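/- Let $A$ be a finite alphabet, $A^+$ the set of finite nonempty words and $A^\infty$ the set of infinite words over $A$; $\mathrm{alph}(w)$ is the set of letters of $w$. First-order sentences over (finite or infinite) words use the order $<$ on positions and a predicate $P_a$ for each $a\in A$. A $\Sigma_2$ sentence is a prenex sentence $\exists x_1\cdots\exists x_p\,\forall y_1\cdots\forall y_q\,\varphi$ with $\varphi$ quantifier-free and $p,q\ge 0$; $\Pi_2$ sentences are defined dually, and $\mathcal B\Sigma_2$ sentences are Boolean combinations of $\Sigma_2$ and $\Pi_2$ sentences. For two finite words, or two infinite words, write $w\lesssim_k w'$ if every $\Sigma_2$ sentence of quantifier rank at most $k$ that holds in $w$ holds in $w'$. For $x\in\{+,\infty\}$ and a map $\beta:A^x\to S$ into a finite set, a nonempty sequence $(s_1,\dots,s_n)$ in $S$ is a $\Sigma_2$-chain for $\beta$ if for every $k\in\mathbb N$ there are $w_1\lesssim_k w_2\lesssim_k\cdots\lesssim_k w_n$ in $A^x$ with $\beta(w_j)=s_j$ for all $j$. The map $\beta$ has bounded $\Sigma_2$-alternation if there are no $s\ne t$ in $S$ such that for every $n\ge 1$ the sequence $(s,t,s,t,\dots,s,t)$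 of length $2n$ is a $\Sigma_2$-chain for $\beta$. An $\omega$-semigroup $(S_+,S_\infty)$ is a semigroup $S_+$ and a set $S_\infty$ with a mixed product $S_+\times S_\infty\to S_\infty$ and an infinite product $(S_+)^{\mathbb N}\to S_\infty$ satisfying all forms of associativity; $(A^+,A^\infty)$ with concatenation is one. A morphism $\alpha:(A^+,A^\infty)\to(S_+,S_\infty)$ of $\omega$-semigroups consists of maps $\alpha_+:A^+\to S_+$ and $\alpha_\infty:A^\infty\to S_\infty$ that respect all products. A set $L\subseteq A^\infty$ is regular if $L=\alpha_\infty^{-1}(F)$ for some morphism $\alpha$ into a finite $\omega$-semigroup and some $F\subseteq S_\infty$. The syntactic morphism of a regular $L$ is the quotient morphism of $(A^+,A^\infty)$ by its syntactic congruence: $u,v\in A^+$ are congruent iff for all $x,y\in A^*$ and $z\in A^+$ we have $xuyz^\infty\in L\Leftrightarrow xvyz^\infty\in L$ and $x(uy)^\infty\in L\Leftrightarrow x(vy)^\infty\in L$; and $u,v\in A^\infty$ are congruent iff for all $x\in A^*$ we have $xu\in L\Leftrightarrow xv\in L$. A morphism $\alpha$ is alphabet compatible if $\alpha_+(u)=\alpha_+(v)$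 implies $\mathrm{alph}(u)=\mathrm{alph}(v)$ for $u,v\in A^+$, and likewise for $\alpha_\infty$ on $A^\infty$; then $\mathrm{alph}(s)$, for $s\in S_+$, denotes the common alphabet of all preimages of $s$ (and $\emptyset$ if there are none). The alphabet completion of $\alpha$ is $\alpha$ itself if $\alpha$ is alphabet compatible, and otherwise the morphism $w\mapsto(\alpha(w),\mathrm{alph}(w))$ into $(S_+\times 2^A,S_\infty\times 2^A)$, where $2^A$ carries union as its products. For $s$ in a finite semigroup, $s^\omega$ denotes its idempotent power, and $s^\infty=sss\cdots$ is the infinite product. **Theorem.** Let $L\subseteq A^\infty$ be a regular $\omega$-language and let $\alpha:(A^+,A^\infty)\to(S_+,S_\infty)$ be the alphabet completion of its syntactic morphism. The following are equivalent: 1. $L$ is definable by a $\mathcal B\Sigma_2$ sentence. 2. $\alpha_\infty$ has bounded $\Sigma_2$-alternation. 3. $\alpha_+$ has bounded $\Sigma_2$-alternation, and $$(s_2(t_2)^\omega)^\infty=(s_2(t_2)^\omega)^\omega\,s_1(t_1)^\infty$$ for all $\Sigma_2$-chains $(s_1,s_2)$ and $(t_1,t_2)$ of length $2$ for $\alpha_+$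 with $\mathrm{alph}(s_1)=\mathrm{alph}(t_1)$. -/

import Mathlib

universe u v

namespace OmegaLang

/-! ### Finite nonempty words and infinite words as labelled linear orders

Finite nonempty words over `A` are the elements of `FreeSemigroup A`; infinite words over `A` are
the functions `ℕ → A`. -/

/-- The list of letters of a finite nonempty word. -/
def letters {A : Type u} (w : FreeSemigroup A) : List A := w.head :: w.tail

/-- A type `W` of words over the alphabet `A`: each word has a set of positions, a strict order on
them, and a labelling of the positions by letters. -/
class WordModel (A : outParam (Type u)) (W : Type v) where
  Pos : W → Type
  lt : ∀ w : W, Pos w → Pos w → Prop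
  label : ∀ w : W, Pos w → A

instance finiteWordModel (A : Type u) : WordModel A (FreeSemigroup A) where
  Pos w := Fin (letters w).length
  lt _ i j := i < j
  label w i := (letters w).get i

instance infiniteWordModel (A : Type u) : WordModel A (ℕ → A) where
  Pos _ := ℕ
  lt _ i j := i < j
  label w i := w i

/-- The alphabet of a word: the set of letters that occur in it. -/
def alph {A : Type u} {W : Type v} [WordModel A W] (w : W) : Set A :=
  Set.range (WordModel.label w)

/-! ### First-order logic over words -/

/-- The relation symbols: a unary symbol for each letter, and a binary symbol for the order. -/
inductive WordRel (A : Type u) : ℕ → Type u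
  | letter (a : A) : WordRel A 1
  | lt : WordRel A 2

/-- The first-order language of words over `A`. -/
def wordLang (A : Type u) : FirstOrder.Language.{0, u} := ⟨fun _ => Empty, WordRel A⟩

/-- A word as a first-order structure on its set of positions. -/
@[reducible]
def wordStructure {A : Type u} {W : Type v} [WordModel A W] (w : W) :
    (wordLang A).Structure (WordModel.Pos w) where
  funMap f _ := Empty.elim f
  RelMap r :=
    match r with
    | WordRel.letter a => fun x => WordModel.label w (x 0) = a
    | WordRel.lt => fun x => WordModel.lt w (x 0) (x 1)

/-- The word `w` satisfies the sentence `φ`. -/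
def Sat {A : Type u} {W : Type v} [WordModel A W] (w : W) (φ : (wordLang A).Sentence) : Prop :=
  @FirstOrder.Language.Sentence.Realize (wordLang A) (WordModel.Pos w) (wordStructure w) φ

/-- Quantifier rank: the length of the longest sequence of nested quantifiers. -/
def qrank {L : FirstOrder.Language.{0, u}} {α : Type} :
    ∀ {n : ℕ}, L.BoundedFormula α n → ℕ
  | _, .falsum => 0
  | _, .equal _ _ => 0
  | _, .rel _ _ => 0
  | _, .imp φ ψ => max (qrank φ) (qrank ψ)
  | _, .all φ => qrank φ + 1

/-- `IsAlt b i φ`: the formula `φ` is in prenex normal form, and its quantifier prefix either has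
at most `i` blocks, the first of which is existential (`b = true`) or universal (`b = false`), or
has fewer than `i` blocks. -/
inductive IsAlt {L : FirstOrder.Language.{0, u}} {α : Type} :
    Bool → ℕ → ∀ {n : ℕ}, L.BoundedFormula α n → Prop
  | qf {b : Bool} {i n : ℕ} {φ : L.BoundedFormula α n} (h : φ.IsQF) : IsAlt b i φ
  | ex {i n : ℕ} {φ : L.BoundedFormula α (n + 1)} (h : IsAlt true (i + 1) φ) :
      IsAlt true (i + 1) φ.ex
  | all {i n : ℕ} {φ : L.BoundedFormula α (n + 1)} (h : IsAlt false (i + 1) φ) :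
      IsAlt false (i + 1) φ.all
  | switch {b : Bool} {i n : ℕ} {φ : L.BoundedFormula α n} (h : IsAlt (!b) i φ) :
      IsAlt b (i + 1) φ

/-- `Σ_i` sentences. -/
def IsSigma {L : FirstOrder.Language.{0, u}} (i : ℕ) (φ : L.Sentence) : Prop := IsAlt true i φ

/-- `Π_i` sentences. -/
def IsPi {L : FirstOrder.Language.{0, u}} (i : ℕ) (φ : L.Sentence) : Prop := IsAlt false i φ

/-- `BΣ_i` sentences: Boolean combinations of `Σ_i` and `Π_i` sentences. -/
inductive IsBSigma {L : FirstOrder.Language.{0, u}} (i : ℕ) : L.Sentence → Prop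
  | sigma {φ : L.Sentence} (h : IsSigma i φ) : IsBSigma i φ
  | pi {φ : L.Sentence} (h : IsPi i φ) : IsBSigma i φ
  | not {φ : L.Sentence} (h : IsBSigma i φ) : IsBSigma i (FirstOrder.Language.BoundedFormula.not φ)
  | inf {φ ψ : L.Sentence} (h : IsBSigma i φ) (h' : IsBSigma i ψ) : IsBSigma i (φ ⊓ ψ)
  | sup {φ ψ : L.Sentence} (h : IsBSigma i φ) (h' : IsBSigma i ψ) : IsBSigma i (φ ⊔ ψ)

/-- A set of words is definable in `BΣ_i`. -/
def BSigmaDefinable {A : Type u} {W : Type v} [WordModel A W] (i : ℕ) (L : Set W) : Prop :=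
  ∃ φ : (wordLang A).Sentence, IsBSigma i φ ∧ L = {w | Sat w φ}

/-- The preorder `w ≲ w'` of level `Σ_i` and rank `k`: every `Σ_i` sentence of rank at most `k`
that holds in `w` holds in `w'`. -/
def SigmaLE {A : Type u} {W : Type v} [WordModel A W] (i k : ℕ) (w w' : W) : Prop :=
  ∀ φ : (wordLang A).Sentence, IsSigma i φ → qrank φ ≤ k → Sat w φ → Sat w' φ

/-! ### `Σ_i`-chains and alternation -/

/-- The set of `Σ_i`-chains for a map `β` defined on words: nonempty sequences `s₁, …, sₙ` such
that for every `k` there are words `w₁ ≲ ⋯ ≲ wₙ` with `β wⱼ = sⱼ` for all `j`. -/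
def sigmaChains {A : Type u} {W : Type v} [WordModel A W] {S : Type*} (i : ℕ) (β : W → S) :
    Set (List S) :=
  {l | l ≠ [] ∧ ∀ k : ℕ, ∃ ws : List W, ws.IsChain (SigmaLE i k) ∧ ws.map β = l}

/-- The pair `(s, t)` is `Σ_i`-alternating for `β`: for all `n ≥ 1` the sequence
`s, t, s, t, …, s, t` of length `2n` is a `Σ_i`-chain. -/
def IsAlternating {A : Type u} {W : Type v} [WordModel A W] {S : Type*} (i : ℕ) (β : W → S)
    (s t : S) : Prop :=
  ∀ n : ℕ, 1 ≤ n → (List.replicate n [s, t]).flatten ∈ sigmaChains i β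

/-- The map `β` has bounded `Σ_i`-alternation. -/
def HasBoundedAlternation {A : Type u} {W : Type v} [WordModel A W] {S : Type*} (i : ℕ)
    (β : W → S) : Prop :=
  ¬ ∃ s t : S, IsAlternating i β s t ∧ s ≠ t

/-! ### Semigroups and ω-semigroups -/

/-- `segProd f i n = f i * f (i + 1) * ⋯ * f (i + n)`. -/
def segProd {S : Type*} [Semigroup S] (f : ℕ → S) (i : ℕ) : ℕ → S
  | 0 => f i
  | n + 1 => segProd f i n * f (i + n + 1)

/-- `sPow s n` is the power `s ^ (n + 1)` in a semigroup. -/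
def sPow {S : Type*} [Semigroup S] (s : S) (n : ℕ) : S := segProd (fun _ => s) 0 n

/-- The least `n` such that `s ^ (n + 1)` is idempotent for all `s` (see
`isIdempotentElem_omegaPow` for its existence in a finite semigroup). -/
noncomputable def omegaExp (S : Type*) [Semigroup S] : ℕ :=
  sInf {n : ℕ | ∀ s : S, IsIdempotentElem (sPow s n)}

/-- The idempotent power `s ^ ω` of an element of a finite semigroup. -/
noncomputable def omegaPow {S : Type*} [Semigroup S] (s : S) : S := sPow s (omegaExp S)

/-- The sequence `s, f 0, f 1, …`. -/
def consSeq {S : Type*} (s : S) (f : ℕ → S) : ℕ → S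
  | 0 => s
  | n + 1 => f n

/-- The pair `(S, T)` is an ω-semigroup, with mixed product `act` and infinite product
`infProd`. -/
class OmegaSemigroup (S : Type*) (T : Type*) [Semigroup S] where
  act : S → T → T
  infProd : (ℕ → S) → T
  mul_act : ∀ (s s' : S) (t : T), act (s * s') t = act s (act s' t)
  act_infProd : ∀ (s : S) (f : ℕ → S), act s (infProd f) = infProd (consSeq s f)
  infProd_regroup : ∀ (f : ℕ → S) (k : ℕ → ℕ), StrictMono k → k 0 = 0 →
    infProd (fun n => segProd f (k n) (k (n + 1) - k n - 1)) = infProd f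

/-- The infinite power `s s s ⋯`. -/
def infPow {S T : Type*} [Semigroup S] [OmegaSemigroup S T] (s : S) : T :=
  OmegaSemigroup.infProd (fun _ => s)

theorem segProd_add {S : Type*} [Semigroup S] (f : ℕ → S) (i m n : ℕ) :
    segProd f i (m + n + 1) = segProd f i m * segProd f (i + m + 1) n := by
  induction n with
  | zero => rfl
  | succ n ih =>
    have h : i + m + 1 + n + 1 = i + (m + n + 1) + 1 := by omega
    simp only [segProd]
    rw [h, ← mul_assoc, ← ih]
    rfl

theorem segProd_consSeq {S : Type*} [Semigroup S] (s : S) (f : ℕ → S) (m : ℕ) :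
    segProd (consSeq s f) 0 (m + 1) = s * segProd f 0 m := by
  induction m with
  | zero => rfl
  | succ m ih =>
    rw [segProd, ih, mul_assoc]
    simp [segProd, consSeq]

theorem segProd_map {S S' : Type*} [Semigroup S] [Semigroup S'] (g : S →ₙ* S') (f : ℕ → S)
    (i n : ℕ) : g (segProd f i n) = segProd (fun j => g (f j)) i n := by
  induction n with
  | zero => rfl
  | succ n ih => simp [segProd, ih]

theorem segProd_regroup {S : Type*} [Semigroup S] (f : ℕ → S) (k : ℕ → ℕ) (hk : StrictMono k)
    (h0 : k 0 = 0) (m : ℕ) :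
    segProd (fun n => segProd f (k n) (k (n + 1) - k n - 1)) 0 m
      = segProd f 0 (k (m + 1) - 1) := by
  induction m with
  | zero => simp [segProd, h0]
  | succ m ih =>
    have h1 : k (m + 1) < k (m + 1 + 1) := hk (by omega)
    have h2 : 0 < k (m + 1) := by
      have : k 0 < k (m + 1) := hk (by omega)
      omega
    rw [segProd, ih]
    have e : k (m + 1 + 1) - 1 = (k (m + 1) - 1) + (k (m + 1 + 1) - k (m + 1) - 1) + 1 := by omega
    have e' : 0 + (k (m + 1) - 1) + 1 = k (m + 1) := by omega
    rw [e, segProd_add, e']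
    simp

theorem sPow_add {S : Type*} [Semigroup S] (s : S) (m n : ℕ) :
    sPow s (m + n + 1) = sPow s m * sPow s n := by
  unfold sPow
  rw [segProd_add]
  congr 1
  generalize 0 + m + 1 = j
  induction n with
  | zero => rfl
  | succ n ih => simp [segProd, ih]

theorem sPow_idem {S : Type*} [Semigroup S] {e : S} (he : IsIdempotentElem e) (n : ℕ) :
    sPow e n = e := by
  induction n with
  | zero => rfl
  | succ n ih =>
    have h := sPow_add e n 0
    simp only [add_zero] at h
    rw [h, ih]
    exact he

theorem sPow_sPow {S : Type*} [Semigroup S] (s : S) (m n : ℕ) :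
    sPow (sPow s m) n = sPow s ((m + 1) * (n + 1) - 1) := by
  induction n with
  | zero => simp [sPow, segProd]
  | succ n ih =>
    have h := sPow_add (sPow s m) n 0
    simp only [add_zero] at h
    have e : (m + 1) * (n + 1 + 1) - 1 = ((m + 1) * (n + 1) - 1) + m + 1 := by
      have : 0 < (m + 1) * (n + 1) := by positivity
      rw [Nat.mul_add (m + 1) (n + 1) 1]
      omega
    rw [h, ih, e, sPow_add]
    rfl

theorem exists_sPow_idem {S : Type*} [Semigroup S] [Finite S] (s : S) :
    ∃ n, IsIdempotentElem (sPow s n) := by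
  obtain ⟨a, b, hab, h⟩ := Finite.exists_ne_map_eq_of_infinite (sPow s)
  wlog hlt : a < b generalizing a b
  · exact this b a hab.symm h.symm (by omega)
  obtain ⟨p, rfl⟩ : ∃ p, b = a + p + 1 := ⟨b - a - 1, by omega⟩
  have step : ∀ c, a ≤ c → sPow s (c + p + 1) = sPow s c := by
    intro c hc
    rcases Nat.eq_or_lt_of_le hc with rfl | hc
    · exact h.symm
    · obtain ⟨d, rfl⟩ : ∃ d, c = a + d + 1 := ⟨c - a - 1, by omega⟩
      rw [show a + d + 1 + p + 1 = (a + p + 1) + d + 1 by omega, sPow_add, ← h, ← sPow_add]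
  have steps : ∀ j c, a ≤ c → sPow s (c + j * (p + 1)) = sPow s c := by
    intro j
    induction j with
    | zero => intro c _; simp
    | succ j ih =>
      intro c hc
      rw [show c + (j + 1) * (p + 1) = (c + j * (p + 1)) + p + 1 by ring, step _ (by omega), ih c hc]
  refine ⟨(a + 1) * (p + 1) - 1, ?_⟩
  have hpos : 0 < (a + 1) * (p + 1) := by positivity
  have hle : a + 1 ≤ (a + 1) * (p + 1) := Nat.le_mul_of_pos_right _ (by omega)
  unfold IsIdempotentElem
  rw [← sPow_add,
    show (a + 1) * (p + 1) - 1 + ((a + 1) * (p + 1) - 1) + 1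
      = ((a + 1) * (p + 1) - 1) + (a + 1) * (p + 1) by omega]
  exact steps _ _ (by omega)

theorem isIdempotentElem_omegaPow {S : Type*} [Semigroup S] [Finite S] (s : S) :
    IsIdempotentElem (omegaPow s) := by
  have hne : {n : ℕ | ∀ s : S, IsIdempotentElem (sPow s n)}.Nonempty := by
    classical
    have := Fintype.ofFinite S
    choose f hf using fun s : S => exists_sPow_idem s
    refine ⟨(∏ s, (f s + 1)) - 1, fun s => ?_⟩
    obtain ⟨c, hc⟩ : f s + 1 ∣ ∏ s, (f s + 1) := Finset.dvd_prod_of_mem _ (Finset.mem_univ s)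
    have hpos : 0 < ∏ s, (f s + 1) := Finset.prod_pos fun i _ => by omega
    obtain ⟨d, rfl⟩ : ∃ d, c = d + 1 := ⟨c - 1, by
      rcases c with _ | c
      · simp at hc; omega
      · rfl⟩
    rw [hc, ← sPow_sPow, sPow_idem (hf s)]
    exact hf s
  exact Nat.sInf_mem hne s

/-! ### The ω-semigroup of finite nonempty and infinite words -/

/-- Prepend a list of letters to an infinite word. -/
def appendInf {A : Type u} (l : List A) (w : ℕ → A) : ℕ → A := fun n =>
  if h : n < l.length then l[n] else w (n - l.length)

/-- The infinite concatenation `f 0 f 1 f 2 ⋯`: since all words are nonempty, its letter in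
position `n` is already present in the finite word `f 0 f 1 ⋯ f n`. -/
def infConcat {A : Type u} (f : ℕ → FreeSemigroup A) : ℕ → A := fun n =>
  (letters (segProd f 0 n)).getD n (f 0).head

theorem letters_mul {A : Type u} (u v : FreeSemigroup A) :
    letters (u * v) = letters u ++ letters v := rfl

theorem lt_length_segProd {A : Type u} (f : ℕ → FreeSemigroup A) (i m : ℕ) :
    m < (letters (segProd f i m)).length := by
  induction m with
  | zero => simp [segProd, letters]
  | succ m ih =>
    have : 0 < (letters (f (i + m + 1))).length := by simp [letters]
    rw [segProd, letters_mul, List.length_append]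
    omega

theorem segProd_prefix {A : Type u} (f : ℕ → FreeSemigroup A) {m m' : ℕ} (h : m ≤ m') :
    letters (segProd f 0 m) <+: letters (segProd f 0 m') := by
  induction m', h using Nat.le_induction with
  | base => exact List.prefix_refl _
  | succ n _ ih => exact ih.trans (List.prefix_append _ _)

theorem infConcat_eq {A : Type u} (f : ℕ → FreeSemigroup A) (m n : ℕ)
    (h : n < (letters (segProd f 0 m)).length) :
    infConcat f n = (letters (segProd f 0 m))[n] := by
  have h' := lt_length_segProd f 0 n
  unfold infConcat
  rw [List.getD_eq_getElem _ _ h']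
  rcases le_total n m with hle | hle
  · exact (segProd_prefix f hle).getElem h'
  · exact ((segProd_prefix f hle).getElem h).symm

theorem infConcat_unique {A : Type u} (f : ℕ → FreeSemigroup A) (w : ℕ → A)
    (hw : ∀ n, ∃ m, ∃ h : n < (letters (segProd f 0 m)).length,
      w n = (letters (segProd f 0 m))[n]) :
    w = infConcat f := by
  funext n
  obtain ⟨m, h, e⟩ := hw n
  rw [e, infConcat_eq f m n h]

theorem appendInf_append {A : Type u} (l l' : List A) (w : ℕ → A) :
    appendInf (l ++ l') w = appendInf l (appendInf l' w) := by
  funext n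
  simp only [appendInf, List.length_append]
  split_ifs with h1 h2 h3 h4 h5
  · exact List.getElem_append_left h2
  · exact List.getElem_append_right (by omega)
  · omega
  · omega
  · omega
  · congr 1
    omega

/-- Concatenation makes finite nonempty words and infinite words into an ω-semigroup. -/
instance wordOmegaSemigroup (A : Type u) : OmegaSemigroup (FreeSemigroup A) (ℕ → A) where
  act u w := appendInf (letters u) w
  infProd := infConcat
  mul_act u v w := by rw [letters_mul, appendInf_append]
  act_infProd u f := by
    apply infConcat_unique
    intro n
    refine ⟨n + 1, by have := lt_length_segProd (consSeq u f) 0 (n + 1); omega, ?_⟩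
    simp only [segProd_consSeq, letters_mul, appendInf]
    split_ifs with h
    · exact (List.getElem_append_left h).symm
    · rw [List.getElem_append_right (by omega)]
      exact infConcat_eq f n _ _
  infProd_regroup f k hk h0 := by
    apply infConcat_unique
    intro n
    refine ⟨k (n + 1) - 1, ?_, ?_⟩
    · have := lt_length_segProd (fun n => segProd f (k n) (k (n + 1) - k n - 1)) 0 n
      rwa [segProd_regroup f k hk h0] at this
    · rw [infConcat_eq _ n n (lt_length_segProd _ _ _)]
      simp only [segProd_regroup f k hk h0]

/-! ### Morphisms and regular ω-languages -/

/-- A morphism of ω-semigroups from the finite nonempty and infinite words over `A` to some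
ω-semigroup `(Plus, Inf)`. -/
structure OmegaMorphism (A : Type u) where
  Plus : Type u
  Inf : Type u
  [semigroup : Semigroup Plus]
  [omegaSemigroup : OmegaSemigroup Plus Inf]
  plus : FreeSemigroup A →ₙ* Plus
  inf : (ℕ → A) → Inf
  map_act : ∀ (x : FreeSemigroup A) (w : ℕ → A),
    inf (OmegaSemigroup.act x w) = OmegaSemigroup.act (plus x) (inf w)
  map_infProd : ∀ f : ℕ → FreeSemigroup A,
    inf (OmegaSemigroup.infProd f) = OmegaSemigroup.infProd (fun n => plus (f n))

attribute [instance] OmegaMorphism.semigroup OmegaMorphism.omegaSemigroup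

/-- An ω-language is regular if it is recognized by a morphism into a finite ω-semigroup. -/
def IsRegular {A : Type u} (L : Set (ℕ → A)) : Prop :=
  ∃ α : OmegaMorphism A, Finite α.Plus ∧ Finite α.Inf ∧ ∃ F : Set α.Inf, L = α.inf ⁻¹' F

/-! ### The syntactic morphism -/

/-- The finite word `u y`, where `u` is nonempty and `y` may be empty. -/
def appendList {A : Type u} (x : FreeSemigroup A) (y : List A) : FreeSemigroup A :=
  ⟨x.head, x.tail ++ y⟩

/-- Syntactic equivalence of finite nonempty words: `u` and `v` are equivalent if
`x u y z^∞ ∈ L ↔ x v y z^∞ ∈ L` and `x (u y)^∞ ∈ L ↔ x (v y)^∞ ∈ L` for all possibly empty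
finite words `x`, `y` and nonempty finite words `z`. -/
def SynEquivPlus {A : Type u} (L : Set (ℕ → A)) (p q : FreeSemigroup A) : Prop :=
  (∀ (x y : List A) (z : FreeSemigroup A),
    appendInf x (appendInf (letters (appendList p y)) (infPow z)) ∈ L ↔
      appendInf x (appendInf (letters (appendList q y)) (infPow z)) ∈ L) ∧
  (∀ x y : List A,
    appendInf x (infPow (appendList p y)) ∈ L ↔ appendInf x (infPow (appendList q y)) ∈ L)

/-- Syntactic equivalence of infinite words: `u` and `v` are equivalent if `x u ∈ L ↔ x v ∈ L`
for every possibly empty finite word `x`. -/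
def SynEquivInf {A : Type u} (L : Set (ℕ → A)) (p q : ℕ → A) : Prop :=
  ∀ x : List A, appendInf x p ∈ L ↔ appendInf x q ∈ L

/-- Syntactic equivalence of finite nonempty words as a setoid. -/
def synPlus {A : Type u} (L : Set (ℕ → A)) : Setoid (FreeSemigroup A) where
  r := SynEquivPlus L
  iseqv :=
    ⟨fun _ => ⟨fun _ _ _ => Iff.rfl, fun _ _ => Iff.rfl⟩,
      fun h => ⟨fun x y z => (h.1 x y z).symm, fun x y => (h.2 x y).symm⟩,
      fun h h' => ⟨fun x y z => (h.1 x y z).trans (h'.1 x y z),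
        fun x y => (h.2 x y).trans (h'.2 x y)⟩⟩

/-- Syntactic equivalence of infinite words as a setoid. -/
def synInf {A : Type u} (L : Set (ℕ → A)) : Setoid (ℕ → A) where
  r := SynEquivInf L
  iseqv := ⟨fun _ _ => Iff.rfl, fun h x => (h x).symm, fun h h' x => (h x).trans (h' x)⟩

theorem appendInf_nil {A : Type u} (w : ℕ → A) : appendInf [] w = w := by
  funext n; simp [appendInf]

theorem letters_appendList {A : Type u} (p : FreeSemigroup A) (y : List A) :
    letters (appendList p y) = letters p ++ y := rfl

theorem letters_injective {A : Type u} {p q : FreeSemigroup A} (h : letters p = letters q) :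
    p = q := by
  cases p; cases q; simp [letters] at h; simp [h]

theorem infPow_eq_append {A : Type u} (p : FreeSemigroup A) :
    (infPow p : ℕ → A) = appendInf (letters p) (infPow p) := by
  have h := OmegaSemigroup.act_infProd (T := ℕ → A) p (fun _ => p)
  have h2 : consSeq p (fun _ => p) = fun _ => p := by funext n; cases n <;> rfl
  rw [h2] at h
  exact h.symm

/-- `(p q)^∞ = p (q p)^∞`. -/
theorem infPow_mul_comm {A : Type u} (p q : FreeSemigroup A) :
    (infPow (p * q) : ℕ → A) = appendInf (letters p) (infPow (q * p)) := by
  have key : ∀ p q : FreeSemigroup A, (infPow (p * q) : ℕ → A)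
      = OmegaSemigroup.infProd (fun n : ℕ => if n % 2 = 0 then p else q) := by
    intro p q
    rw [← OmegaSemigroup.infProd_regroup (T := ℕ → A)
      (fun n : ℕ => if n % 2 = 0 then p else q) (fun n => 2 * n)
      (fun a b h => by simpa using h) (by simp)]
    unfold infPow
    congr 1
    funext n
    have : 2 * (n + 1) - 2 * n - 1 = 1 := by omega
    simp only [this, segProd]
    have h1 : (2 * n) % 2 = 0 := by omega
    simp [h1]
  rw [key p q, key q p]
  have h := OmegaSemigroup.act_infProd (T := ℕ → A) p (fun n : ℕ => if n % 2 = 0 then q else p)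
  refine Eq.trans ?_ h.symm
  congr 1
  funext n
  rcases n with _ | n
  · rfl
  · simp only [consSeq]
    rcases Nat.mod_two_eq_zero_or_one n with h | h
    · have : (n + 1) % 2 = 1 := by omega
      simp [h, this]
    · have : (n + 1) % 2 = 0 := by omega
      simp [h, this]

theorem SynEquivPlus.mul_right {A : Type u} {L : Set (ℕ → A)} {p p' : FreeSemigroup A}
    (h : SynEquivPlus L p p') (q : FreeSemigroup A) : SynEquivPlus L (p * q) (p' * q) := by
  have e : ∀ (r : FreeSemigroup A) (y : List A),
      appendList (r * q) y = appendList r (letters q ++ y) := fun r y =>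
    letters_injective (by simp [letters_appendList, letters_mul])
  refine ⟨fun x y z => ?_, fun x y => ?_⟩
  · rw [e, e]; exact h.1 _ _ _
  · rw [e, e]; exact h.2 _ _

theorem SynEquivPlus.mul_left {A : Type u} {L : Set (ℕ → A)} {q q' : FreeSemigroup A}
    (h : SynEquivPlus L q q') (p : FreeSemigroup A) : SynEquivPlus L (p * q) (p * q') := by
  refine ⟨fun x y z => ?_, fun x y => ?_⟩
  · have e : ∀ r : FreeSemigroup A,
        appendInf x (appendInf (letters (appendList (p * r) y)) (infPow z))
          = appendInf (x ++ letters p) (appendInf (letters (appendList r y)) (infPow z)) := by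
      intro r
      simp only [letters_appendList, letters_mul, appendInf_append]
    rw [e, e]; exact h.1 _ _ _
  · have e : ∀ r : FreeSemigroup A, appendInf x (infPow (appendList (p * r) y))
        = appendInf (x ++ letters p) (infPow (appendList r (y ++ letters p))) := by
      intro r
      have h1 : appendList (p * r) y = p * appendList r y :=
        letters_injective (by simp [letters_appendList, letters_mul])
      have h2 : appendList r (y ++ letters p) = appendList r y * p :=
        letters_injective (by simp [letters_appendList, letters_mul])
      rw [h1, h2, appendInf_append, infPow_mul_comm]
    rw [e, e]; exact h.2 _ _

theorem SynEquivPlus.mul {A : Type u} {L : Set (ℕ → A)} {p p' q q' : FreeSemigroup A}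
    (h : SynEquivPlus L p p') (h' : SynEquivPlus L q q') :
    SynEquivPlus L (p * q) (p' * q') :=
  (synPlus L).iseqv.trans (h.mul_right q) (h'.mul_left p')

theorem SynEquivPlus.segProd {A : Type u} {L : Set (ℕ → A)} {f g : ℕ → FreeSemigroup A}
    (h : ∀ n, SynEquivPlus L (f n) (g n)) (i n : ℕ) :
    SynEquivPlus L (segProd f i n) (segProd g i n) := by
  induction n with
  | zero => exact h i
  | succ n ih => exact ih.mul (h _)

/-- A colouring of the pairs of integers by finitely many colours has an increasing sequence along
which consecutive pairs all have the same colour. -/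
theorem exists_monochromatic {C : Type*} [Finite C] (c : ℕ → ℕ → C) :
    ∃ (k : ℕ → ℕ) (e : C), StrictMono k ∧ 0 < k 0 ∧ ∀ n, c (k n) (k (n + 1)) = e := by
  have hd : ∀ i, ∃ d, ∀ᶠ j in (Filter.hyperfilter ℕ : Filter ℕ), c i j = d := by
    intro i
    obtain ⟨d, hd⟩ := Ultrafilter.eq_pure_of_finite ((Filter.hyperfilter ℕ).map (c i))
    refine ⟨d, ?_⟩
    have : ({d} : Set C) ∈ (Filter.hyperfilter ℕ).map (c i) := by rw [hd]; simp
    exact this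
  choose d hd using hd
  obtain ⟨e, he⟩ := Ultrafilter.eq_pure_of_finite ((Filter.hyperfilter ℕ).map d)
  have he' : ∀ᶠ i in (Filter.hyperfilter ℕ : Filter ℕ), d i = e := by
    have : ({e} : Set C) ∈ (Filter.hyperfilter ℕ).map d := by rw [he]; simp
    exact this
  have hgt : ∀ m, ∀ᶠ i in (Filter.hyperfilter ℕ : Filter ℕ), m < i := by
    intro m
    apply Filter.mem_hyperfilter_of_finite_compl
    exact (Set.finite_Iic m).subset fun x hx => by simpa using hx
  obtain ⟨k0, hk0, hk0'⟩ := (he'.and (hgt 0)).exists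
  have step : ∀ i : {i // d i = e}, ∃ j : {i // d i = e}, i.1 < j.1 ∧ c i.1 j.1 = e := by
    rintro ⟨i, hi⟩
    obtain ⟨j, ⟨hj1, hj2⟩, hj3⟩ := ((he'.and (hgt i)).and (hd i)).exists
    exact ⟨⟨j, hj1⟩, hj2, hj3.trans hi⟩
  choose g hg using step
  refine ⟨fun n => (g^[n] ⟨k0, hk0⟩).1, e, strictMono_nat_of_lt_succ fun n => ?_, hk0', fun n => ?_⟩
  · rw [Function.iterate_succ_apply']; exact (hg _).1
  · simp only [Function.iterate_succ_apply']; exact (hg _).2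

/-- For any finite colouring by a morphism and any infinite product, the product can be cut into a
first block followed by blocks of one colour. -/
theorem exists_factor {A : Type u} (α : OmegaMorphism A) [Finite α.Plus]
    (f g : ℕ → FreeSemigroup A) :
    ∃ a m : ℕ,
      α.inf (infConcat f)
        = α.inf (appendInf (letters (segProd f 0 a)) (infPow (segProd f (a + 1) m))) ∧
      α.inf (infConcat g)
        = α.inf (appendInf (letters (segProd g 0 a)) (infPow (segProd g (a + 1) m))) := by
  obtain ⟨k, e, hk, hk0, he⟩ := exists_monochromatic (fun i j : ℕ =>
    (α.plus (segProd f i (j - i - 1)), α.plus (segProd g i (j - i - 1))))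
  refine ⟨k 0 - 1, k 1 - k 0 - 1, ?_⟩
  have main : ∀ h : ℕ → FreeSemigroup A,
      (∀ n, α.plus (segProd h (k n) (k (n + 1) - k n - 1))
        = α.plus (segProd h (k 0) (k 1 - k 0 - 1))) →
      α.inf (infConcat h) = α.inf (appendInf (letters (segProd h 0 (k 0 - 1)))
        (infPow (segProd h (k 0 - 1 + 1) (k 1 - k 0 - 1)))) := by
    intro h hh
    have hk' : StrictMono (consSeq 0 k) := by
      refine strictMono_nat_of_lt_succ fun n => ?_
      rcases n with _ | n
      · exact hk0
      · exact hk (Nat.lt_succ_self n)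
    have e1 : infConcat h = OmegaSemigroup.infProd (T := ℕ → A)
        (fun n => segProd h (consSeq 0 k n) (consSeq 0 k (n + 1) - consSeq 0 k n - 1)) :=
      (OmegaSemigroup.infProd_regroup (T := ℕ → A) h (consSeq 0 k) hk' rfl).symm
    have e2 : appendInf (letters (segProd h 0 (k 0 - 1)))
        (infPow (segProd h (k 0 - 1 + 1) (k 1 - k 0 - 1)))
        = OmegaSemigroup.infProd (T := ℕ → A) (consSeq (segProd h 0 (k 0 - 1))
          (fun _ => segProd h (k 0 - 1 + 1) (k 1 - k 0 - 1))) :=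
      OmegaSemigroup.act_infProd (T := ℕ → A) (segProd h 0 (k 0 - 1))
        (fun _ => segProd h (k 0 - 1 + 1) (k 1 - k 0 - 1))
    rw [e1, e2, α.map_infProd, α.map_infProd]
    congr 1
    funext n
    rcases n with _ | n
    · rfl
    · have : k 0 - 1 + 1 = k 0 := by omega
      simp only [consSeq, this]
      exact hh n
  exact ⟨main f fun n => by have := (he n).trans (he 0).symm; exact (Prod.ext_iff.1 this).1,
    main g fun n => by have := (he n).trans (he 0).symm; exact (Prod.ext_iff.1 this).2⟩

theorem inf_appendInf_congr {A : Type u} (α : OmegaMorphism A) {w w' : ℕ → A}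
    (h : α.inf w = α.inf w') (x : List A) :
    α.inf (appendInf x w) = α.inf (appendInf x w') := by
  rcases x with _ | ⟨a, l⟩
  · simpa [appendInf_nil] using h
  · have e := α.map_act ⟨a, l⟩ w
    have e' := α.map_act ⟨a, l⟩ w'
    rw [← h] at e'
    exact e.trans e'.symm

theorem synEquivInf_of_inf_eq {A : Type u} {L : Set (ℕ → A)} (α : OmegaMorphism A)
    {F : Set α.Inf} (hL : L = α.inf ⁻¹' F) {w w' : ℕ → A} (h : α.inf w = α.inf w') :
    SynEquivInf L w w' := by
  intro x
  rw [hL, Set.mem_preimage, Set.mem_preimage, inf_appendInf_congr α h]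

theorem SynEquivInf.appendInf {A : Type u} {L : Set (ℕ → A)} {w w' : ℕ → A}
    (h : SynEquivInf L w w') (y : List A) :
    SynEquivInf L (appendInf y w) (OmegaLang.appendInf y w') := by
  intro x
  rw [← appendInf_append, ← appendInf_append]
  exact h _

theorem eq_infConcat_of {A : Type u} (w : ℕ → A) :
    w = infConcat (fun n => FreeSemigroup.of (w n)) := by
  have key : ∀ m, letters (segProd (fun n => FreeSemigroup.of (w n)) 0 m)
      = (List.range (m + 1)).map w := by
    intro m
    induction m with
    | zero => rfl
    | succ m ih =>
      rw [segProd, letters_mul, ih, List.range_succ (n := m + 1), List.map_append]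
      simp [letters]
  apply infConcat_unique
  intro n
  refine ⟨n, lt_length_segProd _ _ _, ?_⟩
  simp [key]

theorem synEquiv_act {A : Type u} {L : Set (ℕ → A)} (hL : IsRegular L)
    {p p' : FreeSemigroup A} {w w' : ℕ → A} (h : SynEquivPlus L p p') (h' : SynEquivInf L w w') :
    SynEquivInf L (OmegaSemigroup.act p w) (OmegaSemigroup.act p' w') := by
  obtain ⟨α, _, _, F, hF⟩ := hL
  refine (synInf L).iseqv.trans ?_ (h'.appendInf (letters p'))
  obtain ⟨a, m, hw, -⟩ := exists_factor α (fun n => FreeSemigroup.of (w n))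
    (fun n => FreeSemigroup.of (w n))
  rw [← eq_infConcat_of] at hw
  have hw := synEquivInf_of_inf_eq α hF hw
  have h1 := hw.appendInf (letters p)
  have h2 := hw.appendInf (letters p')
  refine (synInf L).iseqv.trans h1 ((synInf L).iseqv.trans ?_ ((synInf L).iseqv.symm h2))
  intro x
  rw [← appendInf_append (letters p), ← appendInf_append (letters p')]
  exact h.1 x _ _

theorem synEquiv_infProd {A : Type u} {L : Set (ℕ → A)} (hL : IsRegular L)
    {f g : ℕ → FreeSemigroup A} (h : ∀ n, SynEquivPlus L (f n) (g n)) :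
    SynEquivInf L (infConcat f) (infConcat g) := by
  obtain ⟨α, _, _, F, hF⟩ := id hL
  obtain ⟨a, m, hf, hg⟩ := exists_factor α f g
  refine (synInf L).iseqv.trans (synEquivInf_of_inf_eq α hF hf)
    ((synInf L).iseqv.trans ?_ ((synInf L).iseqv.symm (synEquivInf_of_inf_eq α hF hg)))
  refine synEquiv_act hL (SynEquivPlus.segProd h 0 a) ?_
  intro x
  have h2 := (SynEquivPlus.segProd h (a + 1) m).2 x []
  have e : ∀ r : FreeSemigroup A, appendList r [] = r := fun r =>
    letters_injective (by simp [letters_appendList])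
  rwa [e, e] at h2

/-- The quotient of the finite nonempty words by syntactic equivalence. -/
def SynPlus {A : Type u} (L : Set (ℕ → A)) : Type u := Quotient (synPlus L)

/-- The quotient of the infinite words by syntactic equivalence. -/
def SynInf {A : Type u} (L : Set (ℕ → A)) : Type u := Quotient (synInf L)

instance synSemigroup {A : Type u} (L : Set (ℕ → A)) : Semigroup (SynPlus L) where
  mul := Quotient.map₂ (sa := synPlus L) (sb := synPlus L) (sc := synPlus L) (· * ·)
    fun _ _ h _ _ h' => SynEquivPlus.mul h h'
  mul_assoc s t r := by
    induction s using Quotient.inductionOn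
    induction t using Quotient.inductionOn
    induction r using Quotient.inductionOn
    exact congrArg (Quotient.mk (synPlus L)) (mul_assoc _ _ _)

/-- The quotient map on finite nonempty words. -/
def synPlusHom {A : Type u} (L : Set (ℕ → A)) : FreeSemigroup A →ₙ* SynPlus L where
  toFun p := Quotient.mk (synPlus L) p
  map_mul' _ _ := rfl

/-- The quotient map on infinite words. -/
def synInfMap {A : Type u} (L : Set (ℕ → A)) (w : ℕ → A) : SynInf L := Quotient.mk (synInf L) w

theorem synPlusHom_out {A : Type u} (L : Set (ℕ → A)) (s : SynPlus L) :
    synPlusHom L (Quotient.out (s := synPlus L) s) = s := Quotient.out_eq (s := synPlus L) s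

/-- The infinite product of the syntactic ω-semigroup: multiply representatives. -/
noncomputable def synInfProd {A : Type u} (L : Set (ℕ → A)) (f : ℕ → SynPlus L) : SynInf L :=
  synInfMap L (infConcat fun n => Quotient.out (s := synPlus L) (f n))

theorem synInfProd_map {A : Type u} {L : Set (ℕ → A)} (hL : IsRegular L)
    (f : ℕ → FreeSemigroup A) :
    synInfProd L (fun n => synPlusHom L (f n)) = synInfMap L (infConcat f) :=
  Quotient.sound (s := synInf L) (synEquiv_infProd hL fun n =>
    Quotient.exact (s := synPlus L) (synPlusHom_out L (synPlusHom L (f n))))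

theorem exists_synPlusHom {A : Type u} (L : Set (ℕ → A)) (f : ℕ → SynPlus L) :
    ∃ g : ℕ → FreeSemigroup A, f = fun n => synPlusHom L (g n) :=
  ⟨fun n => Quotient.out (s := synPlus L) (f n), funext fun n => (synPlusHom_out L (f n)).symm⟩

/-- The syntactic ω-semigroup of a regular ω-language. -/
@[reducible]
noncomputable def synOmegaSemigroup {A : Type u} {L : Set (ℕ → A)} (hL : IsRegular L) :
    OmegaSemigroup (SynPlus L) (SynInf L) where
  act := Quotient.map₂ (sa := synPlus L) (sb := synInf L) (sc := synInf L)
    (fun p w => OmegaSemigroup.act p w) fun _ _ h _ _ h' => synEquiv_act hL h h'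
  infProd := synInfProd L
  mul_act s s' t := by
    induction s using Quotient.inductionOn
    induction s' using Quotient.inductionOn
    induction t using Quotient.inductionOn
    exact congrArg (Quotient.mk (synInf L)) (OmegaSemigroup.mul_act _ _ _)
  act_infProd s f := by
    obtain ⟨f, rfl⟩ := exists_synPlusHom L f
    induction s using Quotient.inductionOn with
    | _ p =>
      have e : consSeq (Quotient.mk (synPlus L) p) (fun n => synPlusHom L (f n))
          = fun n => synPlusHom L (consSeq p f n) := by
        funext n; cases n <;> rfl
      refine Eq.trans ?_ (congrArg (synInfProd L) e).symm
      refine Eq.trans ?_ (synInfProd_map hL (consSeq p f)).symm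
      refine Eq.trans (congrArg _ (synInfProd_map hL f)) ?_
      exact congrArg (Quotient.mk (synInf L)) (OmegaSemigroup.act_infProd (T := ℕ → A) p f)
  infProd_regroup f k hk h0 := by
    obtain ⟨f, rfl⟩ := exists_synPlusHom L f
    simp only [← segProd_map]
    rw [synInfProd_map hL, synInfProd_map hL]
    exact congrArg (Quotient.mk (synInf L))
      (OmegaSemigroup.infProd_regroup (T := ℕ → A) f k hk h0)

/-- The syntactic morphism of a regular ω-language. -/
noncomputable def syntacticMorphism {A : Type u} (L : Set (ℕ → A)) (hL : IsRegular L) :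
    OmegaMorphism A :=
  letI := synOmegaSemigroup hL
  { Plus := SynPlus L
    Inf := SynInf L
    plus := synPlusHom L
    inf := synInfMap L
    map_act := fun _ _ => rfl
    map_infProd := fun f => (synInfProd_map hL f).symm }

/-! ### Alphabet compatible morphisms and alphabet completion -/

/-- Words with the same image have the same alphabet. -/
def AlphabetCompatible {A : Type u} (α : OmegaMorphism A) : Prop :=
  (∀ p q : FreeSemigroup A, α.plus p = α.plus q → alph p = alph q) ∧
    (∀ p q : ℕ → A, α.inf p = α.inf q → alph p = alph q)

/-- The subsets of the alphabet, with union as multiplication. -/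
@[ext]
structure Alphabets (A : Type u) where
  toSet : Set A

instance alphabetsSemigroup (A : Type u) : Semigroup (Alphabets A) where
  mul B C := ⟨B.toSet ∪ C.toSet⟩
  mul_assoc _ _ _ := congrArg Alphabets.mk (Set.union_assoc _ _ _)

theorem mem_segProd_alphabets {A : Type u} (f : ℕ → Alphabets A) (i n : ℕ) (a : A) :
    a ∈ (segProd f i n).toSet ↔ ∃ j, i ≤ j ∧ j ≤ i + n ∧ a ∈ (f j).toSet := by
  induction n with
  | zero =>
    constructor
    · intro h
      exact ⟨i, le_rfl, le_rfl, h⟩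
    · rintro ⟨j, h1, h2, h⟩
      obtain rfl : j = i := by omega
      exact h
  | succ n ih =>
    have : a ∈ (segProd f i (n + 1)).toSet ↔
        a ∈ (segProd f i n).toSet ∨ a ∈ (f (i + n + 1)).toSet := Iff.rfl
    rw [this, ih]
    constructor
    · rintro (⟨j, h1, h2, h⟩ | h)
      · exact ⟨j, h1, by omega, h⟩
      · exact ⟨i + n + 1, by omega, by omega, h⟩
    · rintro ⟨j, h1, h2, h⟩
      rcases Nat.lt_or_ge (i + n) j with h3 | h3
      · obtain rfl : j = i + n + 1 := by omega
        exact Or.inr h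
      · exact Or.inl ⟨j, h1, h3, h⟩

instance alphabetsOmegaSemigroup (A : Type u) :
    OmegaSemigroup (Alphabets A) (Alphabets A) where
  act B C := ⟨B.toSet ∪ C.toSet⟩
  infProd f := ⟨⋃ n, (f n).toSet⟩
  mul_act _ _ _ := congrArg Alphabets.mk (Set.union_assoc _ _ _)
  act_infProd B f := by
    refine congrArg Alphabets.mk (Set.ext fun a => ?_)
    simp only [Set.mem_union, Set.mem_iUnion]
    constructor
    · rintro (h | ⟨n, h⟩)
      · exact ⟨0, h⟩
      · exact ⟨n + 1, h⟩
    · rintro ⟨_ | n, h⟩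
      · exact Or.inl h
      · exact Or.inr ⟨n, h⟩
  infProd_regroup f k hk h0 := by
    refine congrArg Alphabets.mk (Set.ext fun a => ?_)
    simp only [Set.mem_iUnion]
    constructor
    · rintro ⟨n, h⟩
      obtain ⟨j, -, -, h⟩ := (mem_segProd_alphabets f _ _ a).1 h
      exact ⟨j, h⟩
    · rintro ⟨j, h⟩
      have hex : ∃ n, j < k (n + 1) := ⟨j, lt_of_lt_of_le (Nat.lt_succ_self j) (hk.le_apply)⟩
      classical
      refine ⟨Nat.find hex, (mem_segProd_alphabets f _ _ a).2 ⟨j, ?_, ?_, h⟩⟩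
      · rcases hn : Nat.find hex with _ | n
        · omega
        · have := Nat.find_min hex (m := n) (by omega)
          omega
      · have := Nat.find_spec hex
        omega

/-- The product of two ω-semigroups. -/
instance prodOmegaSemigroup {S T S' T' : Type*} [Semigroup S] [Semigroup S']
    [OmegaSemigroup S T] [OmegaSemigroup S' T'] : OmegaSemigroup (S × S') (T × T') where
  act s t := (OmegaSemigroup.act s.1 t.1, OmegaSemigroup.act s.2 t.2)
  infProd f := (OmegaSemigroup.infProd fun n => (f n).1, OmegaSemigroup.infProd fun n => (f n).2)
  mul_act s s' t := Prod.ext (OmegaSemigroup.mul_act _ _ _) (OmegaSemigroup.mul_act _ _ _)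
  act_infProd s f := by
    refine Prod.ext ?_ ?_
    · refine (OmegaSemigroup.act_infProd _ _).trans (congrArg _ ?_)
      funext n; cases n <;> rfl
    · refine (OmegaSemigroup.act_infProd _ _).trans (congrArg _ ?_)
      funext n; cases n <;> rfl
  infProd_regroup f k hk h0 := by
    have h1 := fun i n => segProd_map (MulHom.fst S S') f i n
    have h2 := fun i n => segProd_map (MulHom.snd S S') f i n
    simp only [MulHom.coe_fst, MulHom.coe_snd] at h1 h2
    simp only [h1, h2]
    exact Prod.ext (OmegaSemigroup.infProd_regroup _ k hk h0)
      (OmegaSemigroup.infProd_regroup _ k hk h0)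

theorem alph_eq_letters {A : Type u} (p : FreeSemigroup A) : alph p = {a | a ∈ letters p} := by
  ext a
  exact List.mem_iff_get.symm

theorem alph_mul {A : Type u} (p q : FreeSemigroup A) : alph (p * q) = alph p ∪ alph q := by
  ext a
  simp [alph_eq_letters, letters_mul]

theorem alph_act {A : Type u} (p : FreeSemigroup A) (w : ℕ → A) :
    alph (OmegaSemigroup.act p w : ℕ → A) = alph p ∪ alph w := by
  rw [alph_eq_letters]
  ext a
  constructor
  · rintro ⟨n, rfl⟩
    change appendInf (letters p) w n ∈ _
    unfold appendInf
    split_ifs with h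
    · exact Or.inl (List.getElem_mem h)
    · exact Or.inr ⟨_, rfl⟩
  · rintro (h | ⟨(n : ℕ), rfl⟩)
    · obtain ⟨n, hn, rfl⟩ := List.getElem_of_mem h
      refine ⟨n, ?_⟩
      change appendInf (letters p) w n = _
      simp [appendInf, hn]
    · refine ⟨n + (letters p).length, ?_⟩
      change appendInf (letters p) w _ = w n
      simp [appendInf]

theorem alph_infConcat {A : Type u} (f : ℕ → FreeSemigroup A) :
    alph (infConcat f) = ⋃ n, alph (f n) := by
  have hom : ∀ n, (⟨alph (segProd f 0 n)⟩ : Alphabets A)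
      = segProd (fun j => (⟨alph (f j)⟩ : Alphabets A)) 0 n :=
    fun n => segProd_map (S' := Alphabets A)
      ⟨fun p => ⟨alph p⟩, fun p q => congrArg Alphabets.mk (alph_mul p q)⟩ f 0 n
  have hmem : ∀ n a, a ∈ letters (segProd f 0 n) ↔ ∃ j, 0 ≤ j ∧ j ≤ 0 + n ∧ a ∈ alph (f j) := by
    intro n a
    rw [← mem_segProd_alphabets (fun j => (⟨alph (f j)⟩ : Alphabets A)) 0 n a, ← hom n,
      alph_eq_letters]
    rfl
  ext a
  simp only [Set.mem_iUnion]
  constructor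
  · rintro ⟨n, rfl⟩
    change ∃ i, infConcat f n ∈ _
    rw [infConcat_eq f n n (lt_length_segProd _ _ _)]
    obtain ⟨j, -, -, h⟩ := (hmem n _).1 (List.getElem_mem (lt_length_segProd f 0 n))
    exact ⟨j, h⟩
  · rintro ⟨j, h⟩
    obtain ⟨n, hn, rfl⟩ := List.getElem_of_mem ((hmem j a).2 ⟨j, by omega, by omega, h⟩)
    exact ⟨n, infConcat_eq f j n hn⟩

/-- The morphism `w ↦ (α w, alph w)`. -/
def alphabetProduct {A : Type u} (α : OmegaMorphism A) : OmegaMorphism A where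
  Plus := α.Plus × Alphabets A
  Inf := α.Inf × Alphabets A
  plus :=
    { toFun := fun p => (α.plus p, ⟨alph p⟩)
      map_mul' := fun p q =>
        Prod.ext (map_mul α.plus p q) (congrArg Alphabets.mk (alph_mul p q)) }
  inf w := (α.inf w, ⟨alph w⟩)
  map_act p w := Prod.ext (α.map_act p w) (congrArg Alphabets.mk (alph_act p w))
  map_infProd f := Prod.ext (α.map_infProd f) (congrArg Alphabets.mk (alph_infConcat f))

open scoped Classical in
/-- The alphabet completion of `α`: it is `α` itself if `α` is alphabet compatible, and
`w ↦ (α w, alph w)` otherwise. -/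
noncomputable def alphabetCompletion {A : Type u} (α : OmegaMorphism A) : OmegaMorphism A :=
  if AlphabetCompatible α then α else alphabetProduct α

/-- The alphabet of an element `s` of `S₊`, for an alphabet compatible morphism: the common
alphabet of the preimages of `s`, and `∅` if there is none. -/
def content {A : Type u} (α : OmegaMorphism A) (s : α.Plus) : Set A :=
  ⋃ (p : FreeSemigroup A) (_ : α.plus p = s), alph p

theorem content_plus {A : Type u} {α : OmegaMorphism A} (h : AlphabetCompatible α)
    (p : FreeSemigroup A) : content α (α.plus p) = alph p := by
  ext a
  simp only [content, Set.mem_iUnion, exists_prop]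
  exact ⟨fun ⟨q, hq, ha⟩ => h.1 q p hq ▸ ha, fun ha => ⟨p, rfl, ha⟩⟩

theorem alphabetCompletion_compatible {A : Type u} (α : OmegaMorphism A) :
    AlphabetCompatible (alphabetCompletion α) := by
  unfold alphabetCompletion
  split_ifs with h
  · exact h
  · exact ⟨fun p q h => congrArg (fun x => x.2.toSet) h, fun p q h => congrArg (fun x => x.2.toSet) h⟩

end OmegaLang

/-!
The first idea is to replace `Σ₂` sentences by monomials `B₀* a₁ B₁* a₂ ⋯ aₘ Bₘ*`, and the preorders
`≲ₖ` by the preorders `VLE p`, in which `V'` is above `V` if it belongs to all monomials of degree at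
most `p` that contain `V`. Each monomial is defined by a `Σ₂` sentence (`exists_sigma_vmem`).
Conversely the preorder of a large degree refines `≲ₖ` (`exists_vle_imp_sigmaLE`): every word lies in
a monomial of bounded degree that marks the chosen values of the existential quantifiers and whose
pieces between the marked letters are saturated, that is, contain all short words over their
alphabets as scattered subwords (`exists_simulated`), so that they can answer the universal
quantifiers. Finite and infinite words are treated together, as partial words `ℕ → Option A`.
The preorders of monomials are easy to compute with: products and infinite powers are monotone
(`WLE.mul`, `WLE.act`, `WLE.infPow`), and a cut of a word can be copied in any larger word
(`exists_cuts_of_wle`).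

Since there are only finitely many monomials of each degree, the alternation of a map is unbounded
if and only if for every `p` there are two words that are equivalent in the preorder `WLE p` and have
different images (`not_hasBoundedAlternation_iff`). As the equivalence classes are `BΣ₂`-definable
sets, this gives the equivalence of definability and bounded alternation on infinite words.

Suppose that the alternation on infinite words is bounded. If `α₊` separates equivalent finite words
`x` and `x'`, then by the definition of the syntactic congruence some context turns them into
equivalent infinite words that are separated by `α_∞` (`hasBoundedAlternation_plus_of_inf`). If
`u₁ ≲ u₂` and `v₁ ≲ v₂` are words for the two chains, then `(u₂ v₂ᴺ)^∞` and `(u₂ v₂ᴺ)ᴹ u₁ v₁^∞` are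
equivalent for large exponents, because `x^∞ ≲ xⁿ y` whenever all letters of `y` occur in `x`
(`wle_infPow_act_sPow`). This gives the equation (`infPow_eq_of_hasBoundedAlternation_inf`).

For the converse, let `w` and `w'` be equivalent on a high level, and write both as Ramsey
factorizations `u e e e ⋯` with respect to `α₊`. Take factorizations of `w` and `w'` in turn, for long
blocks of levels each, where the factorization of the next level has larger factors at the places of
the former ones and one more factor far behind them (`exists_levels`). An ultrafilter limit over
the level of equivalence gives an infinite scheme `d j i` of images of factors, for factor `i` at
level `j`, in which all finite subsequences in `j` are `Σ₂`-chains (`exists_isScheme`). If the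
alternation of `α₊` is bounded, then `d j i` is eventually a constant `c i`
(`IsScheme.exists_limit`). The equation, applied to the tail of the factorization, expresses the
image of the word at a level by the limits alone (`IsScheme.inf_eq_limit`). By Ramsey's theorem one
can choose places, in blocks for `w` and for `w'` in turn, between which the products of the limits
are constants `x` and `y`. So the images of the two words are `q (x y)^∞` and `q x (y x)^∞`, and these
are equal.
-/

namespace OmegaLang

/-! ### Partial words and monomials -/

/-- The letters that occur in a partial word `V : ℕ → Option A`. -/
def valph {A : Type u} (V : ℕ → Option A) : Set A := {a | ∃ n, V n = some a}

/-- The restriction of a partial word to the positions below `m`. -/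
def vTake {A : Type u} (m : ℕ) (V : ℕ → Option A) : ℕ → Option A :=
  fun n => if n < m then V n else none

/-- The partial word that remains when the first `m` positions are removed. -/
def vDrop {A : Type u} (m : ℕ) (V : ℕ → Option A) : ℕ → Option A := fun n => V (n + m)

/-- Membership of a partial word in the monomial `B* a₁ C₁* a₂ C₂* ⋯ aₙ Cₙ*`, which is encoded by
the set `B` and the list `[(a₁, C₁), …, (aₙ, Cₙ)]`. For infinite words the last star also allows
infinite words. -/
def VMem {A : Type u} : (ℕ → Option A) → Set A → List (A × Set A) → Prop
  | V, B, [] => valph V ⊆ B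
  | V, B, (a, C) :: l => ∃ m, V m = some a ∧ valph (vTake m V) ⊆ B ∧ VMem (vDrop (m + 1) V) C l

/-- The last set of a monomial. -/
def vlast {A : Type u} : Set A → List (A × Set A) → Set A
  | B, [] => B
  | _, (_, C) :: l => vlast C l

/-- `V'` belongs to every monomial of degree at most `p` to which `V` belongs. -/
def VLE {A : Type u} (p : ℕ) (V V' : ℕ → Option A) : Prop :=
  ∀ B l, l.length ≤ p → VMem V B l → VMem V' B l

section
variable {A : Type u}

theorem VLE.refl (p : ℕ) (V : ℕ → Option A) : VLE p V V := fun _ _ _ h => h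

theorem VLE.trans {p : ℕ} {V V' V'' : ℕ → Option A} (h : VLE p V V') (h' : VLE p V' V'') :
    VLE p V V'' := fun B l hl hV => h' B l hl (h B l hl hV)

theorem VLE.mono {p q : ℕ} (hpq : p ≤ q) {V V' : ℕ → Option A} (h : VLE q V V') : VLE p V V' :=
  fun B l hl hV => h B l (hl.trans hpq) hV

theorem vDrop_vDrop (m n : ℕ) (V : ℕ → Option A) : vDrop m (vDrop n V) = vDrop (m + n) V := by
  funext i; simp [vDrop, add_assoc]

theorem vTake_vTake_of_le {m n : ℕ} (h : m ≤ n) (V : ℕ → Option A) :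
    vTake m (vTake n V) = vTake m V := by
  funext i; simp only [vTake]; split_ifs <;> first | rfl | omega

theorem vDrop_vTake (m n : ℕ) (V : ℕ → Option A) :
    vDrop m (vTake (n + m) V) = vTake n (vDrop m V) := by
  funext i; simp [vTake, vDrop]

theorem valph_vTake_mono {m n : ℕ} (h : m ≤ n) (V : ℕ → Option A) :
    valph (vTake m V) ⊆ valph (vTake n V) := by
  rintro a ⟨i, hi⟩
  refine ⟨i, ?_⟩
  simp only [vTake] at hi ⊢
  split_ifs at hi ⊢ <;> first | exact hi | omega

theorem valph_vTake_subset (m : ℕ) (V : ℕ → Option A) : valph (vTake m V) ⊆ valph V := by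
  rintro a ⟨i, hi⟩
  simp only [vTake] at hi
  split_ifs at hi
  exact ⟨i, hi⟩

theorem valph_vDrop_subset (m : ℕ) (V : ℕ → Option A) : valph (vDrop m V) ⊆ valph V := by
  rintro a ⟨i, hi⟩
  exact ⟨_, hi⟩

theorem valph_subset_of_cut (m : ℕ) {V : ℕ → Option A} {B : Set A}
    (h : valph (vTake m V) ⊆ B) (h' : valph (vDrop m V) ⊆ B) : valph V ⊆ B := by
  rintro a ⟨i, hi⟩
  by_cases him : i < m
  · exact h ⟨i, by simp [vTake, him, hi]⟩
  · exact h' ⟨i - m, by simp only [vDrop]; rwa [Nat.sub_add_cancel (by omega)]⟩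

theorem valph_subset_of_letter (m : ℕ) {V : ℕ → Option A} {B : Set A} {a : A}
    (h : valph (vTake m V) ⊆ B) (hm : V m = some a) (ha : a ∈ B)
    (h' : valph (vDrop (m + 1) V) ⊆ B) : valph V ⊆ B := by
  refine valph_subset_of_cut (m + 1) ?_ h'
  rintro b ⟨i, hi⟩
  simp only [vTake] at hi
  split_ifs at hi with him
  rcases Nat.lt_or_ge i m with h1 | h1
  · exact h ⟨i, by simp [vTake, h1, hi]⟩
  · obtain rfl : i = m := by omega
    rw [hm] at hi
    cases hi
    exact ha

theorem valph_vTake_succ {m : ℕ} {V : ℕ → Option A} {B : Set A} {a : A}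
    (h : valph (vTake m V) ⊆ B) (hm : V m = some a) (ha : a ∈ B) :
    valph (vTake (m + 1) V) ⊆ B := by
  refine valph_subset_of_letter m (a := a) (by rwa [vTake_vTake_of_le (by omega)])
    (by simpa [vTake] using hm) ha ?_
  rintro b ⟨i, hi⟩
  simp only [vDrop, vTake] at hi
  split_ifs at hi
  omega

theorem vmem_of_prefix {k : ℕ} {V : ℕ → Option A} {B : Set A} {l : List (A × Set A)}
    (h : valph (vTake k V) ⊆ B) (h' : VMem (vDrop k V) B l) : VMem V B l := by
  match l, h' with
  | [], h' => exact valph_subset_of_cut k h h'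
  | (a, C) :: l, ⟨m, hm, hB, hC⟩ =>
    refine ⟨m + k, hm, ?_, ?_⟩
    · refine valph_subset_of_cut k ?_ ?_
      · rwa [vTake_vTake_of_le (by omega)]
      · rwa [vDrop_vTake]
    · rwa [vDrop_vDrop, show m + 1 + k = m + k + 1 by omega] at hC

/-- Every cut of a partial word cuts the monomials that contain it. -/
theorem vmem_split {V : ℕ → Option A} {B : Set A} {l : List (A × Set A)} (h : VMem V B l)
    (k : ℕ) : ∃ l₁ l₂, l = l₁ ++ l₂ ∧ VMem (vTake k V) B l₁ ∧ VMem (vDrop k V) (vlast B l₁) l₂ := by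
  induction l generalizing V B k with
  | nil => exact ⟨[], [], rfl, (valph_vTake_subset k V).trans h, (valph_vDrop_subset k V).trans h⟩
  | cons x l ih =>
    obtain ⟨a, C⟩ := x
    obtain ⟨m, hm, hB, hC⟩ := h
    rcases Nat.lt_or_ge m k with hk | hk
    · obtain ⟨j, rfl⟩ : ∃ j, k = j + (m + 1) := ⟨k - (m + 1), by omega⟩
      obtain ⟨l₁, l₂, rfl, h1, h2⟩ := ih hC j
      refine ⟨(a, C) :: l₁, l₂, rfl, ⟨m, by simp only [vTake]; rw [if_pos hk]; exact hm, ?_, ?_⟩, ?_⟩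
      · rwa [vTake_vTake_of_le (by omega)]
      · rwa [vDrop_vTake]
      · rwa [vDrop_vDrop] at h2
    · obtain ⟨j, rfl⟩ : ∃ j, m = j + k := ⟨m - k, by omega⟩
      refine ⟨[], _, rfl, (valph_vTake_mono (by omega) V).trans hB, j, hm, ?_, ?_⟩
      · rw [← vDrop_vTake]
        exact (valph_vDrop_subset _ _).trans hB
      · rwa [vDrop_vDrop, show j + 1 + k = j + k + 1 by omega]

theorem vmem_join {V : ℕ → Option A} {B : Set A} {l₁ l₂ : List (A × Set A)} {k : ℕ}
    (h₁ : VMem (vTake k V) B l₁) (h₂ : VMem (vDrop k V) (vlast B l₁) l₂) :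
    VMem V B (l₁ ++ l₂) := by
  induction l₁ generalizing V B k with
  | nil => exact vmem_of_prefix h₁ h₂
  | cons x l ih =>
    obtain ⟨a, C⟩ := x
    obtain ⟨m, hm, hB, hC⟩ := h₁
    simp only [vTake] at hm
    split_ifs at hm with hk
    obtain ⟨j, rfl⟩ : ∃ j, k = j + (m + 1) := ⟨k - (m + 1), by omega⟩
    rw [vTake_vTake_of_le (by omega)] at hB
    rw [vDrop_vTake] at hC
    exact ⟨m, hm, hB, ih hC (by rwa [vDrop_vDrop])⟩

theorem vmem_split_letter {V : ℕ → Option A} {B C : Set A} {l₁ l₂ : List (A × Set A)} {a : A}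
    (h : VMem V B (l₁ ++ (a, C) :: l₂)) :
    ∃ m, V m = some a ∧ VMem (vTake m V) B l₁ ∧ VMem (vDrop (m + 1) V) C l₂ := by
  induction l₁ generalizing V B with
  | nil => exact h
  | cons x l ih =>
    obtain ⟨b, D⟩ := x
    obtain ⟨m, hm, hB, hC⟩ := h
    obtain ⟨j, hj, h1, h2⟩ := ih hC
    refine ⟨j + (m + 1), hj, ⟨m, ?_, ?_, ?_⟩, ?_⟩
    · simp only [vTake]; rw [if_pos (by omega)]; exact hm
    · rwa [vTake_vTake_of_le (by omega)]
    · rwa [vDrop_vTake]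
    · rwa [vDrop_vDrop, show j + 1 + (m + 1) = j + (m + 1) + 1 by omega] at h2

theorem vmem_join_letter {V : ℕ → Option A} {B C : Set A} {l₁ l₂ : List (A × Set A)} {a : A}
    {m : ℕ} (hm : V m = some a) (h₁ : VMem (vTake m V) B l₁)
    (h₂ : VMem (vDrop (m + 1) V) C l₂) : VMem V B (l₁ ++ (a, C) :: l₂) := by
  refine vmem_join h₁ ⟨0, by simpa [vDrop] using hm, ?_, ?_⟩
  · rintro b ⟨i, hi⟩; simp [vTake] at hi
  · rwa [vDrop_vDrop, show 0 + 1 + m = m + 1 by omega]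

/-- Concatenation is monotone. -/
theorem VLE.concat {p : ℕ} {V V' : ℕ → Option A} (k k' : ℕ)
    (h₁ : VLE p (vTake k V) (vTake k' V')) (h₂ : VLE p (vDrop k V) (vDrop k' V')) :
    VLE p V V' := by
  intro B l hl h
  obtain ⟨l₁, l₂, rfl, h3, h4⟩ := vmem_split h k
  rw [List.length_append] at hl
  exact vmem_join (h₁ _ _ (by omega) h3) (h₂ _ _ (by omega) h4)

theorem VLE.valph_eq {p : ℕ} (hp : 1 ≤ p) {V V' : ℕ → Option A} (h : VLE p V V') :
    valph V = valph V' := by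
  apply Set.Subset.antisymm
  · rintro a ⟨n, hn⟩
    obtain ⟨m, hm, -⟩ := h Set.univ [(a, Set.univ)] (by simpa using hp)
      ⟨n, hn, Set.subset_univ _, Set.subset_univ _⟩
    exact ⟨m, hm⟩
  · exact h (valph V) [] (by simp) (fun _ => id)

/-- A partial word in two monomials is in a monomial that is contained in both. -/
theorem exists_vmem_inter {V : ℕ → Option A} {B₁ B₂ : Set A} {l₁ l₂ : List (A × Set A)}
    (h₁ : VMem V B₁ l₁) (h₂ : VMem V B₂ l₂) :
    ∃ B l, B ⊆ B₁ ∧ B ⊆ B₂ ∧ l.length ≤ l₁.length + l₂.length ∧ VMem V B l ∧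
      ∀ V', VMem V' B l → VMem V' B₁ l₁ ∧ VMem V' B₂ l₂ := by
  induction hn : l₁.length + l₂.length using Nat.strong_induction_on
    generalizing V B₁ B₂ l₁ l₂ with
  | _ n ih =>
  -- The case in which the first marked letter of the first monomial comes first.
  have first : ∀ (B₁ B₂ : Set A) (a : A) (C : Set A) (l l' : List (A × Set A)) (m : ℕ),
      V m = some a → valph (vTake m V) ⊆ B₁ → VMem (vDrop (m + 1) V) C l →
      valph (vTake m V) ⊆ B₂ → a ∈ B₂ → VMem (vDrop (m + 1) V) B₂ l' →
      l.length + 1 + l'.length = n →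
      ∃ B L, B ⊆ B₁ ∧ B ⊆ B₂ ∧ L.length ≤ n ∧ VMem V B L ∧
        ∀ V', VMem V' B L → VMem V' B₁ ((a, C) :: l) ∧ VMem V' B₂ l' := by
    intro B₁ B₂ a C l l' m hm h1 h2 h3 ha h4 hlen
    obtain ⟨D, L, hD1, hD2, hL, hV, hV'⟩ := ih _ (by omega) h2 h4 rfl
    refine ⟨B₁ ∩ B₂, (a, D) :: L, Set.inter_subset_left, Set.inter_subset_right, ?_,
      ⟨m, hm, Set.subset_inter h1 h3, hV⟩, ?_⟩
    · rw [List.length_cons]; omega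
    · rintro V' ⟨i, hi, hB, hL'⟩
      obtain ⟨h5, h6⟩ := hV' _ hL'
      refine ⟨⟨i, hi, hB.trans Set.inter_subset_left, h5⟩, ?_⟩
      exact vmem_of_prefix (valph_vTake_succ (hB.trans Set.inter_subset_right) hi ha) h6
  have mem : ∀ {B : Set A} {m n : ℕ} {a : A}, valph (vTake n V) ⊆ B → V m = some a → m < n →
      a ∈ B := fun hB hm hmn => hB ⟨_, by simp only [vTake]; rw [if_pos hmn]; exact hm⟩
  have later : ∀ {B C : Set A} {m n : ℕ} {a : A} {l : List (A × Set A)}, m < n →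
      V n = some a → valph (vTake n V) ⊆ B → VMem (vDrop (n + 1) V) C l →
      VMem (vDrop (m + 1) V) B ((a, C) :: l) := by
    intro B C m n a l hmn hn hB hl
    obtain ⟨j, rfl⟩ : ∃ j, n = j + (m + 1) := ⟨n - (m + 1), by omega⟩
    refine ⟨j, hn, ?_, ?_⟩
    · rw [← vDrop_vTake]; exact (valph_vDrop_subset _ _).trans hB
    · rwa [vDrop_vDrop, show j + 1 + (m + 1) = j + (m + 1) + 1 by omega]
  have nilr : ∀ {B₁ B₂ : Set A} {a C l}, VMem V B₁ ((a, C) :: l) → VMem V B₂ [] →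
      l.length + 1 + 0 = n →
      ∃ B L, B ⊆ B₁ ∧ B ⊆ B₂ ∧ L.length ≤ n ∧ VMem V B L ∧
        ∀ V', VMem V' B L → VMem V' B₁ ((a, C) :: l) ∧ VMem V' B₂ [] := by
    rintro B₁ B₂ a C l ⟨m, hm, hB, hC⟩ h₂ hlen
    exact first B₁ B₂ a C l [] m hm hB hC ((valph_vTake_subset _ _).trans h₂) (h₂ ⟨m, hm⟩)
      ((valph_vDrop_subset _ _).trans h₂) hlen
  match l₁, l₂, h₁, h₂, hn with
  | [], [], h₁, h₂, _ =>
    exact ⟨B₁ ∩ B₂, [], Set.inter_subset_left, Set.inter_subset_right, by simp,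
      Set.subset_inter h₁ h₂,
      fun V' h => ⟨Set.Subset.trans h Set.inter_subset_left,
        Set.Subset.trans h Set.inter_subset_right⟩⟩
  | (a, C) :: l, [], h₁, h₂, hn => exact nilr h₁ h₂ (by simpa using hn)
  | [], (a, C) :: l, h₁, h₂, hn =>
    obtain ⟨B, L, h3, h4, h5, h6, h7⟩ := nilr h₂ h₁ (by simpa using hn)
    exact ⟨B, L, h4, h3, h5, h6, fun V' h => (h7 V' h).symm⟩
  | (a₁, C₁) :: l₁, (a₂, C₂) :: l₂, ⟨m₁, hm₁, hB₁, hC₁⟩, ⟨m₂, hm₂, hB₂, hC₂⟩, hn =>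
    simp only [List.length_cons] at hn
    rcases lt_trichotomy m₁ m₂ with hlt | rfl | hlt
    · exact first B₁ B₂ a₁ C₁ l₁ ((a₂, C₂) :: l₂) m₁ hm₁ hB₁ hC₁
        ((valph_vTake_mono hlt.le V).trans hB₂) (mem hB₂ hm₁ hlt) (later hlt hm₂ hB₂ hC₂)
        (by simp only [List.length_cons]; omega)
    · rw [hm₁] at hm₂
      cases hm₂
      obtain ⟨D, L, hD1, hD2, hL, hV, hV'⟩ := ih _ (by omega)
        hC₁ hC₂ rfl
      refine ⟨B₁ ∩ B₂, (a₁, D) :: L, Set.inter_subset_left, Set.inter_subset_right, ?_,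
        ⟨m₁, hm₁, Set.subset_inter hB₁ hB₂, hV⟩, ?_⟩
      · simp only [List.length_cons]; omega
      · rintro V' ⟨i, hi, hB, hL'⟩
        exact ⟨⟨i, hi, hB.trans Set.inter_subset_left, (hV' _ hL').1⟩,
          ⟨i, hi, hB.trans Set.inter_subset_right, (hV' _ hL').2⟩⟩
    · obtain ⟨B, L, h3, h4, h5, h6, h7⟩ :=
        first B₂ B₁ a₂ C₂ l₂ ((a₁, C₁) :: l₁) m₂ hm₂ hB₂ hC₂
        ((valph_vTake_mono hlt.le V).trans hB₁) (mem hB₁ hm₂ hlt) (later hlt hm₁ hB₁ hC₁)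
        (by simp only [List.length_cons]; omega)
      exact ⟨B, L, h4, h3, h5, h6, fun V' h => (h7 V' h).symm⟩

/-- The monomials of degree at most `p`. -/
def monomials (A : Type u) (p : ℕ) : Set (Set A × List (A × Set A)) := {M | M.2.length ≤ p}

theorem finite_monomials [Finite A] (p : ℕ) : (monomials A p).Finite := by
  have h : {l : List (A × Set A) | l.length ≤ p}.Finite := List.finite_length_le _ _
  exact ((Set.finite_univ (α := Set A)).prod h).subset fun M hM => ⟨Set.mem_univ _, hM⟩

/-- A partial word is in a monomial, of bounded degree, all of whose elements are above it at
level `p`. -/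
theorem exists_characteristic_vmem (A : Type u) [Finite A] (p : ℕ) :
    ∃ P, ∀ V : ℕ → Option A, ∃ B l, l.length ≤ P ∧ VMem V B l ∧
      ∀ V', VMem V' B l → VLE p V V' := by
  refine ⟨(finite_monomials (A := A) p).toFinset.card * p, fun V => ?_⟩
  have key : ∀ s : Finset (Set A × List (A × Set A)), ↑s ⊆ monomials A p →
      ∃ B l, l.length ≤ s.card * p ∧ VMem V B l ∧
        ∀ V', VMem V' B l → ∀ M ∈ s, VMem V M.1 M.2 → VMem V' M.1 M.2 := by
    classical
    intro s
    induction s using Finset.induction_on with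
    | empty => exact fun _ => ⟨Set.univ, [], by simp, Set.subset_univ _, by simp⟩
    | insert M s hM ih =>
      intro hs
      rw [Finset.coe_insert, Set.insert_subset_iff] at hs
      obtain ⟨B, l, hl, hV, h⟩ := ih hs.2
      rw [Finset.card_insert_of_notMem hM, add_mul, one_mul]
      by_cases hVM : VMem V M.1 M.2
      · obtain ⟨D, L, -, -, hL, hVD, hD⟩ := exists_vmem_inter hV hVM
        have hMp : M.2.length ≤ p := hs.1
        refine ⟨D, L, by omega, hVD, fun V' hV' M' hM' hVM' => ?_⟩
        rcases Finset.mem_insert.1 hM' with rfl | hM'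
        · exact (hD V' hV').2
        · exact h V' (hD V' hV').1 M' hM' hVM'
      · refine ⟨B, l, by omega, hV, fun V' hV' M' hM' hVM' => ?_⟩
        rcases Finset.mem_insert.1 hM' with rfl | hM'
        · exact absurd hVM' hVM
        · exact h V' hV' M' hM' hVM'
  obtain ⟨B, l, hl, hV, h⟩ := key (finite_monomials p).toFinset (by simp)
  exact ⟨B, l, hl, hV, fun V' hV' C L hL hVC => h V' hV' (C, L) (by simpa [monomials] using hL) hVC⟩

/-- A cut of `V` in front of a letter can be copied in any `V'` above `V`. -/
theorem exists_cut_of_vle (A : Type u) [Finite A] (p : ℕ) :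
    ∃ P, ∀ V V' : ℕ → Option A, VLE P V V' → ∀ m, V m ≠ none →
      ∃ m', V' m' ≠ none ∧ VLE p (vTake m V) (vTake m' V') ∧ VLE p (vDrop m V) (vDrop m' V') := by
  obtain ⟨P, hP⟩ := exists_characteristic_vmem A p
  refine ⟨P + 1 + P, fun V V' hVV' m hm => ?_⟩
  obtain ⟨a, ha⟩ := Option.ne_none_iff_exists'.1 hm
  obtain ⟨B, l, hl, hV, h⟩ := hP (vTake m V)
  obtain ⟨C, k, hk, hV2, h2⟩ := hP (vDrop (m + 1) V)
  obtain ⟨m', hm', h3, h4⟩ := vmem_split_letter (hVV' B (l ++ (a, C) :: k)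
    (by simp only [List.length_append, List.length_cons]; omega) (vmem_join_letter ha hV hV2))
  refine ⟨m', by simp [hm'], h _ h3, VLE.concat 1 1 ?_ ?_⟩
  · have e : ∀ (U : ℕ → Option A) (n : ℕ), U n = some a →
        vTake 1 (vDrop n U) = fun i => if i = 0 then some a else none := by
      intro U n hn
      funext i
      simp only [vTake, vDrop, Nat.lt_one_iff]
      split_ifs with hi
      · subst hi; simpa using hn
      · rfl
    rw [e V m ha, e V' m' hm']
    exact VLE.refl _ _
  · rw [vDrop_vDrop, vDrop_vDrop, add_comm 1 m, add_comm 1 m']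
    exact h2 _ h4

end

/-! ### Partial isomorphisms between partial words -/

/-- `G` is a partial isomorphism between `V` and `V'`: a set of pairs of positions that preserves
letters and the order. -/
def PIso {A : Type u} (V V' : ℕ → Option A) (G : Set (ℕ × ℕ)) : Prop :=
  (∀ x ∈ G, ∃ a, V x.1 = some a ∧ V' x.2 = some a) ∧
    ∀ x ∈ G, ∀ y ∈ G, (x.1 < y.1 ↔ x.2 < y.2)

/-- `G` is a partial isomorphism such that any `k` positions of `V'` can simultaneously be added to
its range. -/
def Sim1 {A : Type u} (k : ℕ) (V V' : ℕ → Option A) (G : Set (ℕ × ℕ)) : Prop :=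
  ∀ F : Finset ℕ, F.card ≤ k → (∀ n ∈ F, V' n ≠ none) →
    ∃ H, G ⊆ H ∧ PIso V V' H ∧ ∀ n ∈ F, ∃ m, (m, n) ∈ H

/-- The union of a set of pairs of positions before `m` and `m'`, the pair `(m, m')`, and a set of
pairs of positions counted from `m + 1` and `m' + 1`. -/
def gluePairs (m m' : ℕ) (G₁ G₂ : Set (ℕ × ℕ)) : Set (ℕ × ℕ) :=
  {x | x ∈ G₁ ∨ x = (m, m') ∨ ∃ y ∈ G₂, x = (y.1 + (m + 1), y.2 + (m' + 1))}

/-- `V` is in a monomial of degree at most `P` such that `V'` can be simulated by `V`, in the sense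
of `Sim1 q`, for all `V'` in the monomial, with the positions `F` of `V` in the domain. -/
def Simulated {A : Type u} (q P : ℕ) (V : ℕ → Option A) (F : Finset ℕ) : Prop :=
  ∃ B l, l.length ≤ P ∧ VMem V B l ∧
    ∀ V', VMem V' B l → ∃ G, Sim1 q V V' G ∧ ∀ n ∈ F, ∃ m, (n, m) ∈ G

/-- Every word of length `q` over `B` is a scattered subword of `V`. -/
def Saturated {A : Type u} : ℕ → (ℕ → Option A) → Set A → Prop
  | 0, _, _ => True
  | q + 1, V, B => ∀ a ∈ B, ∃ m, V m = some a ∧ Saturated q (vDrop (m + 1) V) B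

section
variable {A : Type u}

theorem Sim1.mono {k k' : ℕ} (h : k ≤ k') {V V' : ℕ → Option A} {G : Set (ℕ × ℕ)}
    (hG : Sim1 k' V V' G) : Sim1 k V V' G := fun F hF hF' => hG F (hF.trans h) hF'

theorem Sim1.pIso {k : ℕ} {V V' : ℕ → Option A} {G : Set (ℕ × ℕ)} (hG : Sim1 k V V' G) :
    PIso V V' G := by
  obtain ⟨H, hGH, hH, -⟩ := hG ∅ (by simp) (by simp)
  exact ⟨fun x hx => hH.1 x (hGH hx), fun x hx y hy => hH.2 x (hGH hx) y (hGH hy)⟩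

theorem lt_of_vTake_eq_some {m n : ℕ} {V : ℕ → Option A} {a : A} (h : vTake m V n = some a) :
    n < m ∧ V n = some a := by
  simp only [vTake] at h
  split_ifs at h with hn
  exact ⟨hn, h⟩

theorem PIso.glue {m m' : ℕ} {V V' : ℕ → Option A} {a : A} (hm : V m = some a)
    (hm' : V' m' = some a) {G₁ G₂ : Set (ℕ × ℕ)} (h₁ : PIso (vTake m V) (vTake m' V') G₁)
    (h₂ : PIso (vDrop (m + 1) V) (vDrop (m' + 1) V') G₂) :
    PIso V V' (gluePairs m m' G₁ G₂) := by
  have b : ∀ x ∈ G₁, x.1 < m ∧ x.2 < m' := by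
    intro x hx
    obtain ⟨b, hb, hb'⟩ := h₁.1 x hx
    exact ⟨(lt_of_vTake_eq_some hb).1, (lt_of_vTake_eq_some hb').1⟩
  constructor
  · rintro x (hx | rfl | ⟨y, hy, rfl⟩)
    · obtain ⟨b, hb, hb'⟩ := h₁.1 x hx
      exact ⟨b, (lt_of_vTake_eq_some hb).2, (lt_of_vTake_eq_some hb').2⟩
    · exact ⟨a, hm, hm'⟩
    · exact h₂.1 y hy
  · rintro x (hx | rfl | ⟨x, hx, rfl⟩) y (hy | rfl | ⟨y, hy, rfl⟩)
    · exact h₁.2 x hx y hy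
    · have := b x hx; simp only; omega
    · have := b x hx; simp only; omega
    · have := b y hy; simp only; omega
    · simp
    · simp only; omega
    · have := b y hy; simp only; omega
    · simp only; omega
    · have := h₂.2 x hx y hy; simp only; omega

theorem Sim1.glue {q m m' : ℕ} {V V' : ℕ → Option A} {a : A} (hm : V m = some a)
    (hm' : V' m' = some a) {G₁ G₂ : Set (ℕ × ℕ)} (h₁ : Sim1 q (vTake m V) (vTake m' V') G₁)
    (h₂ : Sim1 q (vDrop (m + 1) V) (vDrop (m' + 1) V') G₂) :
    Sim1 q V V' (gluePairs m m' G₁ G₂) := by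
  classical
  intro F hF hF'
  obtain ⟨H₁, hG₁, hH₁, hF₁⟩ := h₁ (F.filter (· < m')) ((Finset.card_filter_le _ _).trans hF) (by
    intro n hn
    obtain ⟨h1, h2⟩ := Finset.mem_filter.1 hn
    simpa [vTake, h2] using hF' n h1)
  obtain ⟨H₂, hG₂, hH₂, hF₂⟩ := h₂ ((F.filter (m' < ·)).image (· - (m' + 1)))
    (Finset.card_image_le.trans ((Finset.card_filter_le _ _).trans hF)) (by
      intro n hn
      obtain ⟨i, hi, rfl⟩ := Finset.mem_image.1 hn
      obtain ⟨h1, h2⟩ := Finset.mem_filter.1 hi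
      simp only [vDrop]
      rw [Nat.sub_add_cancel (by omega)]
      exact hF' i h1)
  refine ⟨gluePairs m m' H₁ H₂, ?_, PIso.glue hm hm' hH₁ hH₂, fun n hn => ?_⟩
  · rintro x (hx | rfl | ⟨y, hy, rfl⟩)
    · exact Or.inl (hG₁ hx)
    · exact Or.inr (Or.inl rfl)
    · exact Or.inr (Or.inr ⟨y, hG₂ hy, rfl⟩)
  · rcases lt_trichotomy n m' with h | rfl | h
    · obtain ⟨i, hi⟩ := hF₁ n (Finset.mem_filter.2 ⟨hn, h⟩)
      exact ⟨i, Or.inl hi⟩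
    · exact ⟨m, Or.inr (Or.inl rfl)⟩
    · obtain ⟨i, hi⟩ := hF₂ (n - (m' + 1))
        (Finset.mem_image.2 ⟨n, Finset.mem_filter.2 ⟨hn, h⟩, rfl⟩)
      refine ⟨i + (m + 1), Or.inr (Or.inr ⟨_, hi, ?_⟩)⟩
      simp only [Prod.mk.injEq, true_and]
      omega

theorem Simulated.glue {q P₁ P₂ m : ℕ} {V : ℕ → Option A} {a : A} (hm : V m = some a)
    {F₁ F₂ F : Finset ℕ} (h₁ : Simulated q P₁ (vTake m V) F₁)
    (h₂ : Simulated q P₂ (vDrop (m + 1) V) F₂)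
    (hF : ∀ n ∈ F, n ∈ F₁ ∨ n = m ∨ ∃ i ∈ F₂, n = i + (m + 1)) :
    Simulated q (P₁ + 1 + P₂) V F := by
  obtain ⟨B, l, hl, hV, h⟩ := h₁
  obtain ⟨B', l', hl', hV', h'⟩ := h₂
  refine ⟨B, l ++ (a, B') :: l', by simp only [List.length_append, List.length_cons]; omega,
    vmem_join_letter hm hV hV', fun V' hmem => ?_⟩
  obtain ⟨m', hm', h3, h4⟩ := vmem_split_letter hmem
  obtain ⟨G₁, hG₁, hF₁⟩ := h _ h3
  obtain ⟨G₂, hG₂, hF₂⟩ := h' _ h4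
  refine ⟨_, hG₁.glue hm hm' hG₂, fun n hn => ?_⟩
  rcases hF n hn with h5 | rfl | ⟨i, hi, rfl⟩
  · obtain ⟨j, hj⟩ := hF₁ n h5
    exact ⟨j, Or.inl hj⟩
  · exact ⟨m', Or.inr (Or.inl rfl)⟩
  · obtain ⟨j, hj⟩ := hF₂ i hi
    exact ⟨j + (m' + 1), Or.inr (Or.inr ⟨_, hj, rfl⟩)⟩

theorem Simulated.mono {q P P' : ℕ} (hP : P ≤ P') {V : ℕ → Option A} {F : Finset ℕ}
    (h : Simulated q P V F) : Simulated q P' V F := by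
  obtain ⟨B, l, hl, h⟩ := h
  exact ⟨B, l, hl.trans hP, h⟩

theorem Saturated.of_vDrop {q n : ℕ} {V : ℕ → Option A} {B : Set A}
    (h : Saturated q (vDrop n V) B) : Saturated q V B := by
  cases q with
  | zero => trivial
  | succ q =>
    intro a ha
    obtain ⟨m, hm, h⟩ := h a ha
    refine ⟨m + n, hm, ?_⟩
    rwa [vDrop_vDrop, show m + 1 + n = m + n + 1 by omega] at h

/-- A saturated partial word simulates all partial words over the same letters, since the letters
at any `q` positions of the latter form a scattered subword of the former. -/
theorem Saturated.sim1 {q : ℕ} {V V' : ℕ → Option A} {B : Set A} (h : Saturated q V B)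
    (hV' : valph V' ⊆ B) : Sim1 q V V' ∅ := by
  classical
  induction q generalizing V V' with
  | zero =>
    intro F hF _
    obtain rfl : F = ∅ := by simpa using hF
    exact ⟨∅, subset_rfl, ⟨by simp, by simp⟩, by simp⟩
  | succ q ih =>
    intro F hF hF'
    rcases F.eq_empty_or_nonempty with rfl | hne
    · exact ⟨∅, subset_rfl, ⟨by simp, by simp⟩, by simp⟩
    have hmin := F.min'_mem hne
    set m' := F.min' hne with hm'
    obtain ⟨a, ha⟩ := Option.ne_none_iff_exists'.1 (hF' m' hmin)
    obtain ⟨m, hm, hs⟩ := h a (hV' ⟨m', ha⟩)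
    obtain ⟨H, -, hH, hFH⟩ := ih hs ((valph_vDrop_subset (m' + 1) V').trans hV')
      ((F.erase m').image (· - (m' + 1)))
      (Finset.card_image_le.trans (by rw [Finset.card_erase_of_mem hmin]; omega)) (by
        intro n hn
        obtain ⟨i, hi, rfl⟩ := Finset.mem_image.1 hn
        obtain ⟨h1, h2⟩ := Finset.mem_erase.1 hi
        have := F.min'_le i h2
        simp only [vDrop]
        rw [Nat.sub_add_cancel (by omega)]
        exact hF' i h2)
    refine ⟨gluePairs m m' ∅ H, Set.empty_subset _,
      PIso.glue hm ha ⟨by simp, by simp⟩ hH, fun n hn => ?_⟩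
    by_cases hnm : n = m'
    · exact ⟨m, Or.inr (Or.inl (by rw [hnm]))⟩
    · have := F.min'_le n hn
      obtain ⟨i, hi⟩ := hFH (n - (m' + 1))
        (Finset.mem_image.2 ⟨n, Finset.mem_erase.2 ⟨hnm, hn⟩, rfl⟩)
      refine ⟨i + (m + 1), Or.inr (Or.inr ⟨_, hi, ?_⟩)⟩
      simp only [Prod.mk.injEq, true_and]
      omega

/-- Every partial word over at most `c` letters is cut by boundedly many letters into pieces that
are saturated over some alphabet: if it is not saturated itself, then it is a product of fewer than
`q` arches, and each arch without its last letter misses some letter. -/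
theorem exists_simulated_of_card_le (q c : ℕ) :
    ∃ P, ∀ (V : ℕ → Option A) (B : Finset A), B.card ≤ c → valph V ⊆ B → Simulated q P V ∅ := by
  classical
  have sat : ∀ (V : ℕ → Option A) (B : Finset A), valph V ⊆ B → Saturated q V B →
      Simulated q 0 V ∅ := fun V B hB hs =>
    ⟨B, [], le_rfl, hB, fun V' hV' => ⟨∅, hs.sim1 hV', by simp⟩⟩
  induction c with
  | zero =>
    refine ⟨0, fun V B hB hV => sat V B hV ?_⟩
    obtain rfl : B = ∅ := by simpa using hB
    cases q with
    | zero => trivial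
    | succ q => intro a ha; simp at ha
  | succ c ih =>
    obtain ⟨P, hP⟩ := ih
    have arch : ∀ r : ℕ, ∃ P', ∀ (V : ℕ → Option A) (B : Finset A), B.card ≤ c + 1 →
        valph V ⊆ B → Saturated r V B ∨ Simulated q P' V ∅ := by
      intro r
      induction r with
      | zero => exact ⟨0, fun _ _ _ _ => Or.inl trivial⟩
      | succ r ihr =>
        obtain ⟨P', hP'⟩ := ihr
        refine ⟨P + 1 + P', fun V B hB hV => ?_⟩
        have miss : ∀ U : ℕ → Option A, valph U ⊆ B → ¬ (B : Set A) ⊆ valph U →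
            Simulated q P U ∅ := by
          intro U hU hB'
          obtain ⟨b, hb, hbU⟩ := Set.not_subset.1 hB'
          refine hP U (B.erase b) (by rw [Finset.card_erase_of_mem hb]; omega) fun a ha => ?_
          refine Finset.mem_coe.2 (Finset.mem_erase.2 ⟨?_, hU ha⟩)
          rintro rfl
          exact hbU ha
        by_cases hBV : ∃ n, (B : Set A) ⊆ valph (vTake n V)
        · have hs := Nat.find_spec hBV
          rcases hn : Nat.find hBV with _ | m
          · rw [hn] at hs
            left
            intro a ha
            obtain ⟨i, hi⟩ := hs ha
            simp [vTake] at hi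
          · rw [hn] at hs
            have hlt := Nat.find_min hBV (m := m) (by omega)
            have hm : V m ≠ none := by
              intro hm
              apply hlt
              intro a ha
              obtain ⟨i, hi⟩ := hs ha
              obtain ⟨h1, h2⟩ := lt_of_vTake_eq_some hi
              have : i ≠ m := by rintro rfl; rw [hm] at h2; cases h2
              exact ⟨i, by simp only [vTake]; rw [if_pos (by omega)]; exact h2⟩
            obtain ⟨a, ha⟩ := Option.ne_none_iff_exists'.1 hm
            rcases hP' (vDrop (m + 1) V) B hB ((valph_vDrop_subset _ _).trans hV) with h | h
            · left
              intro b hb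
              obtain ⟨i, hi⟩ := hs hb
              obtain ⟨h1, h2⟩ := lt_of_vTake_eq_some hi
              refine ⟨i, h2, Saturated.of_vDrop (n := m - i) ?_⟩
              rwa [vDrop_vDrop, show m - i + (i + 1) = m + 1 by omega]
            · right
              exact Simulated.glue ha (miss _ ((valph_vTake_subset _ _).trans hV) hlt) h (by simp)
        · right
          refine (miss V hV fun h => hBV ?_).mono (by omega)
          have hfin : ∀ s : Finset A, ↑s ⊆ valph V → ∃ n, (s : Set A) ⊆ valph (vTake n V) := by
            intro s
            induction s using Finset.induction_on with
            | empty => exact fun _ => ⟨0, by simp⟩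
            | insert a s _ ih =>
              intro hs
              rw [Finset.coe_insert, Set.insert_subset_iff] at hs
              obtain ⟨n, hn⟩ := ih hs.2
              obtain ⟨i, hi⟩ := hs.1
              refine ⟨max n (i + 1), ?_⟩
              rw [Finset.coe_insert, Set.insert_subset_iff]
              refine ⟨⟨i, ?_⟩, hn.trans (valph_vTake_mono (le_max_left _ _) V)⟩
              have : i < max n (i + 1) := lt_of_lt_of_le (Nat.lt_succ_self i) (le_max_right _ _)
              simpa [vTake, this] using hi
          exact hfin B h
    obtain ⟨P', hP'⟩ := arch q
    refine ⟨P', fun V B hB hV => ?_⟩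
    rcases hP' V B hB hV with h | h
    · exact (sat V B hV h).mono (by omega)
    · exact h

/-- The positions in `F` cut the word into pieces, to each of which `exists_simulated_of_card_le`
applies. -/
theorem exists_simulated (A : Type u) [Finite A] (q k : ℕ) :
    ∃ P, ∀ (V : ℕ → Option A) (F : Finset ℕ), F.card ≤ k → (∀ n ∈ F, V n ≠ none) →
      Simulated q P V F := by
  classical
  have := Fintype.ofFinite A
  obtain ⟨P₀, hP₀⟩ := exists_simulated_of_card_le (A := A) q (Fintype.card A)
  have h₀ : ∀ V : ℕ → Option A, Simulated q P₀ V ∅ := fun V =>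
    hP₀ V Finset.univ le_rfl (by simp)
  induction k with
  | zero =>
    refine ⟨P₀, fun V F hF _ => ?_⟩
    obtain rfl : F = ∅ := by simpa using hF
    exact h₀ V
  | succ k ih =>
    obtain ⟨P, hP⟩ := ih
    refine ⟨P₀ + 1 + P, fun V F hF hF' => ?_⟩
    rcases F.eq_empty_or_nonempty with rfl | hne
    · exact (h₀ V).mono (by omega)
    have hmin := F.min'_mem hne
    set m := F.min' hne with hm
    obtain ⟨a, ha⟩ := Option.ne_none_iff_exists'.1 (hF' m hmin)
    refine Simulated.glue (F₂ := (F.erase m).image (· - (m + 1))) ha (h₀ _)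
      (hP _ _ (Finset.card_image_le.trans (by rw [Finset.card_erase_of_mem hmin]; omega)) ?_) ?_
    · intro n hn
      obtain ⟨i, hi, rfl⟩ := Finset.mem_image.1 hn
      obtain ⟨h1, h2⟩ := Finset.mem_erase.1 hi
      have := F.min'_le i h2
      simp only [vDrop]
      rw [Nat.sub_add_cancel (by omega)]
      exact hF' i h2
    · intro n hn
      have := F.min'_le n hn
      by_cases hnm : n = m
      · exact Or.inr (Or.inl hnm)
      · exact Or.inr (Or.inr ⟨n - (m + 1),
          Finset.mem_image.2 ⟨n, Finset.mem_erase.2 ⟨hnm, hn⟩, rfl⟩, by omega⟩)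

end

/-! ### `Σ₂` sentences and monomials -/

section
open FirstOrder Language

variable {A : Type u} {W : Type v} [WordModel A W]

/-- Satisfaction of a formula of the language of words, with variables `xs`, in the word `w`. -/
def WRealize (w : W) {n : ℕ} (φ : (wordLang A).BoundedFormula Empty n)
    (xs : Fin n → WordModel.Pos w) : Prop :=
  @BoundedFormula.Realize (wordLang A) (WordModel.Pos w) (wordStructure w) Empty n φ default xs

theorem sat_iff_wRealize (w : W) (φ : (wordLang A).Sentence) (xs : Fin 0 → WordModel.Pos w) :
    Sat w φ ↔ WRealize w φ xs := by
  obtain rfl : xs = default := Subsingleton.elim _ _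
  rfl

theorem wRealize_all (w : W) {n : ℕ} (φ : (wordLang A).BoundedFormula Empty (n + 1))
    (xs : Fin n → WordModel.Pos w) : WRealize w φ.all xs ↔ ∀ p, WRealize w φ (Fin.snoc xs p) :=
  Iff.rfl

theorem wRealize_ex (w : W) {n : ℕ} (φ : (wordLang A).BoundedFormula Empty (n + 1))
    (xs : Fin n → WordModel.Pos w) : WRealize w φ.ex xs ↔ ∃ p, WRealize w φ (Fin.snoc xs p) :=
  @BoundedFormula.realize_ex (wordLang A) (WordModel.Pos w) (wordStructure w) Empty n φ default xs

theorem wRealize_imp (w : W) {n : ℕ} (φ ψ : (wordLang A).BoundedFormula Empty n)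
    (xs : Fin n → WordModel.Pos w) :
    WRealize w (φ.imp ψ) xs ↔ (WRealize w φ xs → WRealize w ψ xs) :=
  Iff.rfl

theorem wRealize_not (w : W) {n : ℕ} (φ : (wordLang A).BoundedFormula Empty n)
    (xs : Fin n → WordModel.Pos w) : WRealize w φ.not xs ↔ ¬ WRealize w φ xs :=
  Iff.rfl

theorem wRealize_inf (w : W) {n : ℕ} (φ ψ : (wordLang A).BoundedFormula Empty n)
    (xs : Fin n → WordModel.Pos w) :
    WRealize w (φ ⊓ ψ) xs ↔ WRealize w φ xs ∧ WRealize w ψ xs :=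
  @BoundedFormula.realize_inf (wordLang A) (WordModel.Pos w) (wordStructure w) Empty n φ ψ default
    xs

theorem wRealize_sup (w : W) {n : ℕ} (φ ψ : (wordLang A).BoundedFormula Empty n)
    (xs : Fin n → WordModel.Pos w) :
    WRealize w (φ ⊔ ψ) xs ↔ WRealize w φ xs ∨ WRealize w ψ xs :=
  @BoundedFormula.realize_sup (wordLang A) (WordModel.Pos w) (wordStructure w) Empty n φ ψ default
    xs

theorem qrank_ex {n : ℕ} (φ : (wordLang A).BoundedFormula Empty (n + 1)) :
    qrank φ.ex = qrank φ + 1 := by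
  simp [qrank]

theorem isQF_of_isAlt_zero {b : Bool} {n : ℕ} {φ : (wordLang A).BoundedFormula Empty n}
    (h : IsAlt b 0 φ) : φ.IsQF := by
  generalize hi : 0 = i at h
  cases h with
  | qf h => exact h
  | ex h => omega
  | all h => omega
  | switch h => omega

theorem qrank_of_isQF {n : ℕ} {φ : (wordLang A).BoundedFormula Empty n} (h : φ.IsQF) :
    qrank φ = 0 := by
  induction h with
  | falsum => rfl
  | of_isAtomic h => cases h <;> rfl
  | imp _ _ h₁ h₂ => simp [qrank, h₁, h₂]

theorem exists_term_eq_var {n : ℕ} (t : (wordLang A).Term (Empty ⊕ Fin n)) :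
    ∃ i, t = Term.var (Sum.inr i) := by
  match t with
  | .var (.inl e) => exact e.elim
  | .var (.inr i) => exact ⟨i, rfl⟩
  | .func f _ => exact Empty.elim f

/-- The map `ι` numbers the positions of `w` in such a way that `w` becomes the partial word `V`. -/
structure Represents (w : W) (V : ℕ → Option A) (ι : WordModel.Pos w → ℕ) : Prop where
  inj : Function.Injective ι
  lt_iff : ∀ p q, WordModel.lt w p q ↔ ι p < ι q
  label : ∀ p, V (ι p) = some (WordModel.label w p)
  surj : ∀ n, V n ≠ none → ∃ p, ι p = n

variable {W' : Type v} [WordModel A W'] {w : W} {w' : W'} {V V' : ℕ → Option A}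
  {ι : WordModel.Pos w → ℕ} {ι' : WordModel.Pos w' → ℕ}

/-- Partial isomorphisms preserve quantifier-free formulas. -/
theorem wRealize_iff_of_isQF (hι : Represents w V ι) (hι' : Represents w' V' ι') {n : ℕ}
    {φ : (wordLang A).BoundedFormula Empty n} (hφ : φ.IsQF) {xs : Fin n → WordModel.Pos w}
    {xs' : Fin n → WordModel.Pos w'} {H : Set (ℕ × ℕ)} (hH : PIso V V' H)
    (hxs : ∀ i, (ι (xs i), ι' (xs' i)) ∈ H) : WRealize w φ xs ↔ WRealize w' φ xs' := by
  induction hφ with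
  | falsum => exact Iff.rfl
  | imp _ _ h₁ h₂ => rw [wRealize_imp, wRealize_imp, h₁, h₂]
  | of_isAtomic h =>
    cases h with
    | equal t₁ t₂ =>
      obtain ⟨i, rfl⟩ := exists_term_eq_var t₁
      obtain ⟨j, rfl⟩ := exists_term_eq_var t₂
      change xs i = xs j ↔ xs' i = xs' j
      have h1 := hH.2 _ (hxs i) _ (hxs j)
      have h2 := hH.2 _ (hxs j) _ (hxs i)
      simp only at h1 h2
      rw [← hι.inj.eq_iff, ← hι'.inj.eq_iff]
      omega
    | rel R ts =>
      obtain ⟨f, hf⟩ := Classical.axiomOfChoice fun i => exists_term_eq_var (ts i)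
      obtain rfl : ts = fun i => Term.var (Sum.inr (f i)) := funext hf
      cases R with
      | letter a =>
        change WordModel.label w (xs (f 0)) = a ↔ WordModel.label w' (xs' (f 0)) = a
        obtain ⟨b, h1, h2⟩ := hH.1 _ (hxs (f 0))
        simp only [hι.label, hι'.label, Option.some.injEq] at h1 h2
        rw [h1, h2]
      | lt =>
        change WordModel.lt w (xs (f 0)) (xs (f 1)) ↔ WordModel.lt w' (xs' (f 0)) (xs' (f 1))
        rw [hι.lt_iff, hι'.lt_iff]
        exact hH.2 _ (hxs (f 0)) _ (hxs (f 1))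

/-- A `Π₁` formula that fails in `w'` fails in every `w` for which there is a partial isomorphism
with suitable, at most `qrank φ` many, positions of `w'` in its range. -/
theorem exists_refutation (hι : Represents w V ι) (hι' : Represents w' V' ι') {n : ℕ}
    {φ : (wordLang A).BoundedFormula Empty n} (hφ : IsAlt false 1 φ)
    {xs' : Fin n → WordModel.Pos w'} (h : ¬ WRealize w' φ xs') :
    ∃ F : Finset ℕ, F.card ≤ qrank φ ∧ (∀ n ∈ F, V' n ≠ none) ∧
      ∀ (xs : Fin n → WordModel.Pos w) (H : Set (ℕ × ℕ)), PIso V V' H →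
        (∀ n ∈ F, ∃ m, (m, n) ∈ H) → (∀ i, (ι (xs i), ι' (xs' i)) ∈ H) → ¬ WRealize w φ xs := by
  classical
  have qf : ∀ {n : ℕ} {φ : (wordLang A).BoundedFormula Empty n}, φ.IsQF →
      ∀ {xs' : Fin n → WordModel.Pos w'}, ¬ WRealize w' φ xs' →
      ∃ F : Finset ℕ, F.card ≤ qrank φ ∧ (∀ n ∈ F, V' n ≠ none) ∧
      ∀ (xs : Fin n → WordModel.Pos w) (H : Set (ℕ × ℕ)), PIso V V' H →
        (∀ n ∈ F, ∃ m, (m, n) ∈ H) → (∀ i, (ι (xs i), ι' (xs' i)) ∈ H) → ¬ WRealize w φ xs :=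
    fun hφ _ h => ⟨∅, by simp, by simp, fun xs H hH _ hxs =>
      (wRealize_iff_of_isQF hι hι' hφ hH hxs).not.2 h⟩
  generalize hb : false = b, hi : 1 = i at hφ
  induction hφ with
  | qf hφ => exact qf hφ h
  | ex => cases hb
  | switch hφ =>
    obtain rfl : _ = 0 := by simpa using hi.symm
    exact qf (isQF_of_isAlt_zero hφ) h
  | all hφ ih =>
    rw [wRealize_all, not_forall] at h
    obtain ⟨p, hp⟩ := h
    obtain ⟨F, hF, hFV, hF'⟩ := ih hp hb hi
    refine ⟨insert (ι' p) F, ?_, ?_, fun xs H hH hFH hxs hall => ?_⟩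
    · exact (Finset.card_insert_le _ _).trans (Nat.succ_le_succ hF)
    · intro n hn
      rcases Finset.mem_insert.1 hn with rfl | hn
      · rw [hι'.label]; simp
      · exact hFV n hn
    · obtain ⟨m, hm⟩ := hFH _ (Finset.mem_insert_self _ _)
      obtain ⟨a, ha, -⟩ := hH.1 _ hm
      obtain ⟨q, rfl⟩ := hι.surj m (by rw [ha]; simp)
      refine hF' (Fin.snoc xs q) H hH (fun n hn => hFH n (Finset.mem_insert_of_mem hn))
        (fun i => ?_) (hall q)
      refine Fin.lastCases ?_ (fun i => ?_) i
      · simpa using hm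
      · simpa using hxs i

/-- A `Σ₂` formula that holds in `w` holds in every `w'` that can be simulated by `w`, with suitable
positions of `w` in the domain. -/
theorem exists_support (hι : Represents w V ι) (hι' : Represents w' V' ι') {n : ℕ}
    {φ : (wordLang A).BoundedFormula Empty n} (hφ : IsAlt true 2 φ)
    {xs : Fin n → WordModel.Pos w} (h : WRealize w φ xs) :
    ∃ F : Finset ℕ, F.card ≤ qrank φ ∧ (∀ n ∈ F, V n ≠ none) ∧
      ∀ (xs' : Fin n → WordModel.Pos w') (G : Set (ℕ × ℕ)), Sim1 (qrank φ) V V' G →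
        (∀ n ∈ F, ∃ m, (n, m) ∈ G) → (∀ i, (ι (xs i), ι' (xs' i)) ∈ G) → WRealize w' φ xs' := by
  classical
  generalize hb : true = b, hi : 2 = i at hφ
  induction hφ with
  | qf hφ =>
    exact ⟨∅, by simp, by simp, fun xs' G hG _ hxs =>
      (wRealize_iff_of_isQF hι hι' hφ hG.pIso hxs).1 h⟩
  | all => cases hb
  | switch hφ =>
    obtain rfl : _ = 1 := by simpa using hi.symm
    subst hb
    refine ⟨∅, by simp, by simp, fun xs' G hG _ hxs => ?_⟩
    by_contra hn
    obtain ⟨F, hF, hFV, hF'⟩ := exists_refutation hι hι' hφ hn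
    obtain ⟨H, hGH, hH, hFH⟩ := hG F hF hFV
    exact hF' xs H hH hFH (fun i => hGH (hxs i)) h
  | ex hφ ih =>
    rw [wRealize_ex] at h
    obtain ⟨p, hp⟩ := h
    obtain ⟨F, hF, hFV, hF'⟩ := ih hp hb hi
    rw [qrank_ex]
    refine ⟨insert (ι p) F, ?_, ?_, fun xs' G hG hFG hxs => ?_⟩
    · exact (Finset.card_insert_le _ _).trans (Nat.succ_le_succ hF)
    · intro n hn
      rcases Finset.mem_insert.1 hn with rfl | hn
      · rw [hι.label]; simp
      · exact hFV n hn
    · obtain ⟨m, hm⟩ := hFG _ (Finset.mem_insert_self _ _)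
      obtain ⟨a, -, ha⟩ := hG.pIso.1 _ hm
      obtain ⟨q, rfl⟩ := hι'.surj m (by rw [ha]; simp)
      rw [wRealize_ex]
      refine ⟨q, hF' (Fin.snoc xs' q) G (hG.mono (Nat.le_succ _))
        (fun n hn => hFG n (Finset.mem_insert_of_mem hn)) (fun i => ?_)⟩
      refine Fin.lastCases ?_ (fun i => ?_) i
      · simpa using hm
      · simpa using hxs i

/-- The preorder of monomials of large degree refines the preorder of `Σ₂` sentences of rank `k`. -/
theorem exists_vle_imp_sigmaLE (A : Type u) [Finite A] (k : ℕ) :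
    ∃ P, ∀ {W : Type v} [WordModel A W] {w w' : W} {V V' : ℕ → Option A}
      {ι : WordModel.Pos w → ℕ} {ι' : WordModel.Pos w' → ℕ}, Represents w V ι →
      Represents w' V' ι' → VLE P V V' → SigmaLE 2 k w w' := by
  obtain ⟨P, hP⟩ := exists_simulated A k k
  refine ⟨P, fun hι hι' hVV' φ hφ hk h => ?_⟩
  rw [sat_iff_wRealize _ _ Fin.elim0] at h ⊢
  obtain ⟨F, hF, hFV, hF'⟩ := exists_support hι hι' hφ h
  obtain ⟨B, l, hl, hV, hs⟩ := hP _ F (hF.trans hk) hFV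
  obtain ⟨G, hG, hFG⟩ := hs _ (hVV' B l hl hV)
  exact hF' _ G (hG.mono hk) hFG (fun i => i.elim0)

/-! ### Monomials are defined by `Σ₂` sentences -/

/-- The condition on positions `x` and `y` that says that the marked letters of the monomial
`(B, l)` are at the positions `x`, after the position `r` if there is one, and that the letter at
position `y` is allowed. -/
def MarkedBy (w : W) : Option (WordModel.Pos w) → Set A → (l : List (A × Set A)) →
    (Fin l.length → WordModel.Pos w) → WordModel.Pos w → Prop
  | r, B, [], _, y => (∀ r' ∈ r, WordModel.lt w r' y) → WordModel.label w y ∈ B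
  | r, B, (a, C) :: l, x, y =>
    (∀ r' ∈ r, WordModel.lt w r' (x 0)) ∧ WordModel.label w (x 0) = a ∧
      ((∀ r' ∈ r, WordModel.lt w r' y) → WordModel.lt w y (x 0) → WordModel.label w y ∈ B) ∧
      MarkedBy w (some (x 0)) C l (Fin.tail x) y

theorem exists_isQF_forall {n : ℕ} {β : Type*} [Finite β]
    {f : β → (wordLang A).BoundedFormula Empty n} (hf : ∀ b, (f b).IsQF) :
    ∃ φ : (wordLang A).BoundedFormula Empty n, φ.IsQF ∧
      ∀ {W : Type v} [WordModel A W] (w : W) xs, WRealize w φ xs ↔ ∀ b, WRealize w (f b) xs := by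
  refine ⟨BoundedFormula.iInf f, ?_, fun w xs =>
    @BoundedFormula.realize_iInf (wordLang A) (WordModel.Pos w) (wordStructure w) _ _ _ _ _
      default xs⟩
  unfold BoundedFormula.iInf
  let _ := Fintype.ofFinite β
  change BoundedFormula.IsQF (((Finset.univ : Finset β).toList.map f).foldr (· ⊓ ·) ⊤)
  generalize (Finset.univ : Finset β).toList = s
  induction s with
  | nil => exact BoundedFormula.IsQF.top
  | cons b s ih => exact (hf b).inf ih

/-- Being after an optional position is expressed by a quantifier-free formula. -/
theorem exists_isQF_after {n : ℕ} (r : Option (Fin n)) (i : Fin n) :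
    ∃ φ : (wordLang A).BoundedFormula Empty n, φ.IsQF ∧
      ∀ {W : Type v} [WordModel A W] (w : W) xs,
        WRealize w φ xs ↔ ∀ r' ∈ r.map xs, WordModel.lt w r' (xs i) := by
  cases r with
  | none => exact ⟨⊤, BoundedFormula.IsQF.top, fun w xs => by
      simp only [Option.map_none, Option.not_mem_none, false_imp_iff, implies_true, iff_true]
      exact fun h => h⟩
  | some j =>
    exact ⟨Relations.boundedFormula₂ (WordRel.lt : (wordLang A).Relations 2)
      (Term.var (Sum.inr j)) (Term.var (Sum.inr i)), (BoundedFormula.IsAtomic.rel _ _).isQF,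
      fun w xs => by
        simp only [Option.map_some, Option.mem_def, Option.some.injEq, forall_eq']
        exact @BoundedFormula.realize_rel₂ (wordLang A) _ (wordStructure w) _ _ _ _ _ _ _⟩

/-- Having a label in a given set is expressed by a quantifier-free formula. -/
theorem exists_isQF_label [Finite A] {n : ℕ} (B : Set A) (i : Fin n) :
    ∃ φ : (wordLang A).BoundedFormula Empty n, φ.IsQF ∧
      ∀ {W : Type v} [WordModel A W] (w : W) xs,
        WRealize w φ xs ↔ WordModel.label w (xs i) ∈ B := by
  obtain ⟨φ, hφ, h⟩ := exists_isQF_forall.{u, v} (A := A) (n := n) (β := {a : A // a ∉ B})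
    (f := fun b => (Relations.boundedFormula₁ (WordRel.letter b.1 : (wordLang A).Relations 1)
      (Term.var (Sum.inr i))).not) fun b => (BoundedFormula.IsAtomic.rel _ _).isQF.not
  refine ⟨φ, hφ, fun w xs => (h w xs).trans ?_⟩
  have key : ∀ b : {a : A // a ∉ B}, WRealize w ((Relations.boundedFormula₁
      (WordRel.letter b.1 : (wordLang A).Relations 1) (Term.var (Sum.inr i))).not) xs ↔
        WordModel.label w (xs i) ≠ b.1 := by
    intro b
    rw [wRealize_not]
    exact not_congr
      (@BoundedFormula.realize_rel₁ (wordLang A) _ (wordStructure w) _ _ _ _ _ _)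
  simp only [key]
  constructor
  · intro h1
    by_contra h2
    exact h1 ⟨_, h2⟩ rfl
  · rintro h1 ⟨b, hb⟩ rfl
    exact hb h1

theorem exists_isQF_markedBy [Finite A] (l : List (A × Set A)) {n : ℕ} (r : Option (Fin n))
    (B : Set A) (f : Fin l.length → Fin n) (j : Fin n) :
    ∃ φ : (wordLang A).BoundedFormula Empty n, φ.IsQF ∧
      ∀ {W : Type v} [WordModel A W] (w : W) xs,
        WRealize w φ xs ↔ MarkedBy w (r.map xs) B l (xs ∘ f) (xs j) := by
  induction l generalizing r B with
  | nil =>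
    obtain ⟨φ₁, h₁, h₁'⟩ := exists_isQF_after.{u, v} (A := A) r j
    obtain ⟨φ₂, h₂, h₂'⟩ := exists_isQF_label.{u, v} B j
    exact ⟨φ₁.imp φ₂, h₁.imp h₂, fun w xs => by rw [wRealize_imp, h₁', h₂']; rfl⟩
  | cons x l ih =>
    obtain ⟨a, C⟩ := x
    obtain ⟨φ₁, h₁, h₁'⟩ := exists_isQF_after.{u, v} (A := A) r (f 0)
    obtain ⟨φ₂, h₂, h₂'⟩ := exists_isQF_label.{u, v} ({a} : Set A) (f 0)
    obtain ⟨φ₃, h₃, h₃'⟩ := exists_isQF_after.{u, v} (A := A) r j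
    obtain ⟨φ₄, h₄, h₄'⟩ := exists_isQF_after.{u, v} (A := A) (some j) (f 0)
    obtain ⟨φ₅, h₅, h₅'⟩ := exists_isQF_label.{u, v} B j
    obtain ⟨φ₆, h₆, h₆'⟩ := ih (some (f 0)) C (Fin.tail f)
    refine ⟨φ₁ ⊓ (φ₂ ⊓ ((φ₃.imp (φ₄.imp φ₅)) ⊓ φ₆)),
      h₁.inf (h₂.inf ((h₃.imp (h₄.imp h₅)).inf h₆)), fun w xs => ?_⟩
    rw [wRealize_inf, wRealize_inf, wRealize_inf, wRealize_imp, wRealize_imp, h₁', h₂', h₃', h₄',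
      h₅', h₆']
    simp only [Option.map_some, Option.mem_def, Option.some.injEq, forall_eq',
      Set.mem_singleton_iff]
    rfl

/-- The rest of the word `w` after the optional position `r`, where the partial word `V` is cut at
`s`, is in a monomial if and only if the marked letters can be chosen. -/
theorem vmem_vDrop_iff_markedBy (hι : Represents w V ι) (r : Option (WordModel.Pos w)) (s : ℕ)
    (hrs : ∀ p, s ≤ ι p ↔ ∀ r' ∈ r, WordModel.lt w r' p) (B : Set A) (l : List (A × Set A)) :
    VMem (vDrop s V) B l ↔ ∃ x, ∀ y, MarkedBy w r B l x y := by
  induction l generalizing r s B with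
  | nil =>
    simp only [VMem, MarkedBy, List.length_nil, exists_const, ← hrs]
    constructor
    · intro h y hy
      exact h ⟨ι y - s, by simp only [vDrop]; rw [Nat.sub_add_cancel hy, hι.label]⟩
    · rintro h a ⟨i, hi⟩
      obtain ⟨p, hp⟩ := hι.surj (i + s) (by change vDrop s V i ≠ none; rw [hi]; simp)
      have h1 := h p (by omega)
      have h2 := hι.label p
      rw [hp] at h2
      rw [show V (i + s) = some a from hi] at h2
      cases h2
      exact h1
  | cons x l ih =>
    obtain ⟨a, C⟩ := x
    constructor
    · rintro ⟨m, hm, hB, hC⟩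
      obtain ⟨p, hp⟩ := hι.surj (m + s) (by change vDrop s V m ≠ none; rw [hm]; simp)
      rw [vDrop_vDrop] at hC
      obtain ⟨x, hx⟩ := (ih (some p) (m + 1 + s) (by
        intro q
        simp only [Option.mem_def, Option.some.injEq, forall_eq', hι.lt_iff, hp]
        omega) C).1 hC
      refine ⟨Fin.cons p x, fun y => ⟨?_, ?_, ?_, ?_⟩⟩
      · exact (hrs p).1 (by omega)
      · have h2 := hι.label p
        rw [hp, show V (m + s) = some a from hm] at h2
        cases h2
        rfl
      · intro h1 h2
        have h3 := (hrs y).2 h1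
        replace h2 : WordModel.lt w y p := h2
        rw [hι.lt_iff, hp] at h2
        refine hB ⟨ι y - s, ?_⟩
        simp only [vTake, vDrop]
        rw [if_pos (by omega), Nat.sub_add_cancel h3, hι.label]
      · exact hx y
    · rintro ⟨x, hx⟩
      obtain ⟨h1, h2, -, -⟩ := hx (x 0)
      have h3 := (hrs _).2 h1
      refine ⟨ι (x 0) - s, ?_, ?_, ?_⟩
      · simp only [vDrop]
        rw [Nat.sub_add_cancel h3, hι.label, h2]
      · rintro b ⟨i, hi⟩
        obtain ⟨hi, hi'⟩ := lt_of_vTake_eq_some hi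
        obtain ⟨p, hp⟩ := hι.surj (i + s) (by change vDrop s V i ≠ none; rw [hi']; simp)
        have h4 := hι.label p
        rw [hp, show V (i + s) = some b from hi'] at h4
        cases h4
        refine (hx p).2.2.1 ((hrs p).1 (by omega)) ?_
        rw [hι.lt_iff]
        omega
      · rw [vDrop_vDrop]
        refine (ih (some (x 0)) _ ?_ C).2 ⟨Fin.tail x, fun y => (hx y).2.2.2⟩
        intro q
        simp only [Option.mem_def, Option.some.injEq, forall_eq', hι.lt_iff]
        omega

theorem exists_isAlt_exs {n : ℕ} {φ : (wordLang A).BoundedFormula Empty n} (h : IsAlt true 2 φ) :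
    IsSigma 2 φ.exs ∧ qrank φ.exs = qrank φ + n := by
  induction n with
  | zero => exact ⟨h, rfl⟩
  | succ n ih =>
    obtain ⟨h1, h2⟩ := ih (IsAlt.ex h)
    refine ⟨h1, h2.trans ?_⟩
    rw [qrank_ex]
    omega

/-- Every monomial is defined by a `Σ₂` sentence. -/
theorem exists_sigma_vmem [Finite A] (B : Set A) (l : List (A × Set A)) :
    ∃ φ : (wordLang A).Sentence, IsSigma 2 φ ∧ qrank φ = l.length + 1 ∧
      ∀ {W : Type v} [WordModel A W] {w : W} {V : ℕ → Option A} {ι : WordModel.Pos w → ℕ},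
        Represents w V ι → (Sat w φ ↔ VMem V B l) := by
  obtain ⟨ψ, hψ, h⟩ := exists_isQF_markedBy.{u, v} l (n := l.length + 1) none B Fin.castSucc
    (Fin.last _)
  have h1 : IsAlt true 2 ψ.all := IsAlt.switch (b := true) (IsAlt.all (IsAlt.qf hψ))
  obtain ⟨h2, h3⟩ := exists_isAlt_exs h1
  refine ⟨ψ.all.exs, h2, ?_, fun {W _ w V ι} hι => ?_⟩
  · rw [h3, qrank, qrank_of_isQF hψ]; omega
  · have h4 := vmem_vDrop_iff_markedBy hι none 0 (by simp) B l
    change VMem V B l ↔ _ at h4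
    rw [h4]
    refine (@BoundedFormula.realize_exs (wordLang A) _ (wordStructure w) _ _ ψ.all default).trans ?_
    refine exists_congr fun x => ?_
    refine forall_congr' fun y => (h w _).trans ?_
    have e : (Fin.snoc x y : Fin (l.length + 1) → WordModel.Pos w) ∘ Fin.castSucc = x := by
      funext i; simp
    rw [e, Fin.snoc_last]
    rfl

end

/-! ### The preorder of monomials on words -/

/-- The words of type `W` are coded as partial words. -/
class CodedWords (A : outParam (Type u)) (W : Type v) [WordModel A W] where
  code : W → ℕ → Option A
  represents : ∀ w : W, ∃ ι, Represents w (code w) ι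

/-- A list as a partial word. -/
def listCode {A : Type u} (l : List A) : ℕ → Option A := fun n => l[n]?

instance finiteCodedWords (A : Type u) : CodedWords A (FreeSemigroup A) where
  code w := listCode (letters w)
  represents w := ⟨Fin.val, Fin.val_injective, fun _ _ => Iff.rfl,
    fun p => List.getElem?_eq_getElem p.2, fun n hn =>
      ⟨⟨n, by simpa [listCode] using hn⟩, rfl⟩⟩

instance infiniteCodedWords (A : Type u) : CodedWords A (ℕ → A) where
  code w := fun n => some (w n)
  represents _ := ⟨id, Function.injective_id, fun _ _ => Iff.rfl, fun _ => rfl, fun n _ => ⟨n, rfl⟩⟩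

open CodedWords

/-- The preorder of monomials of degree at most `p` on words. -/
def WLE {A : Type u} {W : Type v} [WordModel A W] [CodedWords A W] (p : ℕ) (w w' : W) : Prop :=
  VLE p (code w) (code w')

section
variable {A : Type u} {W : Type v} [WordModel A W] [CodedWords A W]

theorem WLE.refl (p : ℕ) (w : W) : WLE p w w := VLE.refl _ _

theorem WLE.trans {p : ℕ} {w w' w'' : W} (h : WLE p w w') (h' : WLE p w' w'') : WLE p w w'' :=
  VLE.trans h h'

theorem WLE.mono {p q : ℕ} (hpq : p ≤ q) {w w' : W} (h : WLE q w w') : WLE p w w' :=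
  VLE.mono hpq h

theorem alph_eq_valph (w : W) : alph w = valph (code w) := by
  obtain ⟨ι, hι⟩ := represents w
  ext a
  constructor
  · rintro ⟨p, rfl⟩
    exact ⟨ι p, hι.label p⟩
  · rintro ⟨n, hn⟩
    obtain ⟨p, rfl⟩ := hι.surj n (by rw [hn]; simp)
    rw [hι.label] at hn
    cases hn
    exact ⟨p, rfl⟩

theorem WLE.alph_eq {p : ℕ} (hp : 1 ≤ p) {w w' : W} (h : WLE p w w') : alph w = alph w' := by
  rw [alph_eq_valph, alph_eq_valph]
  exact VLE.valph_eq hp h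

theorem exists_wle_imp_sigmaLE (W : Type v) [WordModel A W] [CodedWords A W] [Finite A] (k : ℕ) :
    ∃ P, ∀ w w' : W, WLE P w w' → SigmaLE 2 k w w' := by
  obtain ⟨P, hP⟩ := exists_vle_imp_sigmaLE.{u, v} A k
  refine ⟨P, fun w w' h => ?_⟩
  obtain ⟨ι, hι⟩ := represents w
  obtain ⟨ι', hι'⟩ := represents w'
  exact hP hι hι' h

theorem wle_of_sigmaLE [Finite A] {p : ℕ} {w w' : W} (h : SigmaLE 2 (p + 1) w w') : WLE p w w' := by
  intro B l hl hV
  obtain ⟨φ, hφ, hr, hs⟩ := exists_sigma_vmem.{u, v} B l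
  obtain ⟨ι, hι⟩ := represents w
  obtain ⟨ι', hι'⟩ := represents w'
  rw [← hs hι']
  rw [← hs hι] at hV
  exact h φ hφ (by omega) hV

theorem mem_sigmaChains_iff [Finite A] {S : Type*} {β : W → S} {l : List S} :
    l ∈ sigmaChains 2 β ↔
      l ≠ [] ∧ ∀ p, ∃ ws : List W, ws.IsChain (WLE p) ∧ ws.map β = l := by
  refine and_congr_right fun _ => ⟨fun h p => ?_, fun h k => ?_⟩
  · obtain ⟨ws, hc, hm⟩ := h (p + 1)
    exact ⟨ws, hc.imp fun _ _ => wle_of_sigmaLE, hm⟩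
  · obtain ⟨P, hP⟩ := exists_wle_imp_sigmaLE W k
    obtain ⟨ws, hc, hm⟩ := h P
    exact ⟨ws, hc.imp fun _ _ => hP _ _, hm⟩

theorem mem_sigmaChains_pair_iff [Finite A] {S : Type*} {β : W → S} {s t : S} :
    [s, t] ∈ sigmaChains 2 β ↔ ∀ p, ∃ w w' : W, WLE p w w' ∧ β w = s ∧ β w' = t := by
  rw [mem_sigmaChains_iff]
  refine (and_iff_right (by simp)).trans (forall_congr' fun p => ?_)
  constructor
  · rintro ⟨ws, hc, hm⟩
    match ws, hc, hm with
    | [w, w'], hc, hm =>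
      simp only [List.map_cons, List.map_nil, List.cons.injEq, and_true] at hm
      exact ⟨w, w', by simpa using hc, hm⟩
  · rintro ⟨w, w', h, rfl, rfl⟩
    exact ⟨[w, w'], by simpa using h, rfl⟩

/-! ### Products and cuts of words -/

theorem vTake_listCode_append (l m : List A) :
    vTake l.length (listCode (l ++ m)) = listCode l := by
  funext n
  simp only [vTake, listCode]
  split_ifs with h
  · exact List.getElem?_append_left h
  · exact (List.getElem?_eq_none (by omega)).symm

theorem vDrop_listCode_append (l m : List A) :
    vDrop l.length (listCode (l ++ m)) = listCode m := by
  funext n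
  simp only [vDrop, listCode]
  rw [List.getElem?_append_right (by omega), Nat.add_sub_cancel]

theorem vTake_code_appendInf (l : List A) (w : ℕ → A) :
    vTake l.length (code (appendInf l w)) = listCode l := by
  funext n
  simp only [vTake, listCode, code, appendInf]
  split_ifs with h
  · exact (List.getElem?_eq_getElem h).symm
  · exact (List.getElem?_eq_none (by omega)).symm

theorem vDrop_code_appendInf (l : List A) (w : ℕ → A) :
    vDrop l.length (code (appendInf l w)) = code w := by
  funext n
  simp [vDrop, code, appendInf]

theorem VLE.append {p : ℕ} {l l' m m' : List A} (h : VLE p (listCode l) (listCode l'))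
    (h' : VLE p (listCode m) (listCode m')) :
    VLE p (listCode (l ++ m)) (listCode (l' ++ m')) := by
  refine VLE.concat l.length l'.length ?_ ?_
  · rwa [vTake_listCode_append, vTake_listCode_append]
  · rwa [vDrop_listCode_append, vDrop_listCode_append]

theorem WLE.appendInf {p : ℕ} {l l' : List A} {w w' : ℕ → A}
    (h : VLE p (listCode l) (listCode l')) (h' : WLE p w w') :
    WLE p (appendInf l w) (OmegaLang.appendInf l' w') := by
  refine VLE.concat l.length l'.length ?_ ?_
  · rwa [vTake_code_appendInf, vTake_code_appendInf]
  · rwa [vDrop_code_appendInf, vDrop_code_appendInf]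

theorem WLE.mul {p : ℕ} {x x' y y' : FreeSemigroup A} (h : WLE p x x') (h' : WLE p y y') :
    WLE p (x * y) (x' * y') := VLE.append h h'

theorem WLE.act {p : ℕ} {x x' : FreeSemigroup A} {w w' : ℕ → A} (h : WLE p x x')
    (h' : WLE p w w') :
    WLE p (OmegaSemigroup.act x w : ℕ → A) (OmegaSemigroup.act x' w') := WLE.appendInf h h'

theorem WLE.segProd {p : ℕ} {f g : ℕ → FreeSemigroup A} {i n : ℕ}
    (h : ∀ j, i ≤ j → j ≤ i + n → WLE p (f j) (g j)) :
    WLE p (segProd f i n) (OmegaLang.segProd g i n) := by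
  induction n with
  | zero => exact h i le_rfl le_rfl
  | succ n ih =>
    exact WLE.mul (ih fun j h1 h2 => h j h1 (by omega)) (h _ (by omega) (by omega))

/-- A prefix of a product can be split off. -/
theorem act_segProd_infProd {S T : Type*} [Semigroup S] [OmegaSemigroup S T] (f : ℕ → S) (n : ℕ) :
    (OmegaSemigroup.act (segProd f 0 n) (OmegaSemigroup.infProd fun i => f (i + (n + 1))) : T)
      = OmegaSemigroup.infProd f := by
  have step : ∀ (g : ℕ → S), (OmegaSemigroup.act (g 0)
      (OmegaSemigroup.infProd fun i => g (i + 1)) : T) = OmegaSemigroup.infProd g := by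
    intro g
    rw [OmegaSemigroup.act_infProd]
    congr 1
    funext i
    cases i <;> rfl
  induction n with
  | zero => exact step f
  | succ n ih =>
    rw [segProd, OmegaSemigroup.mul_act, ← ih]
    congr 1
    have e : (fun i => f (i + (n + 1 + 1))) = fun i => f (i + 1 + (n + 1)) := by
      funext i; congr 1; omega
    rw [e, show 0 + n + 1 = 0 + (n + 1) by omega]
    exact step fun i => f (i + (n + 1))

theorem act_sPow_infPow {S T : Type*} [Semigroup S] [OmegaSemigroup S T] (s : S) (n : ℕ) :
    (OmegaSemigroup.act (sPow s n) (infPow s) : T) = infPow s :=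
  act_segProd_infProd (fun _ => s) n

theorem length_letters_sPow (x : FreeSemigroup A) (n : ℕ) :
    (letters (sPow x n)).length = (n + 1) * (letters x).length := by
  unfold sPow
  induction n with
  | zero => simp [segProd]
  | succ n ih => rw [segProd, letters_mul, List.length_append, ih]; ring

theorem length_letters_pos (x : FreeSemigroup A) : 0 < (letters x).length := by simp [letters]

theorem alph_infPow (x : FreeSemigroup A) : alph (infPow x : ℕ → A) = alph x := by
  change alph (infConcat fun _ => x) = _
  rw [alph_infConcat]
  exact Set.iUnion_const _

/-- Infinite powers are monotone. -/
theorem WLE.infPow {p : ℕ} {x x' : FreeSemigroup A} (h : WLE p x x') :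
    WLE p (infPow x : ℕ → A) (OmegaLang.infPow x') := by
  intro B l hl hV
  induction hn : l.length using Nat.strong_induction_on generalizing B l with
  | _ n ih =>
  match l, hV with
  | [], hV =>
    change valph _ ⊆ _
    change valph _ ⊆ _ at hV
    rw [← alph_eq_valph, alph_infPow, alph_eq_valph] at hV ⊢
    exact h B [] (by simp) hV
  | (a, C) :: l, ⟨m, hm, hB, hC⟩ =>
    -- Cut after a power of `x` that contains the first marked letter.
    simp only [List.length_cons] at hl hn
    have e := length_letters_sPow x m
    have hpos := length_letters_pos x
    have hlt : m < (letters (sPow x m)).length := by rw [e]; nlinarith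
    obtain ⟨j, hj⟩ : ∃ j, (letters (sPow x m)).length = j + (m + 1) := ⟨_, (by omega :
      _ = ((letters (sPow x m)).length - (m + 1)) + (m + 1))⟩
    obtain ⟨l₁, l₂, rfl, h1, h2⟩ := vmem_split hC j
    rw [List.length_append] at hl hn
    rw [vDrop_vDrop, ← hj] at h2
    rw [← act_sPow_infPow (T := ℕ → A) x m] at hm hB h1 h2
    have h3 : VMem (code (sPow x m)) B ((a, C) :: l₁) := by
      change VMem (listCode _) _ _
      rw [← vTake_code_appendInf _ (OmegaLang.infPow x)]
      refine ⟨m, by simp only [vTake]; rw [if_pos hlt]; exact hm, ?_, ?_⟩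
      · rwa [vTake_vTake_of_le hlt.le]
      · rw [hj, vDrop_vTake]; exact h1
    have h4 : VMem (code (OmegaLang.infPow x : ℕ → A)) (vlast C l₁) l₂ := by
      rw [← vDrop_code_appendInf (letters (sPow x m))]
      exact h2
    have h5 := ih l₂.length (by omega) _ l₂ (by omega) h4 rfl
    have h6 : WLE p (sPow x m) (sPow x' m) := WLE.segProd fun _ _ _ => h
    have h7 := h6 B ((a, C) :: l₁) (by simp only [List.length_cons]; omega) h3
    rw [← act_sPow_infPow (T := ℕ → A) x' m]
    refine vmem_join (l₁ := (a, C) :: l₁) (k := (letters (sPow x' m)).length) ?_ ?_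
    · change VMem (vTake _ (code (OmegaLang.appendInf _ _))) _ _
      rw [vTake_code_appendInf]
      exact h7
    · change VMem (vDrop _ (code (OmegaLang.appendInf _ _))) _ _
      rw [vDrop_code_appendInf]
      exact h5

/-- If `X` has period `L`, `Y` agrees with `X` on the first `N` periods, and all letters of `Y`
occur in `X`, then `Y` is in all monomials of degree less than `N` that contain `X`. For the
induction on the degree a prefix of at most one period may be removed from both. -/
theorem vmem_of_periodic {L : ℕ} (hL : 0 < L) {X : ℕ → Option A} (hX : ∀ i, X (i + L) = X i)
    {l : List (A × Set A)} {N : ℕ} (hN : l.length < N) {Y : ℕ → Option A}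
    (hXY : ∀ i < N * L, Y i = X i) (hYX : valph Y ⊆ valph X) {k : ℕ} (hk : k ≤ L) {B : Set A}
    (h : VMem (vDrop k X) B l) : VMem (vDrop k Y) B l := by
  have hXm : ∀ i j, X (i + j * L) = X i := by
    intro i j
    induction j with
    | zero => simp
    | succ j ih => rw [add_mul, one_mul, ← add_assoc, hX, ih]
  induction l generalizing N Y k B with
  | nil =>
    refine Set.Subset.trans (valph_vDrop_subset k Y) (hYX.trans ?_)
    rintro a ⟨i, hi⟩
    refine h ⟨i + k * L - k, ?_⟩
    have : k ≤ k * L := Nat.le_mul_of_pos_right k hL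
    simp only [vDrop]
    rw [Nat.sub_add_cancel (by omega), hXm, hi]
  | cons x l ih =>
    obtain ⟨a, C⟩ := x
    simp only [List.length_cons] at hN
    obtain ⟨m, hm, hB, hC⟩ := h
    rw [vDrop_vDrop] at hC
    change X (m + k) = some a at hm
    have h2L : 2 * L ≤ N * L := Nat.mul_le_mul_right L (by omega)
    have hlt := Nat.mod_lt (m + k) hL
    have hdiv := Nat.mod_add_div (m + k) L
    -- The first marked letter is moved to the period `[L, 2L)` unless it is in `[0, L)`.
    obtain ⟨c, hc, hcm, hck⟩ : ∃ c, c ≤ 1 ∧ (m + k) % L + c * L ≤ m + k ∧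
        k ≤ (m + k) % L + c * L := by
      rcases Nat.lt_or_ge (m + k) L with h1 | h1
      · exact ⟨0, by omega, by simpa using Nat.mod_le _ _, by rw [Nat.mod_eq_of_lt h1]; omega⟩
      · refine ⟨1, le_rfl, ?_, by omega⟩
        have : 0 < (m + k) / L := Nat.div_pos h1 hL
        nlinarith
    set q := (m + k) % L with hq
    have hXq : ∀ i, X (i + (m + k)) = X (i + q) := by
      intro i
      rw [← hdiv, ← add_assoc, mul_comm L, hXm]
    have hcL : c * L ≤ L := by nlinarith
    refine ⟨q + c * L - k, ?_, ?_, ?_⟩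
    · change Y (q + c * L - k + k) = _
      rw [Nat.sub_add_cancel hck, hXY _ (by omega), hXm, ← hm]
      simpa using (hXq 0).symm
    · rintro b ⟨i, hi⟩
      obtain ⟨hi, hi'⟩ := lt_of_vTake_eq_some hi
      refine hB ⟨i, ?_⟩
      simp only [vTake]
      rw [if_pos (by omega)]
      change Y (i + k) = _ at hi'
      rw [hXY _ (by omega)] at hi'
      exact hi'
    · rw [vDrop_vDrop, show q + c * L - k + 1 + k = (q + 1) + c * L by omega, ← vDrop_vDrop]
      refine ih (N := N - c) (by omega) ?_ ((valph_vDrop_subset _ _).trans hYX) (by omega) ?_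
      · intro i hi
        change Y (i + c * L) = _
        rw [hXY _ ?_, hXm]
        rw [Nat.sub_mul] at hi
        omega
      · convert hC using 1
        funext i
        simp only [vDrop]
        rw [show i + (m + 1 + k) = (i + 1) + (m + k) by omega, hXq, add_right_comm, add_assoc]

/-- `x^∞ ≲ xⁿ y` for large `n`, if all letters of `y` occur in `x`. Note that `sPow x p` is the power
with exponent `p + 1`. -/
theorem wle_infPow_act_sPow (p : ℕ) {x : FreeSemigroup A} {y : ℕ → A} (h : alph y ⊆ alph x) :
    WLE p (infPow x : ℕ → A) (OmegaSemigroup.act (sPow x p) y) := by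
  intro B l hl hV
  refine vmem_of_periodic (k := 0) (N := p + 1) (length_letters_pos x) (fun i => ?_) (by omega)
    (fun i hi => ?_) ?_ (by omega) hV
  · have h1 := congrFun (vDrop_code_appendInf (letters x) (infPow x)) i
    rw [← infPow_eq_append] at h1
    exact h1
  · rw [← length_letters_sPow] at hi
    have h1 := congrFun (vTake_code_appendInf (letters (sPow x p)) y) i
    have h2 := congrFun (vTake_code_appendInf (letters (sPow x p)) (infPow x)) i
    rw [← h2] at h1
    simp only [vTake, if_pos hi] at h1
    refine h1.trans ?_
    congr 1
    exact act_sPow_infPow (T := ℕ → A) x p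
  · rw [← alph_eq_valph, ← alph_eq_valph, alph_act, alph_infPow]
    refine Set.union_subset ?_ h
    rw [← alph_infPow x, ← act_sPow_infPow (T := ℕ → A) x p, alph_act]
    exact Set.subset_union_left

/-- The factor `w a ⋯ w (b - 1)` of an infinite word, for `a < b`. -/
def factor (w : ℕ → A) (a b : ℕ) : FreeSemigroup A :=
  segProd (fun i => FreeSemigroup.of (w i)) a (b - a - 1)

theorem code_factor (w : ℕ → A) {a b : ℕ} (h : a < b) :
    code (factor w a b) = vTake (b - a) (vDrop a (code w)) := by
  have key : ∀ n, letters (segProd (fun i => FreeSemigroup.of (w i)) a n)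
      = (List.range (n + 1)).map fun i => w (i + a) := by
    intro n
    induction n with
    | zero => simp [segProd, letters]
    | succ n ih =>
      rw [segProd, letters_mul, ih, List.range_succ (n := n + 1), List.map_append]
      simp only [letters, FreeSemigroup.of, List.map_cons, List.map_nil]
      rw [show a + n + 1 = n + 1 + a by omega]
  funext n
  change (letters (factor w a b))[n]? = _
  rw [factor, key]
  simp only [vTake, vDrop, code, List.getElem?_map]
  split_ifs with hn
  · rw [List.getElem?_range (by omega)]; rfl
  · rw [List.getElem?_eq_none (by simp; omega)]; rfl

/-- Cuts of an infinite word `w` can be copied in any `w'` above `w`. -/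
theorem exists_cuts_of_wle (A : Type u) [Finite A] (j : ℕ) {p : ℕ} (hp : 1 ≤ p) :
    ∃ P, ∀ w w' : ℕ → A, WLE P w w' → ∀ π : ℕ → ℕ, π 0 = 0 → (∀ i < j, π i < π (i + 1)) →
      ∃ π' : ℕ → ℕ, π' 0 = 0 ∧ (∀ i < j, π' i < π' (i + 1) ∧
        WLE p (factor w (π i) (π (i + 1))) (factor w' (π' i) (π' (i + 1)))) ∧
        VLE p (vDrop (π j) (code w)) (vDrop (π' j) (code w')) := by
  induction j generalizing p with
  | zero =>
    refine ⟨p, fun w w' h π h0 _ => ⟨fun _ => 0, rfl, by simp, ?_⟩⟩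
    rw [h0]
    exact h
  | succ j ih =>
    obtain ⟨Q, hQ⟩ := exists_cut_of_vle A p
    obtain ⟨P, hP⟩ := ih (p := max p Q) (hp.trans (le_max_left _ _))
    refine ⟨P, fun w w' h π h0 hπ => ?_⟩
    obtain ⟨π', h0', hπ', hd⟩ := hP w w' h π h0 fun i hi => hπ i (by omega)
    have hj := hπ j (by omega)
    obtain ⟨m', -, h1, h2⟩ := hQ _ _ (hd.mono (le_max_right _ _)) (π (j + 1) - π j)
      (by simp [vDrop, code])
    have hm' : 0 < m' := by
      by_contra hm'
      obtain rfl : m' = 0 := by omega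
      have h3 : w (π j) ∈ valph (vTake (π (j + 1) - π j) (vDrop (π j) (code w))) :=
        ⟨0, by simp only [vTake]; rw [if_pos (by omega)]; simp [vDrop, code]⟩
      rw [h1.valph_eq hp] at h3
      obtain ⟨i, hi⟩ := h3
      simp [vTake] at hi
    refine ⟨fun i => if i ≤ j then π' i else π' j + m', by simp [h0'], fun i hi => ?_, ?_⟩
    · rcases Nat.lt_or_ge i j with hij | hij
      · have h4 : i ≤ j := by omega
        have h5 : i + 1 ≤ j := by omega
        simp only [h4, h5, if_true]
        exact ⟨(hπ' i hij).1, (hπ' i hij).2.mono (le_max_left _ _)⟩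
      · obtain rfl : i = j := by omega
        simp only [le_refl, if_true, show ¬ (i + 1 ≤ i) by omega, if_false]
        refine ⟨by omega, ?_⟩
        unfold WLE
        rw [code_factor _ hj, code_factor _ (by omega), Nat.add_sub_cancel_left]
        exact h1
    · rw [vDrop_vDrop, vDrop_vDrop, Nat.sub_add_cancel hj.le] at h2
      simp only [show ¬ (j + 1 ≤ j) by omega, if_false]
      rwa [add_comm (π' j)]

end

/-! ### Alternation and indistinguishable words -/

section
variable {A : Type u} {W : Type v} [WordModel A W]

theorem flatten_replicate_pair {S : Type*} (n : ℕ) (s t : S) :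
    (List.replicate n [s, t]).flatten =
      (List.range (2 * n)).map fun i => if i % 2 = 0 then s else t := by
  induction n with
  | zero => rfl
  | succ n ih =>
    rw [List.replicate_succ', List.flatten_append, ih, show 2 * (n + 1) = 2 * n + 1 + 1 by ring,
      List.range_succ, List.range_succ, List.map_append, List.map_append]
    have h1 : (2 * n) % 2 = 0 := by omega
    simp [h1]

/-- The alternation of a map into a finite set is unbounded if and only if there are words on every
level that are equivalent but have different images. -/
theorem not_hasBoundedAlternation_iff [CodedWords A W] [Finite A] {S : Type*} [Finite S]
    {β : W → S} :
    ¬ HasBoundedAlternation 2 β ↔ ∀ p, ∃ w w' : W, WLE p w w' ∧ WLE p w' w ∧ β w ≠ β w' := by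
  unfold HasBoundedAlternation
  rw [not_not]
  constructor
  · rintro ⟨s, t, hst, hne⟩ p
    have := (finite_monomials (A := A) p).to_subtype
    -- Among the words of a long chain two have the same type.
    let f : W → Set (monomials A p) := fun w => {M | VMem (code w) M.1.1 M.1.2}
    have hf : ∀ w w', f w ⊆ f w' → WLE p w w' := fun w w' h B l hl hV =>
      h (show (⟨(B, l), hl⟩ : monomials A p) ∈ f w from hV)
    have hf' : ∀ w w', WLE p w w' → f w ⊆ f w' := fun w w' h M hM => h _ _ M.2 hM
    set n := Nat.card (Set (monomials A p)) + 1 with hn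
    obtain ⟨-, h⟩ := mem_sigmaChains_iff.1 (hst n (by omega))
    obtain ⟨ws, hc, hm⟩ := h p
    rw [flatten_replicate_pair] at hm
    have hlen : ws.length = 2 * n := by
      have := congrArg List.length hm
      simpa using this
    have : IsTrans W (WLE p) := ⟨fun _ _ _ => WLE.trans⟩
    have hp := List.pairwise_iff_getElem.1 hc.pairwise
    have hβ : ∀ i (hi : i < ws.length), β ws[i] = if i % 2 = 0 then s else t := by
      intro i hi
      have h1 : (ws.map β)[i]'(by simpa using hi) = _ := List.getElem_of_eq hm _
      simpa using h1
    obtain ⟨i, j, hij, hfij⟩ : ∃ i j : Fin n, i < j ∧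
        f (ws[2 * i.1]'(by omega)) = f (ws[2 * j.1]'(by omega)) := by
      by_contra hcon
      push Not at hcon
      have hinj : Function.Injective (fun i : Fin n => f (ws[2 * i.1]'(by omega))) := by
        intro a b hab
        rcases lt_trichotomy a b with h | h | h
        · exact absurd hab (hcon a b h)
        · exact h
        · exact absurd hab.symm (hcon b a h)
      have := Nat.card_le_card_of_injective _ hinj
      rw [Nat.card_fin] at this
      omega
    have hij' : i.1 < j.1 := hij
    refine ⟨ws[2 * i.1]'(by omega), ws[2 * i.1 + 1]'(by omega),
      hp _ _ _ _ (by omega), hf _ _ ?_, ?_⟩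
    · rw [hfij]
      exact hf' _ _ (hp _ _ _ _ (by omega))
    · rw [hβ, hβ, if_pos (by omega), if_neg (by omega)]
      exact hne
  · intro h
    choose w w' h1 h2 h3 using h
    obtain ⟨⟨s, t⟩, hs⟩ := Finite.exists_infinite_fiber fun p => (β (w p), β (w' p))
    rw [Set.infinite_coe_iff] at hs
    refine ⟨s, t, fun n hn => mem_sigmaChains_iff.2 ⟨?_, fun p => ?_⟩, ?_⟩
    · intro h0
      have := congrArg List.length h0
      rw [flatten_replicate_pair] at this
      simp at this
      omega
    · obtain ⟨q, hq, hpq⟩ := hs.exists_gt p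
      simp only [Set.mem_preimage, Set.mem_singleton_iff, Prod.mk.injEq] at hq
      refine ⟨(List.range (2 * n)).map fun i => if i % 2 = 0 then w q else w' q, ?_, ?_⟩
      · apply List.Pairwise.isChain
        rw [List.pairwise_map]
        refine List.Pairwise.imp (R := fun _ _ => True) (fun {i j} _ => ?_)
          (List.pairwise_of_forall fun _ _ => trivial)
        refine WLE.mono hpq.le ?_
        split_ifs
        · exact WLE.refl _ _
        · exact h1 q
        · exact h2 q
        · exact WLE.refl _ _
      · rw [flatten_replicate_pair, List.map_map]
        refine List.map_congr_left fun i _ => ?_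
        simp only [Function.comp]
        split_ifs
        · exact hq.1
        · exact hq.2
    · obtain ⟨q, hq⟩ := hs.nonempty
      simp only [Set.mem_preimage, Set.mem_singleton_iff, Prod.mk.injEq] at hq
      rw [← hq.1, ← hq.2]
      exact h3 q

/-! ### Definability by `BΣ₂` sentences -/

/-- Negation exchanges the two kinds of quantifiers. -/
theorem exists_dual {b : Bool} {i n : ℕ} {φ : (wordLang A).BoundedFormula Empty n}
    (h : IsAlt b i φ) : ∃ ψ : (wordLang A).BoundedFormula Empty n, IsAlt (!b) i ψ ∧
      qrank ψ = qrank φ ∧ ∀ (w : W) xs, WRealize w ψ xs ↔ ¬ WRealize w φ xs := by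
  induction h with
  | @qf b i n φ h =>
    exact ⟨φ.not, IsAlt.qf h.not, by rw [qrank_of_isQF h.not, qrank_of_isQF h],
      fun w xs => wRealize_not w φ xs⟩
  | ex _ ih =>
    obtain ⟨ψ, h1, h2, h3⟩ := ih
    exact ⟨ψ.all, IsAlt.all h1, by rw [qrank_ex, qrank, h2], fun w xs => by
      rw [wRealize_all, wRealize_ex, not_exists]; exact forall_congr' fun p => h3 w _⟩
  | all _ ih =>
    obtain ⟨ψ, h1, h2, h3⟩ := ih
    exact ⟨ψ.ex, IsAlt.ex h1, by rw [qrank_ex, qrank, h2], fun w xs => by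
      rw [wRealize_all, wRealize_ex, not_forall]; exact exists_congr fun p => h3 w _⟩
  | switch _ ih =>
    obtain ⟨ψ, h1, h2, h3⟩ := ih
    exact ⟨ψ, IsAlt.switch h1, h2, h3⟩

/-- A `BΣ₂` sentence does not distinguish words that are equivalent on a suitable level. -/
theorem exists_sat_iff_of_isBSigma {φ : (wordLang A).Sentence} (h : IsBSigma 2 φ) :
    ∃ k, ∀ w w' : W, SigmaLE 2 k w w' → SigmaLE 2 k w' w → (Sat w φ ↔ Sat w' φ) := by
  have mono : ∀ {k k'} {w w' : W}, k ≤ k' → SigmaLE 2 k' w w' → SigmaLE 2 k w w' :=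
    fun hk h φ hφ hr => h φ hφ (hr.trans hk)
  induction h with
  | @sigma φ h => exact ⟨qrank φ, fun w w' h1 h2 => ⟨h1 φ h le_rfl, h2 φ h le_rfl⟩⟩
  | @pi φ h =>
    obtain ⟨ψ, h3, h4, h5⟩ := exists_dual (W := W) h
    refine ⟨qrank ψ, fun w w' h1 h2 => ?_⟩
    have h6 : ∀ w : W, Sat w ψ ↔ ¬ Sat w φ := fun w => h5 w default
    rw [← not_iff_not, ← h6, ← h6]
    exact ⟨h1 ψ h3 le_rfl, h2 ψ h3 le_rfl⟩
  | @not φ _ ih =>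
    obtain ⟨k, hk⟩ := ih
    refine ⟨k, fun w w' h1 h2 => ?_⟩
    exact not_congr (hk w w' h1 h2)
  | @inf φ ψ _ _ ih ih' =>
    obtain ⟨k, hk⟩ := ih
    obtain ⟨k', hk'⟩ := ih'
    refine ⟨max k k', fun w w' h1 h2 => ?_⟩
    simp only [sat_iff_wRealize _ _ Fin.elim0] at hk hk' ⊢
    rw [wRealize_inf, wRealize_inf,
      hk w w' (mono (le_max_left _ _) h1) (mono (le_max_left _ _) h2),
      hk' w w' (mono (le_max_right _ _) h1) (mono (le_max_right _ _) h2)]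
  | @sup φ ψ _ _ ih ih' =>
    obtain ⟨k, hk⟩ := ih
    obtain ⟨k', hk'⟩ := ih'
    refine ⟨max k k', fun w w' h1 h2 => ?_⟩
    simp only [sat_iff_wRealize _ _ Fin.elim0] at hk hk' ⊢
    rw [wRealize_sup, wRealize_sup,
      hk w w' (mono (le_max_left _ _) h1) (mono (le_max_left _ _) h2),
      hk' w w' (mono (le_max_right _ _) h1) (mono (le_max_right _ _) h2)]

theorem BSigmaDefinable.compl {L : Set W} (h : BSigmaDefinable 2 L) : BSigmaDefinable 2 Lᶜ := by
  obtain ⟨φ, hφ, rfl⟩ := h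
  exact ⟨_, hφ.not, rfl⟩

theorem BSigmaDefinable.union {L L' : Set W} (h : BSigmaDefinable 2 L)
    (h' : BSigmaDefinable 2 L') : BSigmaDefinable 2 (L ∪ L') := by
  obtain ⟨φ, hφ, rfl⟩ := h
  obtain ⟨φ', hφ', rfl⟩ := h'
  refine ⟨_, hφ.sup hφ', Set.ext fun w => ?_⟩
  exact (wRealize_sup w φ φ' default).symm

theorem bSigmaDefinable_empty : BSigmaDefinable 2 (∅ : Set W) :=
  ⟨⊥, IsBSigma.sigma (IsAlt.qf FirstOrder.Language.BoundedFormula.isQF_bot),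
    Set.ext fun _ => Iff.rfl⟩

theorem BSigmaDefinable.iUnion {ι : Type*} [Finite ι] {D : ι → Set W}
    (h : ∀ i, BSigmaDefinable 2 (D i)) : BSigmaDefinable 2 (⋃ i, D i) := by
  classical
  have := Fintype.ofFinite ι
  have key : ∀ s : Finset ι, BSigmaDefinable 2 (⋃ i ∈ s, D i) := by
    intro s
    induction s using Finset.induction_on with
    | empty => simpa using bSigmaDefinable_empty
    | insert i s _ ih =>
      rw [Finset.set_biUnion_insert]
      exact (h i).union ih
  simpa using key Finset.univ

theorem BSigmaDefinable.iInter {ι : Type*} [Finite ι] {D : ι → Set W}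
    (h : ∀ i, BSigmaDefinable 2 (D i)) : BSigmaDefinable 2 (⋂ i, D i) := by
  rw [← compl_compl (⋂ i, D i), Set.compl_iInter]
  exact (BSigmaDefinable.iUnion fun i => (h i).compl).compl

/-- A set of words that does not distinguish words in the same monomials of degree at most `p` is
definable in `BΣ₂`. -/
theorem bSigmaDefinable_of_wle [CodedWords A W] [Finite A] (p : ℕ) {L : Set W}
    (h : ∀ w w' : W, WLE p w w' → WLE p w' w → w ∈ L → w' ∈ L) : BSigmaDefinable 2 L := by
  have := (finite_monomials (A := A) p).to_subtype
  have hD : ∀ M : monomials A p, BSigmaDefinable 2 {w : W | VMem (code w) M.1.1 M.1.2} := by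
    intro M
    obtain ⟨φ, hφ, -, hs⟩ := exists_sigma_vmem.{u, v} M.1.1 M.1.2
    refine ⟨φ, IsBSigma.sigma hφ, Set.ext fun w => ?_⟩
    obtain ⟨ι, hι⟩ := represents w
    exact (hs hι).symm
  let f : W → Set (monomials A p) := fun w => {M | VMem (code w) M.1.1 M.1.2}
  have hf : ∀ w w', f w = f w' → WLE p w w' := fun w w' h B l hl hV =>
    h.le (show (⟨(B, l), hl⟩ : monomials A p) ∈ f w from hV)
  have e : L = ⋃ T : {T : Set (monomials A p) // ∃ w ∈ L, f w = T}, ⋂ M : monomials A p,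
      {w | M ∈ f w ↔ M ∈ T.1} := by
    ext w
    simp only [Set.mem_iUnion, Set.mem_iInter]
    constructor
    · exact fun hw => ⟨⟨f w, w, hw, rfl⟩, fun M => Iff.rfl⟩
    · rintro ⟨⟨_, w', hw', rfl⟩, hM⟩
      have h1 : f w = f w' := Set.ext hM
      exact h w' w (hf _ _ h1.symm) (hf _ _ h1) hw'
  rw [e]
  refine BSigmaDefinable.iUnion fun T => BSigmaDefinable.iInter fun M => ?_
  by_cases hM : M ∈ T.1
  · simp only [hM, iff_true]
    exact hD M
  · simp only [hM, iff_false]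
    exact (hD M).compl

end

/-! ### The syntactic morphism and its alphabet completion -/

/-- The properties of the alphabet completion `α` of the syntactic morphism of `L` that matter:
`α` is finite and alphabet compatible, it recognizes `L`, and it identifies all syntactically
equivalent words with the same alphabet. -/
structure IsCompletedSyntactic {A : Type u} (L : Set (ℕ → A)) (α : OmegaMorphism A) : Prop where
  finite_plus : Finite α.Plus
  finite_inf : Finite α.Inf
  compatible : AlphabetCompatible α
  plus_eq : ∀ x y : FreeSemigroup A, alph x = alph y → SynEquivPlus L x y → α.plus x = α.plus y
  inf_eq : ∀ w w' : ℕ → A, alph w = alph w' → SynEquivInf L w w' → α.inf w = α.inf w'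
  synEquivInf : ∀ w w' : ℕ → A, α.inf w = α.inf w' → SynEquivInf L w w'

section
variable {A : Type u}

theorem plus_appendList_congr (α : OmegaMorphism A) {x x' : FreeSemigroup A}
    (h : α.plus x = α.plus x') (y : List A) :
    α.plus (appendList x y) = α.plus (appendList x' y) := by
  match y with
  | [] =>
    have e : ∀ r : FreeSemigroup A, appendList r [] = r := fun r =>
      letters_injective (by simp [letters_appendList])
    rwa [e, e]
  | a :: y =>
    have e : ∀ r : FreeSemigroup A, appendList r (a :: y) = r * ⟨a, y⟩ := fun r =>
      letters_injective rfl
    rw [e, e, map_mul, map_mul, h]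

theorem synEquivPlus_of_plus_eq {L : Set (ℕ → A)} (α : OmegaMorphism A) {F : Set α.Inf}
    (hL : L = α.inf ⁻¹' F) {x x' : FreeSemigroup A} (h : α.plus x = α.plus x') :
    SynEquivPlus L x x' := by
  constructor
  · intro y z r
    refine synEquivInf_of_inf_eq α hL ?_ y
    have h1 := α.map_act (appendList x z) (infPow r)
    have h2 := α.map_act (appendList x' z) (infPow r)
    rw [plus_appendList_congr α h] at h1
    exact h1.trans h2.symm
  · intro y z
    refine synEquivInf_of_inf_eq α hL ?_ y
    unfold infPow
    rw [α.map_infProd, α.map_infProd, plus_appendList_congr α h]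

theorem finite_synPlus {L : Set (ℕ → A)} (hL : IsRegular L) : Finite (SynPlus L) := by
  obtain ⟨α, _, _, F, hF⟩ := hL
  refine Finite.of_injective (fun x : SynPlus L => α.plus (Quotient.out (s := synPlus L) x)) ?_
  intro x y hxy
  rw [← synPlusHom_out L x, ← synPlusHom_out L y]
  exact Quotient.sound (s := synPlus L) (synEquivPlus_of_plus_eq α hF hxy)

theorem finite_synInf {L : Set (ℕ → A)} (hL : IsRegular L) : Finite (SynInf L) := by
  obtain ⟨α, _, _, F, hF⟩ := hL
  refine Finite.of_injective (fun x : SynInf L => α.inf (Quotient.out (s := synInf L) x)) ?_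
  intro x y hxy
  rw [← Quotient.out_eq (s := synInf L) x, ← Quotient.out_eq (s := synInf L) y]
  exact Quotient.sound (s := synInf L) (synEquivInf_of_inf_eq α hF hxy)

theorem finite_alphabets [Finite A] : Finite (Alphabets A) :=
  Finite.of_injective Alphabets.toSet fun _ _ => Alphabets.ext

theorem isCompletedSyntactic_alphabetCompletion [Finite A] (L : Set (ℕ → A)) (hL : IsRegular L) :
    IsCompletedSyntactic L (alphabetCompletion (syntacticMorphism L hL)) := by
  have hp := finite_synPlus hL
  have hi := finite_synInf hL
  have ha := finite_alphabets (A := A)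
  have hc := alphabetCompletion_compatible (syntacticMorphism L hL)
  by_cases h : AlphabetCompatible (syntacticMorphism L hL)
  · rw [alphabetCompletion, if_pos h] at hc ⊢
    exact ⟨hp, hi, hc, fun _ _ _ h => Quotient.sound (s := synPlus L) h,
      fun _ _ _ h => Quotient.sound (s := synInf L) h, fun _ _ h => Quotient.exact (s := synInf L) h⟩
  · rw [alphabetCompletion, if_neg h] at hc ⊢
    refine ⟨@Finite.instProd _ _ hp ha, @Finite.instProd _ _ hi ha, hc,
      fun x y h h' => Prod.ext (Quotient.sound (s := synPlus L) h') (congrArg Alphabets.mk h),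
      fun x y h h' => Prod.ext (Quotient.sound (s := synInf L) h') (congrArg Alphabets.mk h),
      fun x y h => Quotient.exact (s := synInf L) (congrArg Prod.fst h)⟩

/-! ### Definability and bounded alternation -/

variable [Finite A] {L : Set (ℕ → A)} {α : OmegaMorphism A}

theorem hasBoundedAlternation_inf_of_bSigmaDefinable (hα : IsCompletedSyntactic L α)
    (h : BSigmaDefinable 2 L) : HasBoundedAlternation 2 α.inf := by
  have := hα.finite_inf
  by_contra hb
  rw [not_hasBoundedAlternation_iff] at hb
  obtain ⟨φ, hφ, rfl⟩ := h
  obtain ⟨k, hk⟩ := exists_sat_iff_of_isBSigma (W := ℕ → A) hφ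
  obtain ⟨P, hP⟩ := exists_wle_imp_sigmaLE (ℕ → A) k
  obtain ⟨w, w', h1, h2, hne⟩ := hb (max P 1)
  refine hne (hα.inf_eq w w' (h1.alph_eq (le_max_right _ _)) fun x => ?_)
  exact hk _ _ (hP _ _ ((WLE.appendInf (VLE.refl _ _) h1).mono (le_max_left _ _)))
    (hP _ _ ((WLE.appendInf (VLE.refl _ _) h2).mono (le_max_left _ _)))

theorem bSigmaDefinable_of_hasBoundedAlternation_inf (hα : IsCompletedSyntactic L α)
    (h : HasBoundedAlternation 2 α.inf) : BSigmaDefinable 2 L := by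
  have := hα.finite_inf
  rw [← not_not (a := HasBoundedAlternation 2 α.inf), not_hasBoundedAlternation_iff] at h
  push Not at h
  obtain ⟨p, hp⟩ := h
  refine bSigmaDefinable_of_wle p fun w w' h1 h2 hw => ?_
  have h3 := hα.synEquivInf w w' (hp w w' h1 h2) []
  rw [appendInf_nil, appendInf_nil] at h3
  exact h3.1 hw

end

/-! ### Bounded alternation on infinite words implies the conditions on finite words -/

section
variable {S T : Type*} [Semigroup S] [OmegaSemigroup S T]

theorem segProd_const (s : S) (i n : ℕ) : segProd (fun _ => s) i n = sPow s n := by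
  unfold sPow
  induction n with
  | zero => rfl
  | succ n ih => rw [segProd, segProd, ih]

theorem infPow_sPow (s : S) (n : ℕ) : (infPow (sPow s n) : T) = infPow s := by
  have h := OmegaSemigroup.infProd_regroup (T := T) (fun _ => s) (fun i => (n + 1) * i)
    (strictMono_mul_left_of_pos (Nat.succ_pos n)) (by simp)
  refine Eq.trans ?_ h
  unfold infPow
  congr 1
  funext i
  rw [segProd_const]
  congr 1
  rw [Nat.mul_succ]
  omega

end

section
variable {A : Type u} {L : Set (ℕ → A)} {α : OmegaMorphism A}

theorem plus_sPow (x : FreeSemigroup A) (n : ℕ) : α.plus (sPow x n) = sPow (α.plus x) n :=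
  segProd_map α.plus _ _ _

theorem inf_infPow (x : FreeSemigroup A) : α.inf (infPow x) = infPow (α.plus x) :=
  α.map_infProd _

theorem alph_segProd {f : ℕ → FreeSemigroup A} {B : Set A} {i n : ℕ}
    (h : ∀ j, i ≤ j → j ≤ i + n → alph (f j) = B) : alph (segProd f i n) = B := by
  induction n with
  | zero => exact h i le_rfl le_rfl
  | succ n ih =>
    rw [segProd, alph_mul, ih fun j h1 h2 => h j h1 (by omega), h _ (by omega) (by omega),
      Set.union_self]

theorem alph_sPow (x : FreeSemigroup A) (n : ℕ) : alph (sPow x n) = alph x :=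
  alph_segProd fun _ _ _ => rfl

variable [Finite A]

/-- Equivalent words with different images under `α.plus` have the same alphabet, so they are not
syntactically equivalent. A context that separates them makes equivalent infinite words of them, one
of which is in `L` and the other is not. -/
theorem hasBoundedAlternation_plus_of_inf (hα : IsCompletedSyntactic L α)
    (h : HasBoundedAlternation 2 α.inf) : HasBoundedAlternation 2 α.plus := by
  have := hα.finite_inf
  have := hα.finite_plus
  by_contra hb
  refine not_hasBoundedAlternation_iff.2 (fun p => ?_) h
  obtain ⟨x, x', h1, h2, hne⟩ := not_hasBoundedAlternation_iff.1 hb (max p 1)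
  have hs : ¬ SynEquivPlus L x x' := fun hs =>
    hne (hα.plus_eq x x' (h1.alph_eq (le_max_right _ _)) hs)
  replace h1 := h1.mono (le_max_left p 1)
  replace h2 := h2.mono (le_max_left p 1)
  have sep : ∀ w w' : ℕ → A, ¬ (w ∈ L ↔ w' ∈ L) → α.inf w ≠ α.inf w' := by
    intro w w' hw he
    have := hα.synEquivInf w w' he []
    rw [appendInf_nil, appendInf_nil] at this
    exact hw this
  have happ : ∀ {x x' : FreeSemigroup A} (y : List A), WLE p x x' →
      WLE p (appendList x y) (appendList x' y) := fun y h => VLE.append h (VLE.refl _ _)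
  unfold SynEquivPlus at hs
  rw [not_and_or] at hs
  rcases hs with hs | hs
  · push Not at hs
    obtain ⟨y, z, r, hs⟩ := hs
    refine ⟨_, _, ?_, ?_, sep (appendInf y (appendInf (letters (appendList x z)) (infPow r)))
      (appendInf y (appendInf (letters (appendList x' z)) (infPow r))) (by tauto)⟩
    · exact WLE.appendInf (VLE.refl _ _) (WLE.appendInf (happ z h1) (WLE.refl _ _))
    · exact WLE.appendInf (VLE.refl _ _) (WLE.appendInf (happ z h2) (WLE.refl _ _))
  · push Not at hs
    obtain ⟨y, z, hs⟩ := hs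
    refine ⟨_, _, ?_, ?_, sep (appendInf y (infPow (appendList x z)))
      (appendInf y (infPow (appendList x' z))) (by tauto)⟩
    · exact WLE.appendInf (VLE.refl _ _) (WLE.infPow (happ z h1))
    · exact WLE.appendInf (VLE.refl _ _) (WLE.infPow (happ z h2))

/-- If the two sides of the equation were different, they would be the images of equivalent words,
namely `(u₂ v₂^N)^∞` and `(u₂ v₂^N)^M u₁ v₁^∞` with words `u₁ ≲ u₂` and `v₁ ≲ v₂` for the two chains
and large exponents. -/
theorem infPow_eq_of_hasBoundedAlternation_inf (hα : IsCompletedSyntactic L α)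
    (h : HasBoundedAlternation 2 α.inf) {s₁ s₂ t₁ t₂ : α.Plus}
    (hs : [s₁, s₂] ∈ sigmaChains 2 α.plus) (ht : [t₁, t₂] ∈ sigmaChains 2 α.plus)
    (hst : content α s₁ = content α t₁) :
    (infPow (s₂ * omegaPow t₂) : α.Inf) =
      OmegaSemigroup.act (omegaPow (s₂ * omegaPow t₂)) (OmegaSemigroup.act s₁ (infPow t₁)) := by
  have := hα.finite_inf
  have := hα.finite_plus
  by_contra hne
  refine not_hasBoundedAlternation_iff.2 (fun p => ?_) h
  obtain ⟨u₁, u₂, hu, rfl, rfl⟩ := mem_sigmaChains_pair_iff.1 hs (max p 1)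
  obtain ⟨v₁, v₂, hv, rfl, rfl⟩ := mem_sigmaChains_pair_iff.1 ht (max p 1)
  rw [content_plus hα.compatible, content_plus hα.compatible] at hst
  have hu' := hu.alph_eq (le_max_right p 1)
  have hv' := hv.alph_eq (le_max_right p 1)
  replace hu := hu.mono (le_max_left p 1)
  replace hv := hv.mono (le_max_left p 1)
  set x := sPow v₂ (omegaExp α.Plus) with hx
  set y := u₂ * sPow x p with hy
  set z := sPow y (omegaExp α.Plus) with hz
  have hαx : α.plus x = omegaPow (α.plus v₂) := plus_sPow _ _
  have hαy : α.plus y = α.plus u₂ * omegaPow (α.plus v₂) := by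
    rw [hy, map_mul, plus_sPow, hαx, sPow_idem (isIdempotentElem_omegaPow _)]
  have hαz : α.plus z = omegaPow (α.plus u₂ * omegaPow (α.plus v₂)) := by
    rw [hz, plus_sPow, hαy]; rfl
  have hX : α.inf (infPow y) = infPow (α.plus u₂ * omegaPow (α.plus v₂)) := by
    rw [inf_infPow, hαy]
  have hY : α.inf (OmegaSemigroup.act (sPow z p) (OmegaSemigroup.act u₁ (infPow v₁)))
      = OmegaSemigroup.act (omegaPow (α.plus u₂ * omegaPow (α.plus v₂)))
        (OmegaSemigroup.act (α.plus u₁) (infPow (α.plus v₁))) := by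
    rw [α.map_act, α.map_act, plus_sPow, hαz, sPow_idem (isIdempotentElem_omegaPow _), inf_infPow]
  have hax : alph x = alph v₂ := alph_sPow _ _
  have hay : alph y = alph v₂ := by
    rw [hy, alph_mul, alph_sPow, hax, ← hu', ← hv', hst, Set.union_self]
  have haz : alph z = alph v₂ := by rw [hz, alph_sPow, hay]
  refine ⟨infPow y, OmegaSemigroup.act (sPow z p) (OmegaSemigroup.act u₁ (infPow v₁)), ?_, ?_, ?_⟩
  · have e : (infPow y : ℕ → A) = infPow z := (infPow_sPow y _).symm
    rw [e]
    refine wle_infPow_act_sPow p ?_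
    rw [alph_act, alph_infPow, haz, hst, hv', Set.union_self]
  · have e : (infPow y : ℕ → A) = OmegaSemigroup.act (sPow z p) (infPow y) := by
      have h1 := act_sPow_infPow (T := ℕ → A) z p
      have h2 : (infPow z : ℕ → A) = infPow y := infPow_sPow y _
      rw [h2] at h1
      exact h1.symm
    conv_rhs => rw [e]
    refine WLE.act (WLE.refl _ _) ?_
    have e' : (infPow y : ℕ → A) = OmegaSemigroup.act u₂ (OmegaSemigroup.act (sPow x p)
        (infPow y)) := by
      rw [← OmegaSemigroup.mul_act]
      exact (act_sPow_infPow (T := ℕ → A) y 0).symm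
    rw [e']
    refine WLE.act hu (WLE.trans (WLE.infPow hv) ?_)
    have e'' : (infPow v₂ : ℕ → A) = infPow x := (infPow_sPow v₂ _).symm
    rw [e'']
    refine wle_infPow_act_sPow p ?_
    rw [alph_infPow, hay, hax]
  · rw [hX, hY]
    exact hne

end

/-! ### Factorizations of equivalent infinite words -/

section
variable {S : Type*} [Semigroup S]

theorem segProd_congr {f g : ℕ → S} {i n : ℕ} (h : ∀ j, i ≤ j → j ≤ i + n → f j = g j) :
    segProd f i n = segProd g i n := by
  induction n with
  | zero => exact h i le_rfl le_rfl
  | succ n ih =>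
    rw [segProd, segProd, ih fun j h1 h2 => h j h1 (by omega), h _ (by omega) (by omega)]

/-- The product `f a * ⋯ * f (b - 1)`, for `a < b`. -/
def prodIco (f : ℕ → S) (a b : ℕ) : S := segProd f a (b - a - 1)

theorem prodIco_mul (f : ℕ → S) {a b c : ℕ} (hab : a < b) (hbc : b < c) :
    prodIco f a b * prodIco f b c = prodIco f a c := by
  unfold prodIco
  rw [show c - a - 1 = (b - a - 1) + (c - b - 1) + 1 by omega, segProd_add,
    show a + (b - a - 1) + 1 = b by omega]

theorem prodIco_congr {f g : ℕ → S} {a b : ℕ} (hab : a < b) (h : ∀ i, a ≤ i → i < b → f i = g i) :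
    prodIco f a b = prodIco g a b :=
  segProd_congr fun j h1 h2 => h j h1 (by omega)

theorem prodIco_succ (f : ℕ → S) (a : ℕ) : prodIco f a (a + 1) = f a := by
  unfold prodIco
  rw [show a + 1 - a - 1 = 0 by omega]
  rfl

/-- If consecutive factors multiply to `s`, then the product of `n + 1` factors is the power. -/
theorem prodIco_eq_sPow {f : ℕ → S} {k : ℕ → ℕ} (hk : StrictMono k) {s : S}
    (h : ∀ n, prodIco f (k n) (k (n + 1)) = s) (m n : ℕ) :
    prodIco f (k m) (k (m + n + 1)) = sPow s n := by
  induction n with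
  | zero => exact h m
  | succ n ih =>
    rw [← prodIco_mul f (hk (show m < m + n + 1 by omega))
      (hk (show m + n + 1 < m + (n + 1) + 1 by omega)), ih, show m + (n + 1) = m + n + 1 by omega, h]
    exact (sPow_add s n 0).symm

end

section
variable {A : Type u} {α : OmegaMorphism A}

theorem factor_mul (w : ℕ → A) {a b c : ℕ} (hab : a < b) (hbc : b < c) :
    factor w a b * factor w b c = factor w a c :=
  prodIco_mul (fun i => FreeSemigroup.of (w i)) hab hbc

theorem prodIco_factor (w : ℕ → A) {π : ℕ → ℕ} {j : ℕ} (hj : 0 < j) (h : ∀ i < j, π i < π (i + 1)) :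
    prodIco (fun i => factor w (π i) (π (i + 1))) 0 j = factor w (π 0) (π j) := by
  have lt : ∀ i, i < j → π 0 < π (i + 1) := by
    intro i hi
    induction i with
    | zero => exact h 0 hi
    | succ i ih => exact (ih (by omega)).trans (h _ hi)
  induction j with
  | zero => omega
  | succ j ih =>
    rcases Nat.eq_zero_or_pos j with rfl | hj
    · exact prodIco_succ _ 0
    · rw [← prodIco_mul _ hj (Nat.lt_add_one j), ih hj (fun i hi => h i (by omega))
        (fun i hi => lt i (by omega)), prodIco_succ, factor_mul w _ (h j (by omega))]
      have := lt (j - 1) (by omega)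
      rwa [Nat.sub_add_cancel hj] at this

theorem mem_alph_factor {w : ℕ → A} {a b : ℕ} (hab : a < b) {c : A} :
    c ∈ alph (factor w a b) ↔ ∃ i, a ≤ i ∧ i < b ∧ w i = c := by
  rw [alph_eq_valph, code_factor w hab]
  constructor
  · rintro ⟨i, hi⟩
    obtain ⟨h1, h2⟩ := lt_of_vTake_eq_some hi
    exact ⟨i + a, by omega, by omega, Option.some.inj h2⟩
  · rintro ⟨i, h1, h2, rfl⟩
    refine ⟨i - a, ?_⟩
    simp only [vTake, vDrop]
    rw [if_pos (by omega), Nat.sub_add_cancel h1]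
    rfl

theorem mem_valph_vDrop_code {w : ℕ → A} {a : ℕ} {c : A} :
    c ∈ valph (vDrop a (code w)) ↔ ∃ i, a ≤ i ∧ w i = c := by
  constructor
  · rintro ⟨i, hi⟩
    exact ⟨i + a, by omega, Option.some.inj hi⟩
  · rintro ⟨i, h1, rfl⟩
    refine ⟨i - a, ?_⟩
    simp only [vDrop]
    rw [Nat.sub_add_cancel h1]
    rfl

/-- `κ` cuts the infinite word `w` into an initial factor and factors all of whose products have
the idempotent image `e`. -/
structure IsRamseyCut (α : OmegaMorphism A) (w : ℕ → A) (e : α.Plus) (κ : ℕ → ℕ) : Prop where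
  idem : IsIdempotentElem e
  mono : StrictMono κ
  pos : ∀ m, 0 < κ m
  factor_eq : ∀ m n, m < n → α.plus (factor w (κ m) (κ n)) = e

theorem plus_factor (w : ℕ → A) (a b : ℕ) :
    α.plus (factor w a b) = prodIco (fun i => α.plus (FreeSemigroup.of (w i))) a b :=
  segProd_map α.plus _ _ _

theorem exists_isRamseyCut (α : OmegaMorphism A) [Finite α.Plus] (w : ℕ → A) :
    ∃ e κ, IsRamseyCut α w e κ := by
  obtain ⟨k, s, hk, hk0, hs⟩ := exists_monochromatic fun a b => α.plus (factor w a b)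
  set N := omegaExp α.Plus with hN
  have hκ : StrictMono fun m => k ((N + 1) * m) :=
    hk.comp (strictMono_mul_left_of_pos (Nat.succ_pos N))
  refine ⟨omegaPow s, fun m => k ((N + 1) * m), isIdempotentElem_omegaPow s, hκ,
    fun m => hk0.trans_le (hk.monotone (Nat.zero_le _)), fun m n hmn => ?_⟩
  obtain ⟨q, rfl⟩ : ∃ q, n = m + q + 1 := ⟨n - m - 1, by omega⟩
  simp only [plus_factor] at hs ⊢
  have h1 := prodIco_eq_sPow hk hs ((N + 1) * m) ((N + 1) * (q + 1) - 1)
  have h2 : (N + 1) * m + ((N + 1) * (q + 1) - 1) + 1 = (N + 1) * (m + q + 1) := by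
    have : 0 < (N + 1) * (q + 1) := by positivity
    rw [add_assoc m, Nat.mul_add (N + 1) m]
    omega
  rw [h2] at h1
  rw [h1, ← sPow_sPow]
  exact sPow_idem (isIdempotentElem_omegaPow s) q

namespace IsRamseyCut
variable {w : ℕ → A} {e : α.Plus} {κ : ℕ → ℕ}

theorem inf_eq (h : IsRamseyCut α w e κ) (m : ℕ) :
    α.inf w = OmegaSemigroup.act (α.plus (factor w 0 (κ m))) (infPow e) := by
  have hk : StrictMono (consSeq 0 fun n => κ (m + n)) := by
    refine strictMono_nat_of_lt_succ fun n => ?_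
    rcases n with _ | n
    · exact h.pos _
    · exact h.mono (by omega)
  have e1 : w = OmegaSemigroup.infProd (T := ℕ → A) (fun n =>
      factor w (consSeq 0 (fun n => κ (m + n)) n) (consSeq 0 (fun n => κ (m + n)) (n + 1))) :=
    (eq_infConcat_of w).trans
      (OmegaSemigroup.infProd_regroup (T := ℕ → A) (fun i => FreeSemigroup.of (w i)) _ hk rfl).symm
  unfold infPow
  rw [OmegaSemigroup.act_infProd]
  conv_lhs => rw [e1]
  rw [α.map_infProd]
  congr 1
  funext n
  rcases n with _ | n
  · rfl
  · exact h.factor_eq _ _ (by omega)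

theorem alph_factor (h : IsRamseyCut α w e κ) (hα : AlphabetCompatible α) {m n : ℕ} (hmn : m < n) :
    alph (factor w (κ m) (κ n)) = content α e := by
  rw [← h.factor_eq m n hmn, content_plus hα]

theorem valph_vDrop (h : IsRamseyCut α w e κ) (hα : AlphabetCompatible α) (m : ℕ) :
    valph (vDrop (κ m) (code w)) ⊆ content α e := by
  intro c hc
  obtain ⟨i, hi, rfl⟩ := mem_valph_vDrop_code.1 hc
  have h1 : i < κ (m + i + 1) := lt_of_lt_of_le (by omega) h.mono.le_apply
  rw [← h.alph_factor hα (show m < m + i + 1 by omega)]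
  exact (mem_alph_factor (h.mono (by omega))).2 ⟨i, hi, h1, rfl⟩

theorem content_subset_alph (h : IsRamseyCut α w e κ) (hα : AlphabetCompatible α) {a m n b : ℕ}
    (ham : a ≤ κ m) (hmn : m < n) (hnb : κ n ≤ b) : content α e ⊆ alph (factor w a b) := by
  have hlt := h.mono hmn
  intro c hc
  rw [← h.alph_factor hα hmn, mem_alph_factor hlt] at hc
  obtain ⟨i, h1, h2, rfl⟩ := hc
  exact (mem_alph_factor (by omega)).2 ⟨i, by omega, by omega, rfl⟩

theorem content_subset_valph (h : IsRamseyCut α w e κ) (hα : AlphabetCompatible α) (a : ℕ) :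
    content α e ⊆ valph (vDrop a (code w)) := by
  intro c hc
  have h1 := h.content_subset_alph hα (h.mono.le_apply (x := a)) (Nat.lt_add_one a) le_rfl hc
  have h3 : a ≤ κ a := h.mono.le_apply
  have h4 : κ a < κ (a + 1) := h.mono (Nat.lt_add_one a)
  rw [mem_alph_factor (by omega)] at h1
  obtain ⟨i, h2, -, rfl⟩ := h1
  exact mem_valph_vDrop_code.2 ⟨i, h2, rfl⟩

end IsRamseyCut

variable [Finite A]

/-- Letters that occur infinitely often in equivalent words are the same. -/
theorem exists_content_subset (hα : AlphabetCompatible α) :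
    ∃ P, ∀ (w w' : ℕ → A) (e e' : α.Plus) (κ κ' : ℕ → ℕ), IsRamseyCut α w e κ →
      IsRamseyCut α w' e' κ' → WLE P w w' → content α e' ⊆ content α e := by
  obtain ⟨P, hP⟩ := exists_cuts_of_wle A 1 (p := 1) le_rfl
  refine ⟨P, fun w w' e e' κ κ' h h' hw => ?_⟩
  obtain ⟨π', -, -, h1⟩ := hP w w' hw (fun i => if i = 0 then 0 else κ 0) rfl (by
    intro i hi
    obtain rfl : i = 0 := by omega
    simpa using h.pos 0)
  refine (h'.content_subset_valph hα (π' 1)).trans ?_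
  rw [← h1.valph_eq le_rfl]
  exact h.valph_vDrop hα 0

/-- Level `j` of the construction in `exists_levels`: `j` factors of the word `w`, the last of which
ends at a place of the Ramsey factorization `κ`, and all of which, except for the first, have the
alphabet `B`. -/
structure IsLevel (α : OmegaMorphism A) (w : ℕ → A) (κ : ℕ → ℕ) (B : Set A) (j : ℕ) (π : ℕ → ℕ) :
    Prop where
  zero : π 0 = 0
  lt : ∀ i < j, π i < π (i + 1)
  last : ∃ m, π j = κ m
  alph : ∀ i, 1 ≤ i → i < j → alph (factor w (π i) (π (i + 1))) = B

/-- Let the word `w (σ j)` be considered at level `j`. The cuts at level `j` are copied to level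
`j + 1`, with larger factors with respect to the preorder of level `n`, and one more cut is made far
behind them, at which the rest of the word has the image `(e (σ j))^∞`. -/
theorem exists_levels (hα : AlphabetCompatible α) [Finite α.Plus] (σ : ℕ → Bool) {n : ℕ}
    (hn : 1 ≤ n) :
    ∃ P, ∀ w : Bool → ℕ → A, (∀ b b', WLE P (w b) (w b')) →
      ∃ (e : Bool → α.Plus) (D : ℕ → ℕ → FreeSemigroup A),
        (∀ b, IsIdempotentElem (e b)) ∧
        (∀ j i, i < j → j < n → WLE n (D j i) (D (j + 1) i)) ∧
        (∀ j, 1 ≤ j → j ≤ n → α.inf (w (σ j)) =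
          OmegaSemigroup.act (α.plus (prodIco (D j) 0 j)) (infPow (e (σ j)))) ∧
        (∀ j i b, 1 ≤ i → i < j → j ≤ n → alph (D j i) = content α (e b)) ∧
        (∀ j, 1 ≤ j → j < n → σ j = σ (j + 1) → α.plus (D (j + 1) j) = e (σ j)) := by
  obtain ⟨P₀, hP₀⟩ := exists_content_subset hα
  choose f hf using fun j => exists_cuts_of_wle A j hn
  refine ⟨max P₀ ((Finset.range n).sup f), fun w hw => ?_⟩
  choose e κ hκ using fun b => exists_isRamseyCut α (w b)
  have hB : ∀ b b', content α (e b) = content α (e b') := by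
    intro b b'
    exact Set.Subset.antisymm
      (hP₀ _ _ _ _ _ _ (hκ b') (hκ b) ((hw b' b).mono (le_max_left _ _)))
      (hP₀ _ _ _ _ _ _ (hκ b) (hκ b') ((hw b b').mono (le_max_left _ _)))
  set B := content α (e true) with hBdef
  have step : ∀ j π, ∃ π', 1 ≤ j → j < n → IsLevel α (w (σ j)) (κ (σ j)) B j π →
      IsLevel α (w (σ (j + 1))) (κ (σ (j + 1))) B (j + 1) π' ∧
      (∀ i < j, WLE n (factor (w (σ j)) (π i) (π (i + 1)))
        (factor (w (σ (j + 1))) (π' i) (π' (i + 1)))) ∧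
      (σ j = σ (j + 1) → α.plus (factor (w (σ (j + 1))) (π' j) (π' (j + 1))) = e (σ j)) := by
    intro j π
    by_cases hj : 1 ≤ j ∧ j < n ∧ IsLevel α (w (σ j)) (κ (σ j)) B j π
    swap
    · exact ⟨π, fun h1 h2 h3 => absurd ⟨h1, h2, h3⟩ hj⟩
    obtain ⟨hj1, hjn, hπ⟩ := hj
    obtain ⟨m, hm⟩ := hπ.last
    have htail : valph (vDrop (π j) (code (w (σ j)))) ⊆ B := by
      rw [hm]
      exact ((hκ _).valph_vDrop hα m).trans (hB _ _).le
    -- If the word does not change, then the cuts are kept.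
    obtain ⟨ρ, m', hρ0, hρ, hρtail, hm', hσ⟩ : ∃ (ρ : ℕ → ℕ) (m' : ℕ), ρ 0 = 0 ∧
        (∀ i < j, ρ i < ρ (i + 1) ∧ WLE n (factor (w (σ j)) (π i) (π (i + 1)))
          (factor (w (σ (j + 1))) (ρ i) (ρ (i + 1)))) ∧
        valph (vDrop (ρ j) (code (w (σ (j + 1))))) ⊆ B ∧ ρ j ≤ κ (σ (j + 1)) m' ∧
        (σ j = σ (j + 1) → ρ j = κ (σ (j + 1)) m') := by
      by_cases hσ : σ j = σ (j + 1)
      · rw [← hσ]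
        exact ⟨π, m, hπ.zero, fun i hi => ⟨hπ.lt i hi, WLE.refl _ _⟩, htail, hm.le, fun _ => hm⟩
      · have hle : f j ≤ max P₀ ((Finset.range n).sup f) :=
          (Finset.le_sup (f := f) (Finset.mem_range.2 hjn)).trans (le_max_right _ _)
        obtain ⟨ρ, h1, h2, h3⟩ := hf j _ _ ((hw (σ j) (σ (j + 1))).mono hle) π hπ.zero hπ.lt
        exact ⟨ρ, ρ j, h1, h2, by rwa [← h3.valph_eq hn], (hκ _).mono.le_apply,
          fun h => absurd h hσ⟩
    have hlt := (hκ (σ (j + 1))).mono (Nat.lt_add_one m')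
    refine ⟨fun i => if i ≤ j then ρ i else κ (σ (j + 1)) (m' + 1), fun _ _ _ => ⟨⟨?_, ?_, ?_, ?_⟩,
      ?_, ?_⟩⟩
    · simpa using hρ0
    · intro i hi
      rcases Nat.lt_or_ge i j with hij | hij
      · simp only [show i ≤ j by omega, show i + 1 ≤ j by omega, if_true]
        exact (hρ i hij).1
      · obtain rfl : i = j := by omega
        simp only [le_refl, if_true, show ¬ (i + 1 ≤ i) by omega, if_false]
        omega
    · exact ⟨m' + 1, by simp⟩
    · intro i h1 hi
      rcases Nat.lt_or_ge i j with hij | hij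
      · simp only [show i ≤ j by omega, show i + 1 ≤ j by omega, if_true]
        rw [← (hρ i hij).2.alph_eq hn]
        exact hπ.alph i h1 hij
      · obtain rfl : i = j := by omega
        simp only [le_refl, if_true, show ¬ (i + 1 ≤ i) by omega, if_false]
        apply Set.Subset.antisymm
        · intro c hc
          obtain ⟨a, ha, -, rfl⟩ := (mem_alph_factor (by omega)).1 hc
          exact hρtail (mem_valph_vDrop_code.2 ⟨a, ha, rfl⟩)
        · exact (hB true (σ (i + 1))).le.trans
            ((hκ _).content_subset_alph hα hm' (Nat.lt_add_one m') le_rfl)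
    · intro i hi
      simp only [show i ≤ j by omega, show i + 1 ≤ j by omega, if_true]
      exact (hρ i hi).2
    · intro hσ'
      simp only [le_refl, if_true, show ¬ (j + 1 ≤ j) by omega, if_false]
      rw [hσ hσ', (hκ _).factor_eq _ _ (Nat.lt_add_one m'), hσ']
  choose F hF using step
  let st : ℕ → ℕ → ℕ := fun k => Nat.rec (fun i => if i = 0 then 0 else κ (σ 1) 0)
    (fun k π => F (k + 1) π) k
  have hst : ∀ k < n, IsLevel α (w (σ (k + 1))) (κ (σ (k + 1))) B (k + 1) (st k) := by
    intro k
    induction k with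
    | zero =>
      intro _
      refine ⟨rfl, fun i hi => ?_, ⟨0, rfl⟩, fun i h1 h2 => by omega⟩
      obtain rfl : i = 0 := by omega
      exact (hκ (σ 1)).pos 0
    | succ k ih =>
      intro hk
      exact (hF (k + 1) (st k) (by omega) hk (ih (by omega))).1
  refine ⟨e, fun j i => factor (w (σ j)) (st (j - 1) i) (st (j - 1) (i + 1)),
    fun b => (hκ b).idem, ?_, ?_, ?_, ?_⟩
  · intro j i hi hj
    obtain ⟨k, rfl⟩ : ∃ k, j = k + 1 := ⟨j - 1, by omega⟩
    exact (hF (k + 1) (st k) (by omega) hj (hst k (by omega))).2.1 i hi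
  · intro j hj hjn
    obtain ⟨k, rfl⟩ : ∃ k, j = k + 1 := ⟨j - 1, by omega⟩
    have hl := hst k (by omega)
    obtain ⟨m, hm⟩ := hl.last
    have h1 := prodIco_factor (w (σ (k + 1))) hj hl.lt
    rw [hm, hl.zero] at h1
    refine ((hκ _).inf_eq m).trans ?_
    rw [← h1]
    rfl
  · intro j i b h1 hi hjn
    obtain ⟨k, rfl⟩ : ∃ k, j = k + 1 := ⟨j - 1, by omega⟩
    exact ((hst k (by omega)).alph i h1 hi).trans (hB _ _)
  · intro j hj hjn hσ
    obtain ⟨k, rfl⟩ : ∃ k, j = k + 1 := ⟨j - 1, by omega⟩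
    exact (hF (k + 1) (st k) (by omega) hjn (hst k (by omega))).2.2 hσ

end

/-! ### Limits of factorizations -/

/-- An infinite scheme of images of factors, with the properties that the factorizations in
`exists_levels` have at a single rank `n`: for `i < j` the element `d j i` is the image of the
factor `i` at level `j`, where the word at level `j` has the image `v (σ j)`. -/
structure IsScheme {A : Type u} (α : OmegaMorphism A) (σ : ℕ → Bool) (e : Bool → α.Plus)
    (v : Bool → α.Inf) (d : ℕ → ℕ → α.Plus) : Prop where
  idem : ∀ b, IsIdempotentElem (e b)
  chain : ∀ (a b : ℕ) (js : List ℕ), a < b → js ≠ [] → js.Pairwise (· ≤ ·) → (∀ j ∈ js, b ≤ j) →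
    js.map (fun j => prodIco (d j) a b) ∈ sigmaChains 2 α.plus
  inf_eq : ∀ j, 1 ≤ j → v (σ j) = OmegaSemigroup.act (prodIco (d j) 0 j) (infPow (e (σ j)))
  content_eq : ∀ a b j c, 1 ≤ a → a < b → b ≤ j → content α (prodIco (d j) a b) = content α (e c)
  last : ∀ j, 1 ≤ j → σ j = σ (j + 1) → d (j + 1) j = e (σ j)

section
variable {A : Type u} {α : OmegaMorphism A}

theorem exists_forall_eq_limit {S : Type*} [Finite S] (f : ℕ → S) :
    ∃ s, ∀ᶠ n in (Filter.hyperfilter ℕ : Filter ℕ), f n = s := by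
  obtain ⟨s, hs⟩ := Ultrafilter.eq_pure_of_finite ((Filter.hyperfilter ℕ).map f)
  refine ⟨s, ?_⟩
  have : ({s} : Set S) ∈ (Filter.hyperfilter ℕ).map f := by rw [hs]; simp
  exact this

/-- If `α` has unbounded alternation on infinite words, then there is a scheme for two different
images: an ultrafilter limit of the factorizations in `exists_levels` for pairs of equivalent words
of growing rank `n`. -/
theorem exists_isScheme [Finite A] (hα : AlphabetCompatible α) [Finite α.Plus] [Finite α.Inf]
    (h : ¬ HasBoundedAlternation 2 α.inf) (σ : ℕ → Bool) :
    ∃ e v d, IsScheme α σ e v d ∧ v true ≠ v false := by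
  rw [not_hasBoundedAlternation_iff] at h
  choose P hP using fun n : ℕ => exists_levels hα σ (n := n + 1) (by omega)
  choose w w' h1 h2 h3 using fun n => h (P n)
  choose e D he hD hinf halph hlast using fun n => hP n (fun b : Bool => if b then w n else w' n) (by
    intro b b'
    cases b <;> cases b' <;> simp [WLE.refl, h1, h2])
  choose e' he' using fun b : Bool => exists_forall_eq_limit fun n => e n b
  choose v' hv' using fun b : Bool => exists_forall_eq_limit fun n => α.inf (if b then w n else w' n)
  choose d hd using fun j i => exists_forall_eq_limit fun n => α.plus (D n j i)
  -- Every finite part of the limit is a part of a factorization of arbitrarily large rank.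
  have approx : ∀ J : ℕ, ∃ n, J ≤ n ∧ (∀ b, e n b = e' b) ∧
      (∀ b : Bool, α.inf (if b then w n else w' n) = v' b) ∧
      ∀ j ≤ J, ∀ i ≤ J, α.plus (D n j i) = d j i := by
    intro J
    have hJ : ∀ᶠ n in (Filter.hyperfilter ℕ : Filter ℕ), J ≤ n := by
      apply Filter.mem_hyperfilter_of_finite_compl
      exact (Set.finite_Iio J).subset fun x hx => by simpa using hx
    have hdJ : ∀ᶠ n in (Filter.hyperfilter ℕ : Filter ℕ), ∀ j ∈ Set.Iic J, ∀ i ∈ Set.Iic J,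
        α.plus (D n j i) = d j i :=
      (Filter.eventually_all_finite (Set.finite_Iic J)).2 fun j _ =>
        (Filter.eventually_all_finite (Set.finite_Iic J)).2 fun i _ => hd j i
    obtain ⟨n, h4, h5, h6, h7⟩ := (hJ.and ((Filter.eventually_all.2 he').and
      ((Filter.eventually_all.2 hv').and hdJ))).exists
    exact ⟨n, h4, h5, h6, h7⟩
  have hprod : ∀ {n J j a b : ℕ}, (∀ j ≤ J, ∀ i ≤ J, α.plus (D n j i) = d j i) → a < b → b ≤ j →
      j ≤ J → α.plus (prodIco (D n j) a b) = prodIco (d j) a b := by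
    intro n J j a b hdJ hab hbj hjJ
    exact (segProd_map α.plus _ _ _).trans
      (prodIco_congr hab fun i _ hi => hdJ j hjJ i (by omega))
  have hD' : ∀ {n i j j' : ℕ}, i < j → j ≤ j' → j' ≤ n → WLE (n + 1) (D n j i) (D n j' i) := by
    intro n i j j' hij hjj' hj'
    induction j', hjj' using Nat.le_induction with
    | base => exact WLE.refl _ _
    | succ k hk ih => exact (ih (by omega)).trans (hD n k i (by omega) (by omega))
  refine ⟨e', v', d, ⟨fun b => ?_, fun a b js hab hne hjs hb => ?_, fun j hj => ?_,
    fun a b j c ha hab hbj => ?_, fun j hj hσ => ?_⟩, ?_⟩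
  · obtain ⟨n, -, h4, -⟩ := approx 0
    rw [← h4]
    exact he n b
  · refine mem_sigmaChains_iff.2 ⟨by simpa using hne, fun p => ?_⟩
    obtain ⟨J, hJ⟩ : ∃ J, ∀ j ∈ js, j ≤ J := ⟨js.sum, fun j hj => List.le_sum_of_mem hj⟩
    obtain ⟨n, hn, -, -, hdn⟩ := approx (max p J)
    have hJn : ∀ j ∈ js, j ≤ max p J := fun j hj => (hJ j hj).trans (le_max_right _ _)
    refine ⟨js.map fun j => prodIco (D n j) a b, ?_, ?_⟩
    · apply List.Pairwise.isChain
      rw [List.pairwise_map]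
      refine hjs.imp_of_mem fun {j j'} hj hj' hjj' => ?_
      have hpn : p ≤ n + 1 := by have := le_max_left p J; omega
      refine WLE.mono hpn (WLE.segProd fun i _ hi => ?_)
      have := hb j hj
      exact hD' (by omega) hjj' ((hJn j' hj').trans hn)
    · rw [List.map_map]
      exact List.map_congr_left fun j hj => hprod hdn hab (hb j hj) (hJn j hj)
  · obtain ⟨n, hn, h4, h5, hdn⟩ := approx j
    rw [← h4, ← h5, ← hprod hdn (by omega) le_rfl le_rfl]
    exact hinf n j hj (by omega)
  · obtain ⟨n, hn, h4, h5, hdn⟩ := approx j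
    rw [← h4, ← hprod hdn hab hbj le_rfl, content_plus hα]
    exact alph_segProd fun i h6 h7 => halph n j i c (by omega) (by omega) (by omega)
  · obtain ⟨n, hn, h4, h5, hdn⟩ := approx (j + 1)
    rw [← h4, ← hdn (j + 1) le_rfl j (by omega)]
    exact hlast n j hj (by omega) hσ
  · obtain ⟨n, -, -, h5, -⟩ := approx 0
    rw [← h5, ← h5]
    exact h3 n

/-! ### The conditions on finite words imply bounded alternation on infinite words -/

/-- A sequence all of whose finite subsequences are chains is eventually constant, if the alternation
is bounded. -/
theorem eventually_eq_of_chains {W : Type v} [WordModel A W] {S : Type*} [Finite S] {β : W → S}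
    (hβ : HasBoundedAlternation 2 β) {d : ℕ → S} {i : ℕ}
    (h : ∀ js : List ℕ, js ≠ [] → js.Pairwise (· ≤ ·) → (∀ j ∈ js, i ≤ j) →
      js.map d ∈ sigmaChains 2 β) : ∃ s, ∀ᶠ j in Filter.atTop, d j = s := by
  obtain ⟨s, hs⟩ := Finite.exists_infinite_fiber d
  rw [Set.infinite_coe_iff] at hs
  refine ⟨s, ?_⟩
  by_contra hcon
  have hfreq : ∃ᶠ j in Filter.atTop, d j ≠ s := Filter.not_eventually.1 hcon
  have hinf : {j | d j ≠ s}.Infinite := Nat.frequently_atTop_iff_infinite.1 hfreq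
  have := hinf.to_subtype
  obtain ⟨t, ht⟩ := Finite.exists_infinite_fiber fun j : {j | d j ≠ s} => d j
  have htne : t ≠ s := by
    obtain ⟨⟨⟨j, hj⟩, hjt⟩⟩ := ht.nonempty
    rintro rfl
    exact hj hjt
  have ht' : {j | d j = t}.Infinite := by
    rw [Set.infinite_coe_iff] at ht
    exact (ht.image Subtype.val_injective.injOn).mono (by rintro _ ⟨j, hj, rfl⟩; exact hj)
  obtain ⟨φ, hφ, hφ'⟩ := Filter.extraction_forall_of_frequently
    (P := fun n j => d j = (if n % 2 = 0 then s else t) ∧ i ≤ j) (by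
      intro n
      refine Filter.Frequently.and_eventually ?_ (Filter.eventually_ge_atTop i)
      rw [Nat.frequently_atTop_iff_infinite]
      split_ifs
      · exact hs
      · exact ht')
  refine hβ ⟨s, t, fun n hn => ?_, htne.symm⟩
  have h1 := h ((List.range (2 * n)).map φ) (by simp; omega) (by
    rw [List.pairwise_map]
    exact List.pairwise_lt_range.imp fun hab => (hφ hab).le) (by
      intro j hj
      obtain ⟨k, -, rfl⟩ := List.mem_map.1 hj
      exact (hφ' k).2)
  rw [List.map_map] at h1
  rw [flatten_replicate_pair]
  convert h1 using 1
  exact List.map_congr_left fun k _ => (hφ' k).1.symm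

theorem mul_mem_sigmaChains [Finite A] {s s' t t' : α.Plus} (h : [s, t] ∈ sigmaChains 2 α.plus)
    (h' : [s', t'] ∈ sigmaChains 2 α.plus) : [s * s', t * t'] ∈ sigmaChains 2 α.plus := by
  rw [mem_sigmaChains_pair_iff] at h h' ⊢
  intro p
  obtain ⟨x, y, h1, rfl, rfl⟩ := h p
  obtain ⟨x', y', h2, rfl, rfl⟩ := h' p
  exact ⟨x * x', y * y', h1.mul h2, map_mul _ _ _, map_mul _ _ _⟩

theorem prodIco_mem_sigmaChains [Finite A] {e : α.Plus} (he : IsIdempotentElem e) {f : ℕ → α.Plus} {a b : ℕ}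
    (hab : a < b) (h : ∀ i, a ≤ i → i < b → [e, f i] ∈ sigmaChains 2 α.plus) :
    [e, prodIco f a b] ∈ sigmaChains 2 α.plus := by
  induction b, hab using Nat.le_induction with
  | base => rw [prodIco_succ]; exact h a le_rfl (Nat.lt_add_one a)
  | succ b hb ih =>
    rw [← prodIco_mul f hb (Nat.lt_add_one b), prodIco_succ]
    have := mul_mem_sigmaChains (ih fun i h1 h2 => h i h1 (by omega)) (h b (by omega) (by omega))
    rwa [he] at this

section
variable {S T : Type*} [Semigroup S] [OmegaSemigroup S T]

theorem omegaPow_sPow [Finite S] (s : S) (n : ℕ) : omegaPow (sPow s n) = omegaPow s := by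
  unfold omegaPow
  rw [sPow_sPow, mul_comm, ← sPow_sPow]
  exact sPow_idem (isIdempotentElem_omegaPow s) n

theorem mul_sPow_eq {s t : S} (h : s * t = s) (n : ℕ) : s * sPow t n = s := by
  induction n with
  | zero => exact h
  | succ n ih =>
    have h1 := sPow_add t n 0
    rw [add_zero] at h1
    rw [h1, ← mul_assoc, ih]
    exact h

/-- `(s t)^∞ = s (t s)^∞` in all ω-semigroups. -/
theorem infPow_mul (s t : S) :
    (infPow (s * t) : T) = OmegaSemigroup.act s (infPow (t * s)) := by
  have key : ∀ s t : S, (infPow (s * t) : T)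
      = OmegaSemigroup.infProd (fun n : ℕ => if n % 2 = 0 then s else t) := by
    intro s t
    rw [← OmegaSemigroup.infProd_regroup (T := T)
      (fun n : ℕ => if n % 2 = 0 then s else t) (fun n => 2 * n)
      (fun a b h => by simpa using h) (by simp)]
    unfold infPow
    congr 1
    funext n
    have : 2 * (n + 1) - 2 * n - 1 = 1 := by omega
    simp only [this, segProd]
    rw [if_pos (by omega), if_neg (by omega)]
  rw [key s t, key t s, OmegaSemigroup.act_infProd]
  congr 1
  funext n
  rcases n with _ | n
  · rfl
  · simp only [consSeq]
    rcases Nat.mod_two_eq_zero_or_one n with h | h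
    · rw [if_neg (by omega), if_pos h]
    · rw [if_pos (by omega), if_neg (by omega)]

end

namespace IsScheme
variable {σ : ℕ → Bool} {e : Bool → α.Plus} {v : Bool → α.Inf} {d : ℕ → ℕ → α.Plus}

theorem exists_limit [Finite α.Plus] (h : IsScheme α σ e v d)
    (hb : HasBoundedAlternation 2 α.plus) :
    ∃ c : ℕ → α.Plus, ∀ K, ∃ J, ∀ j ≥ J, ∀ i < K, d j i = c i := by
  choose c hc using fun i => eventually_eq_of_chains hb (d := fun j => d j i) (i := i + 1)
    fun js h1 h2 h3 => by
      have := h.chain i (i + 1) js (Nat.lt_add_one i) h1 h2 h3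
      simpa only [prodIco_succ] using this
  refine ⟨c, fun K => ?_⟩
  have := (Filter.eventually_all_finite (Set.finite_Iio K)).2 fun i _ => hc i
  exact Filter.eventually_atTop.1 this

variable {c : ℕ → α.Plus}

theorem chain_limit (h : IsScheme α σ e v d) (hc : ∀ K, ∃ J, ∀ j ≥ J, ∀ i < K, d j i = c i)
    {a b j : ℕ} (hab : a < b) (hbj : b ≤ j) :
    [prodIco (d j) a b, prodIco c a b] ∈ sigmaChains 2 α.plus := by
  obtain ⟨J, hJ⟩ := hc b
  have h1 := h.chain a b [j, max j J] hab (by simp) (by simp) (by simp [hbj])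
  simp only [List.map_cons, List.map_nil] at h1
  rwa [prodIco_congr hab fun i _ hi => hJ (max j J) (le_max_right _ _) i hi] at h1

/-- In a long interval of levels with the same word there is a level `b` such that the limits of the
products that end at `b` are fixed by an element `t` which is above the idempotent `e`. -/
theorem exists_stable_level [Finite A] [Finite α.Plus] (h : IsScheme α σ e v d)
    (hc : ∀ K, ∃ J, ∀ j ≥ J, ∀ i < K, d j i = c i) {a : ℕ} (ha : 1 ≤ a) {s : Bool}
    (hσ : ∀ j, a ≤ j → j < a + (Nat.card α.Plus + 2) → σ j = s) :
    ∃ b t, a < b ∧ b < a + (Nat.card α.Plus + 2) ∧ [e s, t] ∈ sigmaChains 2 α.plus ∧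
      prodIco c a b * t = prodIco c a b := by
  -- While the word does not change, the new factor at each level has the image `e s`.
  have h1 : ∀ i, a ≤ i → i + 1 < a + (Nat.card α.Plus + 2) →
      [e s, c i] ∈ sigmaChains 2 α.plus := by
    intro i hi hi'
    have h2 := h.chain_limit hc (Nat.lt_add_one i) (le_refl (i + 1))
    rwa [prodIco_succ, prodIco_succ, h.last i (by omega)
      ((hσ i hi (by omega)).trans (hσ (i + 1) (by omega) hi').symm), hσ i hi (by omega)] at h2
  obtain ⟨x, y, hxy, he⟩ : ∃ x y : Fin (Nat.card α.Plus + 1), x < y ∧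
      prodIco c a (a + x.1 + 1) = prodIco c a (a + y.1 + 1) := by
    by_contra hcon
    push Not at hcon
    have hinj : Function.Injective fun x : Fin (Nat.card α.Plus + 1) =>
        prodIco c a (a + x.1 + 1) := by
      intro x y hxy
      rcases lt_trichotomy x y with h | h | h
      · exact absurd hxy (hcon x y h)
      · exact h
      · exact absurd hxy.symm (hcon y x h)
    have := Nat.card_le_card_of_injective _ hinj
    rw [Nat.card_fin] at this
    omega
  have hxy' : x.1 < y.1 := hxy
  refine ⟨a + y.1 + 1, prodIco c (a + x.1 + 1) (a + y.1 + 1), by omega, by omega,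
    prodIco_mem_sigmaChains (h.idem s) (by omega) fun i h2 h3 => h1 i (by omega) (by omega), ?_⟩
  conv_lhs => rw [← he]
  exact prodIco_mul c (by omega) (by omega)

/-- The image of the word at the levels `β 0, β 1, …` is determined by the limits, if the limits of
the factors between these levels are constant. -/
theorem inf_eq_limit [Finite α.Plus] (h : IsScheme α σ e v d)
    (hc : ∀ K, ∃ J, ∀ j ≥ J, ∀ i < K, d j i = c i)
    (hid : ∀ s₁ s₂ t₁ t₂ : α.Plus, [s₁, s₂] ∈ sigmaChains 2 α.plus →
      [t₁, t₂] ∈ sigmaChains 2 α.plus → content α s₁ = content α t₁ →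
      (infPow (s₂ * omegaPow t₂) : α.Inf) = OmegaSemigroup.act (omegaPow (s₂ * omegaPow t₂))
        (OmegaSemigroup.act s₁ (infPow t₁)))
    {β : ℕ → ℕ} (hβ : StrictMono β) (hβ0 : 0 < β 0) {s : Bool} (hσ : ∀ n, σ (β n) = s)
    {x : α.Plus} (hx : ∀ n, prodIco c (β n) (β (n + 1)) = x)
    (ht : ∃ t, [e s, t] ∈ sigmaChains 2 α.plus ∧ x * t = x) :
    v s = OmegaSemigroup.act (prodIco c 0 (β 0)) (infPow x) := by
  set N := omegaExp α.Plus with hN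
  -- At a late level the first `N + 1` factors have reached their limits.
  obtain ⟨J, hJ⟩ := hc (β (N + 1))
  obtain ⟨q, hq⟩ : ∃ q, J ≤ N + 1 + q + 1 := ⟨J, by omega⟩
  set m := N + 1 + q + 1 with hm
  have hJm : J ≤ β m := hq.trans hβ.le_apply
  have h0 : 0 < β (N + 1) := lt_of_lt_of_le (by omega) (hβ.le_apply (x := N + 1))
  have h1 : β 0 < β (N + 1) := hβ (by omega)
  have h2 : β (N + 1) < β m := hβ (by omega)
  obtain ⟨t, ht, hxt⟩ := ht
  have hy : prodIco c (β (N + 1)) (β m) = sPow x q := prodIco_eq_sPow hβ hx (N + 1) q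
  have hyt : sPow x q * omegaPow t = sPow x q := by
    refine mul_sPow_eq ?_ _
    cases q with
    | zero => exact hxt
    | succ q =>
      have h3 := sPow_add x q 0
      rw [add_zero] at h3
      rw [h3, mul_assoc]
      exact congrArg _ hxt
  -- The equation is applied to the product `s₁` of the factors in the tail, whose limit is a power
  -- of `x` and absorbs `t`, and to the idempotent `t₁ = e s` that ends the factorization.
  have h3 := hid _ _ _ _ (hy ▸ h.chain_limit hc h2 le_rfl) ht (h.content_eq _ _ _ s h0 h2 le_rfl)
  rw [hyt, infPow_sPow, omegaPow_sPow] at h3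
  have h4 := h.inf_eq (β m) (by omega)
  rw [hσ, ← prodIco_mul _ h0 h2, OmegaSemigroup.mul_act,
    prodIco_congr h0 fun i _ hi => hJ (β m) hJm i hi, ← prodIco_mul _ hβ0 h1,
    OmegaSemigroup.mul_act] at h4
  have h5 : prodIco c (β 0) (β (N + 1)) = omegaPow x := by
    have := prodIco_eq_sPow hβ hx 0 N
    rwa [Nat.zero_add] at this
  rw [h4, h5, ← h3]

end IsScheme

/-- The levels alternate between long intervals for the two words. Along suitable levels `β n` in
intervals for the first word and `γ n` in intervals for the second, with `β n < γ n < β (n + 1)`,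
the limits of the factors between `β n` and `γ n` and between `γ n` and `β (n + 1)` are constants
`x` and `y`. So the two words have the images `q (x y)^∞` and `q x (y x)^∞`, which are equal. -/
theorem hasBoundedAlternation_inf_of_plus [Finite A] {L : Set (ℕ → A)} (hα : IsCompletedSyntactic L α)
    (hb : HasBoundedAlternation 2 α.plus)
    (hid : ∀ s₁ s₂ t₁ t₂ : α.Plus, [s₁, s₂] ∈ sigmaChains 2 α.plus →
      [t₁, t₂] ∈ sigmaChains 2 α.plus → content α s₁ = content α t₁ →
      (infPow (s₂ * omegaPow t₂) : α.Inf) = OmegaSemigroup.act (omegaPow (s₂ * omegaPow t₂))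
        (OmegaSemigroup.act s₁ (infPow t₁))) : HasBoundedAlternation 2 α.inf := by
  have := hα.finite_plus
  have := hα.finite_inf
  by_contra hinf
  set M := Nat.card α.Plus + 2 with hM
  let σ : ℕ → Bool := fun j => decide (j / M % 2 = 1)
  obtain ⟨e, v, d, h, hv⟩ := exists_isScheme hα.compatible hinf σ
  obtain ⟨c, hc⟩ := h.exists_limit hb
  have hdiv : ∀ r j, r * M ≤ j → j < r * M + M → j / M = r := fun r j h1 h2 =>
    Nat.div_eq_of_lt_le h1 (by rwa [add_mul, one_mul])
  have level : ∀ r, ∃ b t, 1 ≤ r → r * M < b ∧ b < r * M + M ∧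
      [e (decide (r % 2 = 1)), t] ∈ sigmaChains 2 α.plus ∧
      prodIco c (r * M) b * t = prodIco c (r * M) b := by
    intro r
    rcases Nat.eq_zero_or_pos r with rfl | hr
    · exact ⟨0, d 0 0, by omega⟩
    · obtain ⟨b, t, h1⟩ := h.exists_stable_level hc (a := r * M) (s := decide (r % 2 = 1))
        (Nat.mul_pos hr (by omega)) (fun j h1 h2 => by
          change decide (j / M % 2 = 1) = _
          rw [hdiv r j h1 h2])
      exact ⟨b, t, fun _ => h1⟩
  choose b t hbt using level
  have hlt : ∀ r r', 1 ≤ r → r < r' → b r < r' * M := by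
    intro r r' hr hrr'
    have h1 := (hbt r hr).2.1
    have h2 : (r + 1) * M ≤ r' * M := Nat.mul_le_mul_right M hrr'
    rw [add_mul, one_mul] at h2
    omega
  have hbb : ∀ r r', 1 ≤ r → r < r' → b r < b r' := fun r r' hr hrr' =>
    (hlt r r' hr hrr').trans (hbt r' (by omega)).1
  have hfix : ∀ r r', 1 ≤ r → r < r' →
      prodIco c (b r) (b r') * t r' = prodIco c (b r) (b r') := by
    intro r r' hr hrr'
    obtain ⟨h1, -, -, h2⟩ := hbt r' (by omega)
    rw [← prodIco_mul c (hlt r r' hr hrr') h1, mul_assoc, h2]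
  have hσ : ∀ r, 1 ≤ r → σ (b r) = decide (r % 2 = 1) := by
    intro r hr
    obtain ⟨h1, h2, -⟩ := hbt r hr
    change decide (b r / M % 2 = 1) = _
    rw [hdiv r _ h1.le h2]
  obtain ⟨k, ⟨x, y⟩, hk, hk0, hxy⟩ := exists_monochromatic fun i i' : ℕ =>
    (prodIco c (b (2 * i)) (b (2 * i + 1)), prodIco c (b (2 * i + 1)) (b (2 * i')))
  simp only [Prod.mk.injEq] at hxy
  have hkpos : ∀ n, 1 ≤ k n := fun n => hk0.trans_le (hk.monotone (Nat.zero_le n))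
  have hkk : ∀ n, k n < k (n + 1) := fun n => hk (Nat.lt_add_one n)
  have hβγ : ∀ n, b (2 * k n) < b (2 * k n + 1) := fun n =>
    hbb _ _ (by have := hkpos n; omega) (by omega)
  have hγβ : ∀ n, b (2 * k n + 1) < b (2 * k (n + 1)) := fun n =>
    hbb _ _ (by omega) (by have := hkk n; omega)
  have hβ : ∀ n, prodIco c (b (2 * k n)) (b (2 * k (n + 1))) = x * y := fun n => by
    rw [← prodIco_mul c (hβγ n) (hγβ n), (hxy n).1, (hxy n).2]
  have hγ : ∀ n, prodIco c (b (2 * k n + 1)) (b (2 * k (n + 1) + 1)) = y * x := fun n => by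
    rw [← prodIco_mul c (hγβ n) (hβγ (n + 1)), (hxy n).2, (hxy (n + 1)).1]
  have hβ0 : 0 < b (2 * k 0) := by
    have := (hbt (2 * k 0) (by omega)).1
    omega
  have h1 := h.inf_eq_limit hc hid (β := fun n => b (2 * k n)) (s := false) (x := x * y)
    (strictMono_nat_of_lt_succ fun n => (hβγ n).trans (hγβ n)) hβ0
    (fun n => by
      rw [hσ _ (by have := hkpos n; omega)]
      simp) hβ ⟨t (2 * k 1), by
        have h2 := (hbt (2 * k 1) (by have := hkpos 1; omega)).2.2.1
        rwa [show decide (2 * k 1 % 2 = 1) = false by simp] at h2, by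
        rw [← hβ 0]
        exact hfix _ _ (by have := hkpos 0; omega) (by have := hkk 0; omega)⟩
  have h2 := h.inf_eq_limit hc hid (β := fun n => b (2 * k n + 1)) (s := true) (x := y * x)
    (strictMono_nat_of_lt_succ fun n => (hγβ n).trans (hβγ (n + 1))) (hβ0.trans (hβγ 0))
    (fun n => by
      rw [hσ _ (by omega)]
      simp [Nat.add_mod]) hγ ⟨t (2 * k 1 + 1), by
        have h2 := (hbt (2 * k 1 + 1) (by omega)).2.2.1
        rwa [show decide ((2 * k 1 + 1) % 2 = 1) = true by simp [Nat.add_mod]] at h2, by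
        rw [← hγ 0]
        exact hfix _ _ (by omega) (by have := hkk 0; omega)⟩
  apply hv
  rw [h1, h2, ← prodIco_mul c hβ0 (hβγ 0), (hxy 0).1, OmegaSemigroup.mul_act, ← infPow_mul]

end
end OmegaLang

theorem mainTheorem3 {A : Type u} [Finite A] (L : Set (ℕ → A)) (hL : OmegaLang.IsRegular L)
    (α : OmegaLang.OmegaMorphism A)
    (hα : α = OmegaLang.alphabetCompletion (OmegaLang.syntacticMorphism L hL)) :
    List.TFAE [
      OmegaLang.BSigmaDefinable 2 L,
      OmegaLang.HasBoundedAlternation 2 α.inf,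
      OmegaLang.HasBoundedAlternation 2 α.plus ∧
        ∀ s₁ s₂ t₁ t₂ : α.Plus,
          [s₁, s₂] ∈ OmegaLang.sigmaChains 2 α.plus →
          [t₁, t₂] ∈ OmegaLang.sigmaChains 2 α.plus →
          OmegaLang.content α s₁ = OmegaLang.content α t₁ →
          (OmegaLang.infPow (s₂ * OmegaLang.omegaPow t₂) : α.Inf) =
            OmegaLang.OmegaSemigroup.act (OmegaLang.omegaPow (s₂ * OmegaLang.omegaPow t₂))
              (OmegaLang.OmegaSemigroup.act s₁ (OmegaLang.infPow t₁))] := by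
  have h : OmegaLang.IsCompletedSyntactic L α := by
    rw [hα]
    exact OmegaLang.isCompletedSyntactic_alphabetCompletion L hL
  tfae_have 1 → 2 := OmegaLang.hasBoundedAlternation_inf_of_bSigmaDefinable h
  tfae_have 2 → 1 := OmegaLang.bSigmaDefinable_of_hasBoundedAlternation_inf h
  tfae_have 2 → 3 := fun h2 => ⟨OmegaLang.hasBoundedAlternation_plus_of_inf h h2,
    fun _ _ _ _ hs ht hst => OmegaLang.infPow_eq_of_hasBoundedAlternation_inf h h2 hs ht hst⟩
  tfae_have 3 → 2 := fun h3 => OmegaLang.hasBoundedAlternation_inf_of_plus h h3.1 h3.2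
  tfae_finish
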